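/- Let $M$ be a compact complex manifold of complex dimension $n$ with a smooth Kähler form $\omega=\sqrt{-1}\,g_{i\bar j}\,dz^i\wedge d\bar z^j$, Ricci form $\mathrm{Ric}=\sqrt{-1}\,R_{i\bar j}\,dz^i\wedge d\bar z^j$, $R_{i\bar j}=-\partial_i\partial_{\bar j}\log\det(g_{k\bar l})$, and average scalar curvature $\underline R=\int_M (\mathrm{tr}_\omega \mathrm{Ric})\,\omega^n\big/\int_M\omega^n$. Let $\mathcal H^{1,1}_{w+}$ be the set of real functions $u\in L^\infty(M)$ whose distributional complex Hessian $\partial\bar\partial u$ is in $L^\infty$ and for which $\omega_u:=\omega+\sqrt{-1}\partial\bar\partial u\ge\varepsilon\omega$ almost everywhere for some $\varepsilon>0$. Products of these $L^\infty$ forms are taken pointwise almost everywhere. For $u\in\mathcal H^{1,1}_{w+}$ put $V_u=\log\frac{\omega_u^n}{\omega^n}$ and define the K-energy by Chen's formula $$\mathcal K(u)=\frac{\underline R}{n+1}\sum_{j=0}^{n}\int_M u\,\omega_u^j\wedge\omega^{n-j}-\sum_{j=0}^{n-1}\int_M u\,\mathrm{Ric}\wedge\omega_u^j\wedge\omega^{n-1-j}+\int_M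 V_u\,\omega_u^n .$$ Call $u$ a weak solution of $R_u=\underline R$ if for every $\psi\in C^{1,1}(M)$ $$-\int_M V_u\,\Delta_u\psi\;\omega_u^n=\int_M\psi\,\bigl(\underline R-g_u^{i\bar j}R_{i\bar j}\bigr)\,\omega_u^n,\qquad \Delta_u\psi=g_u^{i\bar j}\partial_i\partial_{\bar j}\psi ,$$ where $g_u^{i\bar j}$ is the inverse of $(g_u)_{i\bar j}=g_{i\bar j}+\partial_i\partial_{\bar j}u$. Call $u$ a critical point of $\mathcal K$ (among smooth variations) if $\frac{d}{dt}\big|_{t=0}\mathcal K(u+t\psi)=0$ for every $\psi\in C^\infty(M;\mathbb R)$. **Proposition.** Let $u\in\mathcal H^{1,1}_{w+}$. 1. For every $\psi\in C^\infty(M;\mathbb R)$, $u+t\psi\in\mathcal H^{1,1}_{w+}$ for all $t$ close to $0$, the function $t\mapsto\mathcal K(u+t\psi)$ is differentiable at $t=0$, and $$\frac{d}{dt}\Big|_{t=0}\mathcal K(u+t\psi)=\underline R\int_M\psi\,\omega_u^n-n\int_M\psi\,\mathrm{Ric}\wedge\omega_u^{n-1}+n\int_M V_u\,\sqrt{-1}\partial\bar\partial\psi\wedge\omega_u^{n-1}.$$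 2. $u$ is a weak solution of $R_u=\underline R$ if and only if $u$ is a critical point of $\mathcal K$. 3. If $\mathcal K(u)\le\mathcal K(v)$ for all $v\in\mathcal H^{1,1}_{w+}$, then $u$ is a weak solution of $R_u=\underline R$. -/

import Mathlib

open Set Filter Topology MeasureTheory
open scoped Manifold ContDiff ComplexOrder

noncomputable section

namespace WeakCSCK

/-- The model space of an `n`-dimensional complex manifold. -/
abbrev Model (n : ℕ) : Type := Fin n → ℂ

/-! ### Wirtinger derivatives on `ℂⁿ` -/

/-- `∂F/∂zᵢ = (∂F/∂xᵢ - √-1 ∂F/∂yᵢ) / 2`. -/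
def dz {n : ℕ} (i : Fin n) (F : Model n → ℂ) (z : Model n) : ℂ :=
  (1 / 2 : ℂ) * (fderiv ℝ F z (Pi.single i 1) - Complex.I * fderiv ℝ F z (Pi.single i Complex.I))

/-- `∂F/∂z̄ⱼ = (∂F/∂xⱼ + √-1 ∂F/∂yⱼ) / 2`. -/
def dzbar {n : ℕ} (j : Fin n) (F : Model n → ℂ) (z : Model n) : ℂ :=
  (1 / 2 : ℂ) * (fderiv ℝ F z (Pi.single j 1) + Complex.I * fderiv ℝ F z (Pi.single j Complex.I))

/-- The pointwise complex Hessian `(∂ᵢ∂_{j̄} f)` of a real function on `ℂⁿ`. -/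
def complexHessian {n : ℕ} (f : Model n → ℝ) (z : Model n) : Matrix (Fin n) (Fin n) ℂ :=
  Matrix.of fun i j => dz i (dzbar j fun w => (f w : ℂ)) z

/-- The coefficient of `α₁ ∧ ⋯ ∧ αₙ` with respect to `(√-1)ⁿ dz₁ ∧ dz̄₁ ∧ ⋯ ∧ dzₙ ∧ dz̄ₙ`, where
`αₖ = √-1 ∑ᵢⱼ (Aₖ)ᵢⱼ dzᵢ ∧ dz̄ⱼ` are real (1,1)-forms, i.e. the matrices `Aₖ` are Hermitian
(the sum is then a real number). -/
def wedge {n : ℕ} (A : Fin n → Matrix (Fin n) (Fin n) ℂ) : ℝ :=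
  (∑ σ : Equiv.Perm (Fin n), ∑ τ : Equiv.Perm (Fin n),
    ((Equiv.Perm.sign σ : ℤ) : ℂ) * ((Equiv.Perm.sign τ : ℤ) : ℂ) * ∏ k, A k (σ k) (τ k)).re

section Manifold

variable {n : ℕ} {M : Type*} [TopologicalSpace M]

/-- Local coefficient matrices `(A e)ᵢⱼ`, one for each chart `e` (only the charts of the atlas
matter), of a real (1,1)-form `√-1 ∑ᵢⱼ (A e)ᵢⱼ dzᵢ ∧ dz̄ⱼ`. -/
abbrev LocalForm (n : ℕ) (M : Type*) [TopologicalSpace M] : Type _ :=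
  OpenPartialHomeomorph M (Model n) → Model n → Matrix (Fin n) (Fin n) ℂ

/-- Local coefficients of an (n,n)-form, or local expressions of a function. -/
abbrev LocalFun (n : ℕ) (M : Type*) [TopologicalSpace M] : Type _ :=
  OpenPartialHomeomorph M (Model n) → Model n → ℝ

/-- The complex Jacobian matrix `∂τₐ/∂zᵢ` of the transition map `τ = e' ∘ e⁻¹`. -/
def transitionJacobian (e e' : OpenPartialHomeomorph M (Model n)) (z : Model n) :
    Matrix (Fin n) (Fin n) ℂ :=
  Matrix.of fun a i => fderiv ℂ (fun w => e' (e.symm w)) z (Pi.single i 1) a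

/-- A smooth Kähler metric `ω = √-1 ∑ gᵢⱼ dzᵢ ∧ dz̄ⱼ` on `M`, given by its coefficients in the
charts of the atlas. -/
structure KahlerMetric (n : ℕ) (M : Type*) [TopologicalSpace M] [ChartedSpace (Model n) M] where
  /-- The coefficients `gᵢⱼ` in each chart. -/
  coeff : LocalForm n M
  smooth : ∀ e ∈ atlas (Model n) M, ∀ i j, ContDiffOn ℝ ∞ (fun z => coeff e z i j) e.target
  posDef : ∀ e ∈ atlas (Model n) M, ∀ z ∈ e.target, (coeff e z).PosDef
  /-- `gᵢⱼ = ∑ₐᵦ (∂τₐ/∂zᵢ) (g'ₐᵦ ∘ τ) conj(∂τᵦ/∂zⱼ)` on overlaps. -/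
  transform : ∀ e ∈ atlas (Model n) M, ∀ e' ∈ atlas (Model n) M, ∀ z ∈ e.target,
    e.symm z ∈ e'.source →
      coeff e z = (transitionJacobian e e' z).transpose * coeff e' (e' (e.symm z)) *
        (transitionJacobian e e' z).map (starRingEnd ℂ)
  /-- `dω = 0`, i.e. `∂ₖ gᵢⱼ = ∂ᵢ gₖⱼ`. -/
  closed : ∀ e ∈ atlas (Model n) M, ∀ z ∈ e.target, ∀ i j k,
    dz k (fun w => coeff e w i j) z = dz i (fun w => coeff e w k j) z

/-- The Ricci form `Rᵢⱼ = -∂ᵢ∂_{j̄} log det g`. -/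
def ricci [ChartedSpace (Model n) M] (ω₀ : KahlerMetric n M) : LocalForm n M :=
  fun e z => -complexHessian (fun w => Real.log (ω₀.coeff e w).det.re) z

/-- The local expression of a function on `M`. -/
def localExpr (f : M → ℝ) : LocalFun n M := fun e z => f (e.symm z)

/-- `√-1 ∂∂̄ψ` computed with pointwise derivatives (almost everywhere defined if `ψ` is
`C^{1,1}`). -/
def ddbar (ψ : M → ℝ) : LocalForm n M := fun e z => complexHessian (localExpr ψ e) z

/-- The matrix function `H` is locally integrable and is the complex Hessian `(∂ᵢ∂_{j̄} u)`, in
the sense of distributions, of `u` in the chart `e`. -/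
def IsWeakDdbar (e : OpenPartialHomeomorph M (Model n)) (u : M → ℝ)
    (H : Model n → Matrix (Fin n) (Fin n) ℂ) : Prop :=
  ∀ i j, LocallyIntegrableOn (fun z => H z i j) e.target volume ∧
    ∀ χ : Model n → ℝ, ContDiff ℝ ∞ χ → HasCompactSupport χ → tsupport χ ⊆ e.target →
      ∫ z in e.target, (localExpr u e z : ℂ) * complexHessian χ z i j =
        ∫ z in e.target, H z i j * (χ z : ℂ)

open Classical in
/-- The distributional `√-1 ∂∂̄u` (almost everywhere unique when it is a locally integrable
form; zero by convention if there is none). -/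
def weakDdbar (u : M → ℝ) : LocalForm n M := fun e =>
  if h : ∃ H, IsWeakDdbar e u H then h.choose else 0

/-- `ψ` is of class `C^{1,1}`: continuously differentiable with locally Lipschitz derivative in
every chart. -/
def IsC11 (n : ℕ) [ChartedSpace (Model n) M] (ψ : M → ℝ) : Prop :=
  ∀ e ∈ atlas (Model n) M, ContDiffOn ℝ 1 (localExpr (n := n) ψ e) e.target ∧
    LocallyLipschitzOn e.target (fderiv ℝ (localExpr (n := n) ψ e))

/-- `ψ` is a smooth real function on `M`. -/
def IsSmooth (n : ℕ) [ChartedSpace (Model n) M] (ψ : M → ℝ) : Prop :=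
  ContMDiff 𝓘(ℝ, Model n) 𝓘(ℝ, ℝ) ∞ ψ

/-! ### Integration of (n,n)-forms -/

/-- A partition of unity subordinate to the (preferred) charts of the compact manifold `M`. -/
lemma exists_partition [ChartedSpace (Model n) M] [CompactSpace M] [T2Space M] :
    ∃ ρ : PartitionOfUnity M M univ, ρ.IsSubordinate fun x => (chartAt (Model n) x).source :=
  PartitionOfUnity.exists_isSubordinate isClosed_univ _
    (fun x => (chartAt (Model n) x).open_source)
    (fun x _ => mem_iUnion.2 ⟨x, mem_chart_source (Model n) x⟩)

variable (n M) in
/-- A chosen partition of unity. -/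
def partition [ChartedSpace (Model n) M] [CompactSpace M] [T2Space M] :
    PartitionOfUnity M M univ :=
  (exists_partition (n := n) (M := M)).choose

/-- The integral over `M` of the (n,n)-form with coefficient `α e` with respect to
`(√-1)ⁿ dz₁ ∧ dz̄₁ ∧ ⋯ ∧ dzₙ ∧ dz̄ₙ` (which is `2ⁿ` times Lebesgue measure) in the chart `e`,
through a partition of unity. By compactness only finitely many summands are non-zero. -/
def integral [ChartedSpace (Model n) M] [CompactSpace M] [T2Space M] (α : LocalFun n M) : ℝ :=
  ∑ᶠ x : M, ∫ z in (chartAt (Model n) x).target,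
    partition n M x ((chartAt (Model n) x).symm z) * (2 ^ n * α (chartAt (Model n) x) z)

/-! ### `L^∞` Kähler metrics -/

variable [ChartedSpace (Model n) M]

/-- `ω_u = ω + √-1 ∂∂̄u`. -/
def perturbed (ω₀ : KahlerMetric n M) (u : M → ℝ) : LocalForm n M :=
  fun e z => ω₀.coeff e z + weakDdbar u e z

/-- The space `H^{1,1}_{w+}`: functions `u ∈ L^∞` with `∂∂̄u ∈ L^∞` (both measured with `ω`)
such that `ω_u ≥ ε ω` almost everywhere for some `ε > 0`. -/
def HwPlus (ω₀ : KahlerMetric n M) : Set (M → ℝ) :=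
  {u | (∀ e ∈ atlas (Model n) M,
          AEStronglyMeasurable (localExpr u e) (volume.restrict e.target)) ∧
       (∃ C : ℝ, ∀ e ∈ atlas (Model n) M, ∀ᵐ z ∂(volume.restrict e.target),
          |localExpr u e z| ≤ C) ∧
       (∀ e ∈ atlas (Model n) M, IsWeakDdbar e u (weakDdbar u e)) ∧
       (∃ L : ℝ, ∀ e ∈ atlas (Model n) M, ∀ᵐ z ∂(volume.restrict e.target),
          (L • ω₀.coeff e z - weakDdbar u e z).PosSemidef ∧
          (L • ω₀.coeff e z + weakDdbar u e z).PosSemidef) ∧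
       (∃ ε : ℝ, 0 < ε ∧ ∀ e ∈ atlas (Model n) M, ∀ᵐ z ∂(volume.restrict e.target),
          (perturbed ω₀ u e z - ε • ω₀.coeff e z).PosSemidef)}

/-- The trace `tr_G A = G^{i j̄} A_{i j̄}`. -/
def traceWrt (G A : LocalForm n M) : LocalFun n M := fun e z => ((G e z)⁻¹ * A e z).trace.re

/-- The (n,n)-form `Gⁿ`. -/
def topPow (G : LocalForm n M) : LocalFun n M := fun e z => wedge fun _ => G e z

/-- The (n,n)-form `Gʲ ∧ B^{n-j}`, for `j ≤ n`. -/
def mixedPow (G B : LocalForm n M) (j : ℕ) : LocalFun n M :=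
  fun e z => wedge fun k => if (k : ℕ) < j then G e z else B e z

/-- The (n,n)-form `A ∧ Gʲ ∧ B^{n-1-j}`, for `j ≤ n - 1` and `n ≥ 1`. -/
def mixedPowWith (A G B : LocalForm n M) (j : ℕ) : LocalFun n M :=
  fun e z => wedge fun k => if (k : ℕ) = 0 then A e z else if (k : ℕ) ≤ j then G e z else B e z

/-- The log volume ratio `V_u = log (ω_uⁿ / ωⁿ) = log (det (g + ∂∂̄u) / det g)`. -/
def logRatio (ω₀ : KahlerMetric n M) (u : M → ℝ) : LocalFun n M :=
  fun e z => Real.log ((perturbed ω₀ u e z).det.re / (ω₀.coeff e z).det.re)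

variable [CompactSpace M] [T2Space M]

/-- The average scalar curvature `R̲ = ∫ (tr_ω Ric) ωⁿ / ∫ ωⁿ`. -/
def avgScalar (ω₀ : KahlerMetric n M) : ℝ :=
  integral (traceWrt ω₀.coeff (ricci ω₀) * topPow ω₀.coeff) / integral (topPow ω₀.coeff)

/-- `u` is a (`Δ`-)weak solution of `R_u = f`: for every `ψ ∈ C^{1,1}`,
`-∫ V_u Δ_u ψ ω_uⁿ = ∫ ψ (f - g_u^{i j̄} Rᵢⱼ) ω_uⁿ`. -/
def IsWeakSolution (ω₀ : KahlerMetric n M) (u f : M → ℝ) : Prop :=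
  ∀ ψ : M → ℝ, IsC11 n ψ →
    -integral (logRatio ω₀ u * traceWrt (perturbed ω₀ u) (ddbar ψ) * topPow (perturbed ω₀ u)) =
      integral (localExpr ψ * (localExpr f - traceWrt (perturbed ω₀ u) (ricci ω₀)) *
        topPow (perturbed ω₀ u))

/-- `E(u) = ∑_{j=0}^{n} ∫ u ω_uʲ ∧ ω^{n-j}`. -/
def energy (ω₀ : KahlerMetric n M) (u : M → ℝ) : ℝ :=
  ∑ j ∈ Finset.range (n + 1), integral (localExpr u * mixedPow (perturbed ω₀ u) ω₀.coeff j)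

/-- `E_Ric(u) = ∑_{j=0}^{n-1} ∫ u Ric ∧ ω_uʲ ∧ ω^{n-1-j}`. -/
def energyRic (ω₀ : KahlerMetric n M) (u : M → ℝ) : ℝ :=
  ∑ j ∈ Finset.range n,
    integral (localExpr u * mixedPowWith (ricci ω₀) (perturbed ω₀ u) ω₀.coeff j)

/-- Chen's formula for the K-energy,
`K(u) = R̲/(n+1) E(u) - E_Ric(u) + ∫ log (ω_uⁿ / ωⁿ) ω_uⁿ`. -/
def kEnergy (ω₀ : KahlerMetric n M) (u : M → ℝ) : ℝ :=
  avgScalar ω₀ / (n + 1) * energy ω₀ u - energyRic ω₀ u +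
    integral (logRatio ω₀ u * topPow (perturbed ω₀ u))

/-- The first variation
`R̲ ∫ ψ ω_uⁿ - n ∫ ψ Ric ∧ ω_u^{n-1} + n ∫ log (ω_uⁿ / ωⁿ) √-1 ∂∂̄ψ ∧ ω_u^{n-1}`. -/
def firstVariation (ω₀ : KahlerMetric n M) (u ψ : M → ℝ) : ℝ :=
  avgScalar ω₀ * integral (localExpr ψ * topPow (perturbed ω₀ u)) -
    n * integral (localExpr ψ *
      mixedPowWith (ricci ω₀) (perturbed ω₀ u) (perturbed ω₀ u) (n - 1)) +
    n * integral (logRatio ω₀ u *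
      mixedPowWith (ddbar ψ) (perturbed ω₀ u) (perturbed ω₀ u) (n - 1))

/-- `u` is a critical point of the K-energy among smooth variations. -/
def IsCriticalPoint (ω₀ : KahlerMetric n M) (u : M → ℝ) : Prop :=
  ∀ ψ : M → ℝ, IsSmooth n ψ → HasDerivAt (fun t : ℝ => kEnergy ω₀ fun x => u x + t * ψ x) 0 0

end Manifold

end WeakCSCK

end

/-!
Almost everywhere `ω_{u+tψ} = ω_u + t √-1 ∂∂̄ψ`, and `∂∂̄ψ` is bounded by a multiple of `ω`.
Hence, for small `t`, these forms are bounded above and below by multiples of `ω`, uniformly in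
`t` (`exists_uniform_pos`): `u + tψ` stays in the space, and the K-energy can be differentiated
under the integral sign, the integrands being polynomials and logarithms in bounded coefficients.

The derivative so obtained becomes the stated one by integration by parts
(`integral_mul_wedge_ddbar`), `∫ v √-1 ∂∂̄ψ ∧ α = ∫ ψ √-1 ∂∂̄v ∧ α`, where `ψ` is smooth, `v` has
bounded complex Hessian, and `α` is a product of `n - 1` closed forms, each of which is a smooth
form plus a multiple of `√-1 ∂∂̄u`. After a partition of unity it is a statement in one chart. For
smooth functions it holds because the cofactors of closed forms are divergence free
(`integral_mul_wedgeC_complexHessian`). In general `u` and `v` are mollified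
(`WeakHess.exists_smooth_approx`): the complex Hessian of a mollification is the mollification of
the weak one, so it is bounded and converges almost everywhere, and the wedge products converge
boundedly although they are not linear in `u` (`WeakHess.integral_mul_wedgeC`). Mollification also
shows that the weak complex Hessian transforms as a (1,1)-form under changes of charts, which
makes the integrals independent of the charts.

* Energies. In the derivative of `∫ u ω_u^j ∧ β` each factor `ω_u` contributes `∫ u √-1 ∂∂̄ψ ∧
  ω_u^{j-1} ∧ β`, where `∂∂̄` moves to `u`, and `√-1 ∂∂̄u = ω_u - ω`. The sum over `j` then
  telescopes (`hasDerivAt_sum_slotPow`). This applies with `β` a power of `ω`, and with `β` the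
  product of such a power and the Ricci form.
* Entropy. The derivative of `V_u ω_u^n` is `(1 + V_u) n √-1 ∂∂̄ψ ∧ ω_u^{n-1}`, and the integral
  of `√-1 ∂∂̄ψ ∧ ω_u^{n-1}` vanishes by integration by parts with `v = 1` (`hasDerivAt_entropy`).

Since `n A ∧ ω_u^{n-1} = (tr_{ω_u} A) ω_u^n` (`trace_mul_wedge_const`), the weak equation tested
against `ψ` says exactly that the first variation along `ψ` is zero (`weak_equation_iff`).
Critical points test smooth `ψ` only. The first variation has the form `∫ ψ α + ∫ V √-1 ∂∂̄ψ ∧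
ω_u^{n-1}` with bounded coefficients, and a function of class `C^{1,1}` is a limit of smooth
functions with bounded and almost everywhere convergent complex Hessians, so that its vanishing
extends to test functions of class `C^{1,1}` (`functional_eq_zero`). A minimizer is a critical
point because `t = 0` is a local minimum of `t ↦ 𝒦(u + tψ)`.
-/


namespace WeakCSCK

/-! ### Mixed discriminants of complex matrices -/

/-- The mixed discriminant of `n` complex matrices, that is the complex number whose real part is
`wedge A`. -/
noncomputable def wedgeC {n : ℕ} (A : Fin n → Matrix (Fin n) (Fin n) ℂ) : ℂ :=
  ∑ σ : Equiv.Perm (Fin n), ∑ τ : Equiv.Perm (Fin n),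
    ((Equiv.Perm.sign σ : ℤ) : ℂ) * ((Equiv.Perm.sign τ : ℤ) : ℂ) * ∏ k, A k (σ k) (τ k)

section LinearAlgebra

variable {n : ℕ} (A : Fin n → Matrix (Fin n) (Fin n) ℂ)

lemma wedge_eq_re_wedgeC : wedge A = (wedgeC A).re := rfl

lemma wedgeC_eq_sum_det :
    wedgeC A = ∑ σ : Equiv.Perm (Fin n), ((Equiv.Perm.sign σ : ℤ) : ℂ) *
      (Matrix.of fun k l => A k (σ k) l).det := by
  refine Finset.sum_congr rfl fun σ _ => ?_
  rw [← Matrix.det_transpose, Matrix.det_apply', Finset.mul_sum]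
  exact Finset.sum_congr rfl fun τ _ => by simp [mul_assoc]

lemma wedgeC_eq_sum_det' :
    wedgeC A = ∑ τ : Equiv.Perm (Fin n), ((Equiv.Perm.sign τ : ℤ) : ℂ) *
      (Matrix.of fun k l => A l k (τ l)).det := by
  rw [wedgeC, Finset.sum_comm]
  refine Finset.sum_congr rfl fun σ _ => ?_
  rw [Matrix.det_apply', Finset.mul_sum]
  exact Finset.sum_congr rfl fun τ _ => by simp; ring

lemma wedgeC_mul_right (Q : Matrix (Fin n) (Fin n) ℂ) :
    wedgeC (fun k => A k * Q) = wedgeC A * Q.det := by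
  rw [wedgeC_eq_sum_det, wedgeC_eq_sum_det, Finset.sum_mul]
  refine Finset.sum_congr rfl fun σ _ => ?_
  rw [mul_assoc, ← Matrix.det_mul]
  congr 2

lemma wedgeC_mul_left (P : Matrix (Fin n) (Fin n) ℂ) :
    wedgeC (fun k => P * A k) = P.det * wedgeC A := by
  rw [wedgeC_eq_sum_det', wedgeC_eq_sum_det', Finset.mul_sum]
  refine Finset.sum_congr rfl fun σ _ => ?_
  rw [mul_left_comm, ← Matrix.det_mul]
  congr 2

lemma wedge_transform (J : Matrix (Fin n) (Fin n) ℂ) :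
    wedge (fun k => J.transpose * A k * J.map (starRingEnd ℂ)) =
      Complex.normSq J.det * wedge A := by
  have h : (J.map (starRingEnd ℂ)).det = (starRingEnd ℂ) J.det :=
    (RingHom.map_det (starRingEnd ℂ) J).symm
  rw [wedge_eq_re_wedgeC, wedgeC_mul_right, wedgeC_mul_left (fun k => A k), h,
    Matrix.det_transpose, wedge_eq_re_wedgeC, mul_right_comm, Complex.mul_conj,
    Complex.re_ofReal_mul]

lemma wedgeC_comp_perm (π : Equiv.Perm (Fin n)) : wedgeC (fun k => A (π k)) = wedgeC A := by
  have h : ∀ σ τ : Equiv.Perm (Fin n),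
      ((Equiv.Perm.sign (σ * π) : ℤ) : ℂ) * ((Equiv.Perm.sign (τ * π) : ℤ) : ℂ) *
        ∏ k, A (π k) ((σ * π) k) ((τ * π) k) =
      ((Equiv.Perm.sign σ : ℤ) : ℂ) * ((Equiv.Perm.sign τ : ℤ) : ℂ) * ∏ k, A k (σ k) (τ k) := by
    intro σ τ
    rw [← Equiv.prod_comp π (fun k => A k (σ k) (τ k))]
    rcases Int.units_eq_one_or (Equiv.Perm.sign π) with h | h <;> simp [h]
  rw [wedgeC, ← Equiv.sum_comp (Equiv.mulRight π)]
  refine Finset.sum_congr rfl fun σ _ => ?_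
  rw [← Equiv.sum_comp (Equiv.mulRight π)]
  exact Finset.sum_congr rfl fun τ _ => h σ τ

lemma wedge_comp_perm (π : Equiv.Perm (Fin n)) : wedge (fun k => A (π k)) = wedge A := by
  rw [wedge_eq_re_wedgeC, wedgeC_comp_perm, wedge_eq_re_wedgeC]

/-- A distinguished entry can be moved to any other slot which carries the same form. -/
lemma wedge_update_swap (i j : Fin n) (X : Matrix (Fin n) (Fin n) ℂ) (h : A i = A j) :
    wedge (Function.update A i X) = wedge (Function.update A j X) := by
  rw [← wedge_comp_perm (Function.update A j X) (Equiv.swap i j)]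
  congr 1
  funext k
  by_cases hi : k = i
  · subst hi; simp
  · by_cases hj : k = j
    · subst hj
      rcases eq_or_ne i k with rfl | hik
      · exact absurd rfl hi
      · simp [hik, Function.update_of_ne (Ne.symm hik), h]
    · rw [Equiv.swap_apply_of_ne_of_ne hi hj]; simp [hi, hj]

/-- Expansion of a mixed discriminant along one slot. -/
lemma wedgeC_update (k₀ : Fin n) (X : Matrix (Fin n) (Fin n) ℂ) :
    wedgeC (Function.update A k₀ X) =
      ∑ σ : Equiv.Perm (Fin n), ∑ τ : Equiv.Perm (Fin n),
        ((Equiv.Perm.sign σ : ℤ) : ℂ) * ((Equiv.Perm.sign τ : ℤ) : ℂ) *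
          (X (σ k₀) (τ k₀) * ∏ k ∈ Finset.univ.erase k₀, A k (σ k) (τ k)) := by
  refine Finset.sum_congr rfl fun σ _ => Finset.sum_congr rfl fun τ _ => ?_
  rw [← Finset.mul_prod_erase _ _ (Finset.mem_univ k₀), Function.update_self]
  congr 2
  exact Finset.prod_congr rfl fun k hk => by
    rw [Function.update_of_ne (Finset.ne_of_mem_erase hk)]

lemma wedgeC_update_add (k₀ : Fin n) (X Y : Matrix (Fin n) (Fin n) ℂ) :
    wedgeC (Function.update A k₀ (X + Y)) =
      wedgeC (Function.update A k₀ X) + wedgeC (Function.update A k₀ Y) := by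
  simp only [wedgeC_update, ← Finset.sum_add_distrib]
  refine Finset.sum_congr rfl fun σ _ => Finset.sum_congr rfl fun τ _ => ?_
  rw [Matrix.add_apply]; ring

lemma wedgeC_update_smul (k₀ : Fin n) (c : ℂ) (X : Matrix (Fin n) (Fin n) ℂ) :
    wedgeC (Function.update A k₀ (c • X)) = c * wedgeC (Function.update A k₀ X) := by
  simp only [wedgeC_update, Finset.mul_sum]
  refine Finset.sum_congr rfl fun σ _ => Finset.sum_congr rfl fun τ _ => ?_
  rw [Matrix.smul_apply, smul_eq_mul]; ring

lemma wedge_update_add (k₀ : Fin n) (X Y : Matrix (Fin n) (Fin n) ℂ) :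
    wedge (Function.update A k₀ (X + Y)) =
      wedge (Function.update A k₀ X) + wedge (Function.update A k₀ Y) := by
  simp only [wedge_eq_re_wedgeC, wedgeC_update_add, Complex.add_re]

lemma wedge_update_smul (k₀ : Fin n) (c : ℝ) (X : Matrix (Fin n) (Fin n) ℂ) :
    wedge (Function.update A k₀ (c • X)) = c * wedge (Function.update A k₀ X) := by
  have := wedgeC_update_smul A k₀ c X
  rw [Complex.coe_smul] at this
  rw [wedge_eq_re_wedgeC, this, wedge_eq_re_wedgeC, Complex.re_ofReal_mul]

lemma wedge_update_sub (k₀ : Fin n) (X Y : Matrix (Fin n) (Fin n) ℂ) :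
    wedge (Function.update A k₀ (X - Y)) =
      wedge (Function.update A k₀ X) - wedge (Function.update A k₀ Y) := by
  have := wedge_update_add A k₀ (X - Y) Y
  rw [sub_add_cancel] at this
  linarith

lemma wedge_update_sum {ι : Type*} (s : Finset ι) (k₀ : Fin n)
    (X : ι → Matrix (Fin n) (Fin n) ℂ) :
    wedge (Function.update A k₀ (∑ i ∈ s, X i)) = ∑ i ∈ s, wedge (Function.update A k₀ (X i)) := by
  classical
  induction s using Finset.induction_on with
  | empty => simpa using wedge_update_smul A k₀ 0 0
  | insert i s hi ih => rw [Finset.sum_insert hi, Finset.sum_insert hi, wedge_update_add, ih]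

/-- `Gⁿ = n! det G`. -/
lemma wedgeC_const (G : Matrix (Fin n) (Fin n) ℂ) :
    wedgeC (fun _ => G) = (n.factorial : ℂ) * G.det := by
  have h1 : wedgeC (fun _ : Fin n => (1 : Matrix (Fin n) (Fin n) ℂ)) = n.factorial := by
    have : ∀ σ : Equiv.Perm (Fin n), ((Equiv.Perm.sign σ : ℤ) : ℂ) *
        (Matrix.of fun k l => (1 : Matrix (Fin n) (Fin n) ℂ) (σ k) l).det = 1 := by
      intro σ
      have h2 : (Matrix.of fun k l => (1 : Matrix (Fin n) (Fin n) ℂ) (σ k) l) =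
          (1 : Matrix (Fin n) (Fin n) ℂ).submatrix σ id := rfl
      rw [h2, Matrix.det_permute, Matrix.det_one, mul_one]
      rcases Int.units_eq_one_or (Equiv.Perm.sign σ) with h | h <;> simp [h]
    rw [wedgeC_eq_sum_det, Finset.sum_congr rfl fun σ _ => this σ]
    simp [Fintype.card_perm]
  have := wedgeC_mul_left (fun _ : Fin n => (1 : Matrix (Fin n) (Fin n) ℂ)) G
  simp only [mul_one] at this
  rw [this, h1, mul_comm]

/-- `n X ∧ Iⁿ⁻¹ = n! tr X`, the case of the standard metric in `trace_mul_wedge_const`. -/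
lemma wedgeC_update_one (k₀ : Fin n) (X : Matrix (Fin n) (Fin n) ℂ) :
    (n : ℂ) * wedgeC (Function.update (fun _ => 1) k₀ X) = (n.factorial : ℂ) * X.trace := by
  have h0 : ∀ k : Fin n, wedgeC (Function.update (fun _ => 1) k X) =
      wedgeC (Function.update (fun _ => 1) k₀ X) := by
    intro k
    rw [← wedgeC_comp_perm (Function.update (fun _ => 1) k₀ X) (Equiv.swap k k₀)]
    congr 1
    funext l
    by_cases hi : l = k
    · subst hi; simp
    · by_cases hj : l = k₀
      · subst hj; simp [hi, Function.update_of_ne (Ne.symm hi)]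
      · rw [Equiv.swap_apply_of_ne_of_ne hi hj]; simp [hi, hj]
  have h1 : (n : ℂ) * wedgeC (Function.update (fun _ => 1) k₀ X) =
      ∑ k : Fin n, wedgeC (Function.update (fun _ => 1) k X) := by
    simp [h0]
  -- only the pairs `σ = τ` contribute
  have h2 : ∀ k : Fin n, wedgeC (Function.update (fun _ => 1) k X) =
      ∑ σ : Equiv.Perm (Fin n), X (σ k) (σ k) := by
    intro k
    rw [wedgeC_update]
    refine Finset.sum_congr rfl fun σ _ => ?_
    rw [Finset.sum_eq_single σ]
    · rw [Finset.prod_eq_one fun k _ => by simp]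
      rcases Int.units_eq_one_or (Equiv.Perm.sign σ) with h | h <;> simp [h]
    · intro τ _ hτ
      obtain ⟨l, hlk, hl⟩ : ∃ l, l ≠ k ∧ σ l ≠ τ l := by
        by_contra! hc
        apply hτ
        ext l
        by_cases hlk : l = k
        · subst hlk
          by_contra hne
          obtain ⟨m, hm⟩ := σ.surjective (τ l)
          rcases eq_or_ne m l with rfl | hml
          · exact hne (congrArg _ hm.symm)
          · exact hml (τ.injective ((hc m hml).symm.trans hm))
        · rw [hc l hlk]
      have h0 : ∏ k ∈ Finset.univ.erase k, (1 : Matrix (Fin n) (Fin n) ℂ) (σ k) (τ k) = 0 :=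
        Finset.prod_eq_zero (Finset.mem_erase.2 ⟨hlk, Finset.mem_univ l⟩)
          (Matrix.one_apply_ne hl)
      rw [h0, mul_zero, mul_zero]
    · simp
  rw [h1, Finset.sum_congr rfl fun k _ => h2 k, Finset.sum_comm]
  have h3 : ∀ σ : Equiv.Perm (Fin n), ∑ k, X (σ k) (σ k) = X.trace := fun σ =>
    Equiv.sum_comp σ (fun k => X k k)
  simp [h3, Fintype.card_perm]

/-- `n A ∧ Gⁿ⁻¹ = tr(G⁻¹A) Gⁿ`. -/
lemma trace_mul_wedge_const (k₀ : Fin n) {G : Matrix (Fin n) (Fin n) ℂ} (hG : G.PosDef)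
    (X : Matrix (Fin n) (Fin n) ℂ) :
    (G⁻¹ * X).trace.re * wedge (fun _ => G) =
      n * wedge (Function.update (fun _ => G) k₀ X) := by
  have hdet : G.det ≠ 0 := hG.det_pos.ne'
  have him : G.det.im = 0 := (Complex.pos_iff.1 hG.det_pos).2.symm
  have h1 := wedgeC_mul_left (Function.update (fun _ => 1) k₀ (G⁻¹ * X)) G
  have h2 : (fun k => G * Function.update (fun _ : Fin n => (1 : Matrix (Fin n) (Fin n) ℂ)) k₀ (G⁻¹ * X) k) =
      Function.update (fun _ => G) k₀ X := by
    funext k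
    by_cases hk : k = k₀
    · subst hk
      simp [Matrix.mul_nonsing_inv_cancel_left _ _ (isUnit_iff_ne_zero.2 hdet)]
    · simp [hk]
  rw [h2] at h1
  have h3 : (n : ℂ) * wedgeC (Function.update (fun _ => G) k₀ X) =
      (G⁻¹ * X).trace * wedgeC (fun _ => G) := by
    rw [h1, mul_left_comm, wedgeC_update_one, wedgeC_const]; ring
  have h4 : (wedgeC (fun _ => G)).im = 0 := by
    rw [wedgeC_const]; simp [him]
  have h5 := congrArg Complex.re h3
  rw [Complex.mul_re, Complex.mul_re, h4, mul_zero, sub_zero, Complex.natCast_re,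
    Complex.natCast_im, zero_mul, sub_zero] at h5
  exact h5.symm

lemma wedge_const (G : Matrix (Fin n) (Fin n) ℂ) :
    wedge (fun _ => G) = (n.factorial : ℝ) * G.det.re := by
  rw [wedge_eq_re_wedgeC, wedgeC_const]; simp

lemma hasDerivAt_wedge (B : Fin n → Matrix (Fin n) (Fin n) ℂ) (t : ℝ) :
    HasDerivAt (fun t : ℝ => wedge fun k => A k + t • B k)
      (∑ m, wedge (Function.update (fun k => A k + t • B k) m (B m))) t := by
  have h : HasDerivAt (fun t : ℝ => wedgeC fun k => A k + t • B k)
      (∑ m, wedgeC (Function.update (fun k => A k + t • B k) m (B m))) t := by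
    have h1 : ∀ σ τ : Equiv.Perm (Fin n), HasDerivAt
        (fun t : ℝ => ∏ k, (A k + t • B k) (σ k) (τ k))
        (∑ m, B m (σ m) (τ m) * ∏ k ∈ Finset.univ.erase m, (A k + t • B k) (σ k) (τ k)) t := by
      intro σ τ
      have h2 : ∀ k ∈ Finset.univ, HasDerivAt (fun t : ℝ => (A k + t • B k) (σ k) (τ k))
          (B k (σ k) (τ k)) t := by
        intro k _
        have := ((hasDerivAt_id t).smul_const (B k (σ k) (τ k))).const_add (A k (σ k) (τ k))
        simpa using this
      have := HasDerivAt.fun_finsetProd h2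
      simpa [mul_comm] using this
    have h3 := HasDerivAt.fun_sum (u := Finset.univ) fun (σ : Equiv.Perm (Fin n)) _ =>
      HasDerivAt.fun_sum (u := Finset.univ) fun (τ : Equiv.Perm (Fin n)) _ =>
        (h1 σ τ).const_mul (((Equiv.Perm.sign σ : ℤ) : ℂ) * ((Equiv.Perm.sign τ : ℤ) : ℂ))
    refine h3.congr_deriv ?_
    simp only [wedgeC_update, Finset.mul_sum]
    rw [eq_comm, Finset.sum_comm]
    exact Finset.sum_congr rfl fun σ _ => Finset.sum_comm
  have := (Complex.reCLM.hasFDerivAt.comp_hasDerivAt t h)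
  simpa [wedge_eq_re_wedgeC, Function.comp_def] using this

end LinearAlgebra

/-! ### The complex Hessian as the (1,1)-part of the second derivative -/

section Hessian

variable {n : ℕ}

/-- The sesquilinear part of type (1,1) of a real bilinear form on `ℂⁿ`, complex linear in the
first and conjugate linear in the second variable. -/
noncomputable def sesqPart (B : Model n →L[ℝ] Model n →L[ℝ] ℝ) (v w : Model n) : ℂ :=
  (1 / 4 : ℂ) * (B v w + Complex.I * B v (Complex.I • w) - Complex.I * B (Complex.I • v) w +
    B (Complex.I • v) (Complex.I • w))

lemma single_I (i : Fin n) :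
    (Pi.single i Complex.I : Model n) = Complex.I • (Pi.single i 1 : Model n) := by
  rw [← Pi.single_smul]; simp

lemma fderiv_ofReal {f : Model n → ℝ} {z : Model n} (h : DifferentiableAt ℝ f z) (v : Model n) :
    fderiv ℝ (fun w => (f w : ℂ)) z v = (fderiv ℝ f z v : ℝ) := by
  have := (Complex.ofRealCLM.hasFDerivAt.comp z h.hasFDerivAt).fderiv
  have h2 : (fun w => (f w : ℂ)) = Complex.ofRealCLM ∘ f := rfl
  rw [h2, this]; rfl

lemma complexHessian_apply {f : Model n → ℝ} {z : Model n}
    (h1 : ∀ᶠ w in 𝓝 z, DifferentiableAt ℝ f w) (h2 : DifferentiableAt ℝ (fderiv ℝ f) z)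
    (i j : Fin n) :
    complexHessian f z i j =
      sesqPart (fderiv ℝ (fderiv ℝ f) z) (Pi.single i 1) (Pi.single j 1) := by
  have h3 : dzbar j (fun w => (f w : ℂ)) =ᶠ[𝓝 z] fun w => (1 / 2 : ℂ) *
      (((fderiv ℝ f w (Pi.single j 1) : ℝ) : ℂ) +
        Complex.I * ((fderiv ℝ f w (Pi.single j Complex.I) : ℝ) : ℂ)) := by
    filter_upwards [h1] with w hw
    rw [dzbar, fderiv_ofReal hw, fderiv_ofReal hw]
  have h4 : ∀ v : Model n, HasFDerivAt (fun w => ((fderiv ℝ f w v : ℝ) : ℂ))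
      (Complex.ofRealCLM ∘L (ContinuousLinearMap.apply ℝ ℝ v ∘L fderiv ℝ (fderiv ℝ f) z)) z := by
    intro v
    exact Complex.ofRealCLM.hasFDerivAt.comp z
      ((ContinuousLinearMap.apply ℝ ℝ v).hasFDerivAt.comp z h2.hasFDerivAt)
  have h5 := (((h4 (Pi.single j 1)).add
    ((h4 (Pi.single j Complex.I)).const_mul Complex.I)).const_mul (1 / 2 : ℂ)).fderiv
  rw [complexHessian, Matrix.of_apply, dz, h3.fderiv_eq]
  have h6 : (fun w => (1 / 2 : ℂ) * (((fderiv ℝ f w (Pi.single j 1) : ℝ) : ℂ) +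
        Complex.I * ((fderiv ℝ f w (Pi.single j Complex.I) : ℝ) : ℂ))) = fun y => (1 / 2 : ℂ) *
      ((fun w => ((fderiv ℝ f w (Pi.single j 1) : ℝ) : ℂ)) + fun w =>
        Complex.I * ((fderiv ℝ f w (Pi.single j Complex.I) : ℝ) : ℂ)) y := rfl
  rw [h6, h5]
  simp only [sesqPart, single_I]
  simp
  ring_nf
  simp
  ring

lemma sesqPart_add_left (B : Model n →L[ℝ] Model n →L[ℝ] ℝ) (v v' w : Model n) :
    sesqPart B (v + v') w = sesqPart B v w + sesqPart B v' w := by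
  simp [sesqPart, smul_add]; ring

lemma sesqPart_add_right (B : Model n →L[ℝ] Model n →L[ℝ] ℝ) (v w w' : Model n) :
    sesqPart B v (w + w') = sesqPart B v w + sesqPart B v w' := by
  simp [sesqPart, smul_add]; ring

lemma sesqPart_smul_left (B : Model n →L[ℝ] Model n →L[ℝ] ℝ) (c : ℂ) (v w : Model n) :
    sesqPart B (c • v) w = c * sesqPart B v w := by
  have h1 : c • v = c.re • v + c.im • (Complex.I • v) := by
    conv_lhs => rw [← Complex.re_add_im c]
    rw [add_smul, mul_smul]; simp
  have h2 : Complex.I • Complex.I • v = -v := by rw [smul_smul]; simp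
  have h3 : ∀ r : ℝ, Complex.I • r • v = r • Complex.I • v := fun r => smul_comm _ _ _
  have h4 : ∀ r : ℝ, Complex.I • r • Complex.I • v = -(r • v) := fun r => by
    rw [smul_comm, h2, smul_neg]
  rw [h1, sesqPart_add_left, ← Complex.re_add_im c]
  simp only [sesqPart, h3, h4, map_smul, map_neg, _root_.smul_apply,
    _root_.neg_apply, smul_eq_mul]
  push_cast
  ring_nf
  simp
  ring

lemma sesqPart_smul_right (B : Model n →L[ℝ] Model n →L[ℝ] ℝ) (c : ℂ) (v w : Model n) :
    sesqPart B v (c • w) = (starRingEnd ℂ) c * sesqPart B v w := by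
  have h1 : c • w = c.re • w + c.im • (Complex.I • w) := by
    conv_lhs => rw [← Complex.re_add_im c]
    rw [add_smul, mul_smul]; simp
  have h2 : Complex.I • Complex.I • w = -w := by rw [smul_smul]; simp
  have h3 : ∀ r : ℝ, Complex.I • r • w = r • Complex.I • w := fun r => smul_comm _ _ _
  have h4 : ∀ r : ℝ, Complex.I • r • Complex.I • w = -(r • w) := fun r => by
    rw [smul_comm, h2, smul_neg]
  rw [h1, sesqPart_add_right, ← Complex.re_add_im c]
  simp only [sesqPart, h3, h4, map_smul, map_neg, smul_eq_mul, map_add, map_mul,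
    Complex.conj_I, Complex.conj_ofReal]
  push_cast
  ring_nf
  simp
  ring

lemma sesqPart_sum_left (B : Model n →L[ℝ] Model n →L[ℝ] ℝ) (v w : Model n) :
    sesqPart B v w = ∑ a, v a * sesqPart B (Pi.single a 1) w := by
  let φ : Model n →ₗ[ℂ] ℂ :=
    { toFun := fun v => sesqPart B v w
      map_add' := fun x y => sesqPart_add_left B x y w
      map_smul' := fun c x => sesqPart_smul_left B c x w }
  have h : v = ∑ a, v a • (Pi.single a 1 : Model n) := by
    funext b; simp [Finset.sum_apply, Pi.single_apply]
  calc sesqPart B v w = φ v := rfl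
    _ = ∑ a, v a * φ (Pi.single a 1) := by
      conv_lhs => rw [h]
      simp
    _ = _ := rfl

lemma sesqPart_sum_right (B : Model n →L[ℝ] Model n →L[ℝ] ℝ) (v w : Model n) :
    sesqPart B v w = ∑ a, (starRingEnd ℂ) (w a) * sesqPart B v (Pi.single a 1) := by
  let φ : Model n →ₛₗ[starRingEnd ℂ] ℂ :=
    { toFun := fun w => sesqPart B v w
      map_add' := fun x y => sesqPart_add_right B v x y
      map_smul' := fun c x => sesqPart_smul_right B c v x }
  have h : w = ∑ a, w a • (Pi.single a 1 : Model n) := by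
    funext b; simp [Finset.sum_apply, Pi.single_apply]
  calc sesqPart B v w = φ w := rfl
    _ = ∑ a, (starRingEnd ℂ) (w a) * φ (Pi.single a 1) := by
      conv_lhs => rw [h]
      simp
    _ = _ := rfl

lemma complexHessian_isHermitian {f : Model n → ℝ} {z : Model n}
    (h1 : ∀ᶠ w in 𝓝 z, DifferentiableAt ℝ f w) (h2 : DifferentiableAt ℝ (fderiv ℝ f) z) :
    (complexHessian f z).IsHermitian := by
  have hs := second_derivative_symmetric_of_eventually (𝕜 := ℝ)
    (h1.mono fun w hw => hw.hasFDerivAt) h2.hasFDerivAt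
  ext i j
  rw [Matrix.conjTranspose_apply, complexHessian_apply h1 h2, complexHessian_apply h1 h2]
  simp only [sesqPart, star_mul', star_add, star_sub, Complex.star_def, Complex.conj_ofReal,
    Complex.conj_I]
  rw [hs (Pi.single j 1) (Pi.single i 1), hs (Pi.single j 1) (Complex.I • Pi.single i 1),
    hs (Complex.I • Pi.single j 1) (Pi.single i 1),
    hs (Complex.I • Pi.single j 1) (Complex.I • Pi.single i 1)]
  simp only [map_div₀, map_one, map_ofNat]
  ring

/-- The complex Jacobian matrix of a map `τ : ℂⁿ → ℂⁿ`. -/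
noncomputable def jacobian (τ : Model n → Model n) (z : Model n) : Matrix (Fin n) (Fin n) ℂ :=
  Matrix.of fun a i => fderiv ℂ τ z (Pi.single i 1) a

variable {F : Type*} [NormedAddCommGroup F] [NormedSpace ℂ F]

/-- First and second real derivatives of `f ∘ τ` for a holomorphic map `τ`. -/
lemma second_fderiv_comp {h : Model n → F} {f : F → ℝ} {z : Model n}
    (hh : ContDiffAt ℂ 2 h z) (hf : ContDiffAt ℝ 2 f (h z)) (v w : Model n) :
    fderiv ℝ (fderiv ℝ (f ∘ h)) z v w =
      fderiv ℝ (fderiv ℝ f) (h z) (fderiv ℂ h z v) (fderiv ℂ h z w) +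
        fderiv ℝ f (h z) (fderiv ℂ (fderiv ℂ h) z v w) := by
  have h1 : ∀ᶠ y in 𝓝 z, DifferentiableAt ℂ h y :=
    (hh.eventually (by simp)).mono fun y hy => hy.differentiableAt (by simp)
  have f1 : ∀ᶠ y in 𝓝 (h z), DifferentiableAt ℝ f y :=
    (hf.eventually (by simp)).mono fun y hy => hy.differentiableAt (by simp)
  have h2 : DifferentiableAt ℂ (fderiv ℂ h) z :=
    (hh.fderiv_right (m := 1) (by norm_num)).differentiableAt (by simp)
  have f2 : DifferentiableAt ℝ (fderiv ℝ f) (h z) :=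
    (hf.fderiv_right (m := 1) (by norm_num)).differentiableAt (by simp)
  have e1 : (fun y => fderiv ℝ (f ∘ h) y w) =ᶠ[𝓝 z] fun y =>
      fderiv ℝ f (h y) (fderiv ℂ h y w) := by
    filter_upwards [h1, hh.continuousAt.eventually f1] with y hy hfy
    rw [fderiv_comp y hfy (hy.restrictScalars ℝ), hy.fderiv_restrictScalars ℝ]
    rfl
  have e3 : DifferentiableAt ℝ (fderiv ℝ (f ∘ h)) z :=
    ((hf.comp z (hh.restrict_scalars ℝ)).fderiv_right (m := 1) (by norm_num)).differentiableAt
      (by simp)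
  have e2 : fderiv ℝ (fun y => fderiv ℝ (f ∘ h) y w) z v =
      fderiv ℝ (fderiv ℝ (f ∘ h)) z v w := by
    have := ((ContinuousLinearMap.apply ℝ ℝ w).hasFDerivAt.comp z e3.hasFDerivAt).fderiv
    have e4 : (fun y => fderiv ℝ (f ∘ h) y w) =
      (ContinuousLinearMap.apply ℝ ℝ w) ∘ fderiv ℝ (f ∘ h) := rfl
    rw [e4, this]; rfl
  have d1 : HasFDerivAt (fun y => fderiv ℝ f (h y))
      (fderiv ℝ (fderiv ℝ f) (h z) ∘L (fderiv ℂ h z).restrictScalars ℝ) z :=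
    f2.hasFDerivAt.comp z (h1.self_of_nhds.hasFDerivAt.restrictScalars ℝ)
  have d2 : HasFDerivAt (fun y => fderiv ℂ h y w)
      (((ContinuousLinearMap.apply ℂ F w) ∘L fderiv ℂ (fderiv ℂ h) z).restrictScalars ℝ) z :=
    ((ContinuousLinearMap.apply ℂ F w).hasFDerivAt.comp z h2.hasFDerivAt).restrictScalars ℝ
  rw [← e2, e1.fderiv_eq, (d1.clm_apply d2).fderiv]
  simp [add_comm]

lemma contDiffAt_twice {f : Model n → ℝ} {z : Model n} (hf : ContDiffAt ℝ 2 f z) :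
    (∀ᶠ w in 𝓝 z, DifferentiableAt ℝ f w) ∧ DifferentiableAt ℝ (fderiv ℝ f) z :=
  ⟨(hf.eventually (by simp)).mono fun _ hy => hy.differentiableAt (by simp),
    (hf.fderiv_right (m := 1) (by norm_num)).differentiableAt (by simp)⟩

/-- The term of the chain rule which contains the second derivative of the holomorphic map has
no part of type (1,1). -/
lemma complexHessian_comp_apply {h : Model n → F} {f : F → ℝ} {z : Model n}
    (hh : ContDiffAt ℂ 2 h z) (hf : ContDiffAt ℝ 2 f (h z)) (i j : Fin n) :
    complexHessian (f ∘ h) z i j = (1 / 4 : ℂ) *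
      (fderiv ℝ (fderiv ℝ f) (h z) (fderiv ℂ h z (Pi.single i 1)) (fderiv ℂ h z (Pi.single j 1)) +
      Complex.I * fderiv ℝ (fderiv ℝ f) (h z) (fderiv ℂ h z (Pi.single i 1))
        (Complex.I • fderiv ℂ h z (Pi.single j 1)) -
      Complex.I * fderiv ℝ (fderiv ℝ f) (h z) (Complex.I • fderiv ℂ h z (Pi.single i 1))
        (fderiv ℂ h z (Pi.single j 1)) +
      fderiv ℝ (fderiv ℝ f) (h z) (Complex.I • fderiv ℂ h z (Pi.single i 1))
        (Complex.I • fderiv ℂ h z (Pi.single j 1))) := by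
  have hc := contDiffAt_twice (hf.comp z (hh.restrict_scalars ℝ))
  rw [complexHessian_apply hc.1 hc.2]
  simp only [sesqPart, second_fderiv_comp hh hf, map_smul, _root_.smul_apply]
  rw [smul_smul, Complex.I_mul_I, neg_one_smul, map_neg]
  push_cast
  ring

/-- The complex Hessian transforms as a form of type (1,1) under holomorphic maps. -/
lemma complexHessian_comp {τ : Model n → Model n} {f : Model n → ℝ} {z : Model n}
    (hτ : ContDiffAt ℂ 2 τ z) (hf : ContDiffAt ℝ 2 f (τ z)) :
    complexHessian (f ∘ τ) z = (jacobian τ z).transpose * complexHessian f (τ z) *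
      (jacobian τ z).map (starRingEnd ℂ) := by
  have hc := contDiffAt_twice hf
  ext i j
  rw [complexHessian_comp_apply hτ hf]
  change sesqPart (fderiv ℝ (fderiv ℝ f) (τ z)) (fderiv ℂ τ z (Pi.single i 1))
    (fderiv ℂ τ z (Pi.single j 1)) = _
  rw [sesqPart_sum_right, Matrix.mul_apply]
  refine Finset.sum_congr rfl fun b _ => ?_
  rw [sesqPart_sum_left, Matrix.mul_apply, mul_comm]
  simp only [Matrix.map_apply, Matrix.transpose_apply, jacobian, Matrix.of_apply,
    complexHessian_apply hc.1 hc.2]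

/-- Real parts of holomorphic functions are pluriharmonic. -/
lemma complexHessian_re_holomorphic {h : Model n → ℂ} {z : Model n} (hh : ContDiffAt ℂ 2 h z) :
    complexHessian (fun w => (h w).re) z = 0 := by
  have h0 : fderiv ℝ (fderiv ℝ (Complex.re : ℂ → ℝ)) (h z) = 0 := by
    have : fderiv ℝ (Complex.re : ℂ → ℝ) = fun _ => Complex.reCLM := by
      funext y; exact Complex.reCLM.fderiv
    rw [this]; simp
  ext i j
  have := complexHessian_comp_apply (f := Complex.re) hh Complex.reCLM.contDiff.contDiffAt i j
  rw [h0] at this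
  simpa [Function.comp_def] using this

lemma complexHessian_add {f g : Model n → ℝ} {z : Model n}
    (hf : (∀ᶠ w in 𝓝 z, DifferentiableAt ℝ f w) ∧ DifferentiableAt ℝ (fderiv ℝ f) z)
    (hg : (∀ᶠ w in 𝓝 z, DifferentiableAt ℝ g w) ∧ DifferentiableAt ℝ (fderiv ℝ g) z) :
    complexHessian (fun w => f w + g w) z = complexHessian f z + complexHessian g z := by
  have h1 : fderiv ℝ (fun w => f w + g w) =ᶠ[𝓝 z] fun w => fderiv ℝ f w + fderiv ℝ g w := by
    filter_upwards [hf.1, hg.1] with w h1 h2 using fderiv_fun_add h1 h2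
  have h2 : ∀ᶠ w in 𝓝 z, DifferentiableAt ℝ (fun w => f w + g w) w := by
    filter_upwards [hf.1, hg.1] with w h1 h2 using h1.add h2
  have h3 : DifferentiableAt ℝ (fderiv ℝ fun w => f w + g w) z :=
    (hf.2.add hg.2).congr_of_eventuallyEq h1
  ext i j
  rw [complexHessian_apply h2 h3, Matrix.add_apply, complexHessian_apply hf.1 hf.2,
    complexHessian_apply hg.1 hg.2, h1.fderiv_eq, fderiv_fun_add hf.2 hg.2]
  simp [sesqPart]; ring

lemma complexHessian_congr {f g : Model n → ℝ} {z : Model n} (h : f =ᶠ[𝓝 z] g) :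
    complexHessian f z = complexHessian g z := by
  ext i j
  have h1 : dzbar j (fun w => (f w : ℂ)) =ᶠ[𝓝 z] dzbar j (fun w => (g w : ℂ)) := by
    filter_upwards [h.eventuallyEq_nhds] with w hw
    have : (fun w => (f w : ℂ)) =ᶠ[𝓝 w] fun w => (g w : ℂ) := hw.fun_comp (fun x : ℝ => (x : ℂ))
    rw [dzbar, dzbar, this.fderiv_eq]
  rw [complexHessian, complexHessian, Matrix.of_apply, Matrix.of_apply, dz, dz, h1.fderiv_eq]

/-- `log |h|²` is pluriharmonic for a nowhere vanishing holomorphic function `h`. -/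
lemma complexHessian_log_normSq {h : Model n → ℂ} {z : Model n} (hh : ContDiffAt ℂ 2 h z)
    (h0 : h z ≠ 0) : complexHessian (fun w => Real.log (Complex.normSq (h w))) z = 0 := by
  -- near `z`, the function is a constant plus the real part of `2 log (h / h z)`
  have hc : ContDiffAt ℂ 2 (fun w => 2 * Complex.log (h w / h z)) z := by
    have h1 : h z / h z ∈ Complex.slitPlane := by
      rw [div_self h0]; exact Complex.one_mem_slitPlane
    have h2 : ContDiffAt ℂ 2 (fun w => Complex.log (h w / h z)) z :=
      ContDiffAt.comp (g := Complex.log) (f := fun w => h w / h z) z (Complex.contDiffAt_log h1)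
        (hh.div_const (h z))
    exact contDiffAt_const.mul h2
  have hc' : ContDiffAt ℝ 2 (fun w => (2 * Complex.log (h w / h z)).re) z :=
    Complex.reCLM.contDiff.contDiffAt.comp z (hc.restrict_scalars ℝ)
  have he : (fun w => Real.log (Complex.normSq (h w))) =ᶠ[𝓝 z] fun w =>
      (2 * Complex.log (h w / h z)).re + Real.log (Complex.normSq (h z)) := by
    filter_upwards [hh.continuousAt.eventually_ne h0] with w hw
    have : (2 * Complex.log (h w / h z)).re = 2 * Real.log (‖h w‖ / ‖h z‖) := by
      rw [← norm_div, ← Complex.log_re]; simp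
    rw [this, Real.log_div (norm_ne_zero_iff.2 hw) (norm_ne_zero_iff.2 h0),
      Complex.normSq_eq_norm_sq, Complex.normSq_eq_norm_sq, Real.log_pow, Real.log_pow]
    push_cast; ring
  have hconst : complexHessian (fun _ : Model n => Real.log (Complex.normSq (h z))) z = 0 := by
    ext i j
    have : dzbar j (fun _ : Model n => ((Real.log (Complex.normSq (h z)) : ℝ) : ℂ)) =
        fun _ => 0 := by
      funext w; simp [dzbar]
    simp only [complexHessian, Matrix.of_apply, this, dz]
    simp
  rw [complexHessian_congr he, complexHessian_add (contDiffAt_twice hc')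
    (contDiffAt_twice contDiffAt_const), complexHessian_re_holomorphic hc, hconst, add_zero]

end Hessian

/-! ### Integration by parts for smooth closed forms on `ℂⁿ` -/

section Wirtinger

variable {n : ℕ}

/-- A common form of the two Wirtinger derivatives: `c = -√-1` gives `∂/∂zᵢ` and `c = √-1` gives
`∂/∂z̄ᵢ`. -/
noncomputable def wirt (c : ℂ) (i : Fin n) (F : Model n → ℂ) (z : Model n) : ℂ :=
  (1 / 2 : ℂ) * (fderiv ℝ F z (Pi.single i 1) + c * fderiv ℝ F z (Pi.single i Complex.I))

lemma dz_eq_wirt (i : Fin n) (F : Model n → ℂ) : dz i F = wirt (-Complex.I) i F := by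
  funext z; simp [dz, wirt, sub_eq_add_neg]

lemma dzbar_eq_wirt (i : Fin n) (F : Model n → ℂ) : dzbar i F = wirt Complex.I i F := rfl

lemma wirt_congr {c : ℂ} {i : Fin n} {F G : Model n → ℂ} {z : Model n} (h : F =ᶠ[𝓝 z] G) :
    wirt c i F z = wirt c i G z := by
  rw [wirt, wirt, h.fderiv_eq]

lemma wirt_mul {c : ℂ} {i : Fin n} {F G : Model n → ℂ} {z : Model n}
    (hF : DifferentiableAt ℝ F z) (hG : DifferentiableAt ℝ G z) :
    wirt c i (fun w => F w * G w) z = wirt c i F z * G z + F z * wirt c i G z := by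
  simp only [wirt]
  rw [fderiv_fun_mul hF hG]
  simp; ring

lemma wirt_prod {c : ℂ} {i : Fin n} {ι : Type*} [DecidableEq ι] (s : Finset ι)
    {f : ι → Model n → ℂ} {z : Model n} (hf : ∀ k ∈ s, DifferentiableAt ℝ (f k) z) :
    wirt c i (fun w => ∏ k ∈ s, f k w) z =
      ∑ m ∈ s, wirt c i (f m) z * ∏ k ∈ s.erase m, f k z := by
  simp only [wirt]
  rw [fderiv_finsetProd hf]
  simp only [FunLike.coe_sum, Finset.sum_apply, _root_.smul_apply, smul_eq_mul]
  rw [Finset.mul_sum, ← Finset.sum_add_distrib, Finset.mul_sum]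
  exact Finset.sum_congr rfl fun m _ => by ring

lemma contDiffAt_fderiv_apply {F : Model n → ℂ} {z : Model n} {m k : WithTop ℕ∞}
    (hF : ContDiffAt ℝ k F z) (hmk : m + 1 ≤ k) (v : Model n) :
    ContDiffAt ℝ m (fun w => fderiv ℝ F w v) z :=
  (hF.fderiv_right hmk).clm_apply contDiffAt_const

lemma contDiffAt_wirt {F : Model n → ℂ} {z : Model n} {m k : WithTop ℕ∞}
    (hF : ContDiffAt ℝ k F z) (hmk : m + 1 ≤ k) (c : ℂ) (i : Fin n) :
    ContDiffAt ℝ m (wirt c i F) z :=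
  contDiffAt_const.mul ((contDiffAt_fderiv_apply hF hmk _).add
    (contDiffAt_const.mul (contDiffAt_fderiv_apply hF hmk _)))

lemma wirt_wirt {F : Model n → ℂ} {z : Model n} (hF : ContDiffAt ℝ 2 F z) (c c' : ℂ)
    (i j : Fin n) :
    wirt c i (wirt c' j F) z = (1 / 4 : ℂ) *
      (fderiv ℝ (fderiv ℝ F) z (Pi.single i 1) (Pi.single j 1) +
        c' * fderiv ℝ (fderiv ℝ F) z (Pi.single i 1) (Pi.single j Complex.I) +
        c * fderiv ℝ (fderiv ℝ F) z (Pi.single i Complex.I) (Pi.single j 1) +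
        c * c' * fderiv ℝ (fderiv ℝ F) z (Pi.single i Complex.I) (Pi.single j Complex.I)) := by
  have h2 : DifferentiableAt ℝ (fderiv ℝ F) z :=
    (hF.fderiv_right (m := 1) (by norm_num)).differentiableAt (by simp)
  have h4 : ∀ v : Model n, HasFDerivAt (fun w => fderiv ℝ F w v)
      (ContinuousLinearMap.apply ℝ ℂ v ∘L fderiv ℝ (fderiv ℝ F) z) z := fun v =>
    (ContinuousLinearMap.apply ℝ ℂ v).hasFDerivAt.comp z h2.hasFDerivAt
  have h5 : HasFDerivAt (wirt c' j F) _ z := ((h4 (Pi.single j 1)).add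
    ((h4 (Pi.single j Complex.I)).const_mul c')).const_mul (1 / 2 : ℂ)
  rw [wirt, h5.fderiv]
  simp
  ring

lemma wirt_comm {F : Model n → ℂ} {z : Model n} (hF : ContDiffAt ℝ 2 F z) (c c' : ℂ)
    (i j : Fin n) : wirt c i (wirt c' j F) z = wirt c' j (wirt c i F) z := by
  have hs : ∀ v w, fderiv ℝ (fderiv ℝ F) z v w = fderiv ℝ (fderiv ℝ F) z w v :=
    second_derivative_symmetric_of_eventually (𝕜 := ℝ)
      ((hF.eventually (by simp)).mono fun w hw =>
        (hw.differentiableAt (by simp)).hasFDerivAt)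
      ((hF.fderiv_right (m := 1) (by norm_num)).differentiableAt (by simp)).hasFDerivAt
  rw [wirt_wirt hF, wirt_wirt hF, hs (Pi.single i 1), hs (Pi.single i 1), hs (Pi.single i Complex.I),
    hs (Pi.single i Complex.I)]
  ring

lemma integral_fderiv_eq_zero {F : Model n → ℂ} (hF : ContDiff ℝ 1 F) (hc : HasCompactSupport F)
    (v : Model n) : ∫ z, fderiv ℝ F z v = 0 := by
  have h1 : Continuous fun z => fderiv ℝ F z v :=
    (hF.continuous_fderiv (by simp)).clm_apply continuous_const
  have hd : Differentiable ℝ F := hF.differentiable (by simp)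
  have h2 : Integrable fun z => fderiv ℝ F z v :=
    h1.integrable_of_hasCompactSupport (hc.fderiv_apply ℝ v)
  have h3 : Integrable F := hF.continuous.integrable_of_hasCompactSupport hc
  have := integral_mul_fderiv_eq_neg_fderiv_mul_of_integrable (μ := volume) (f := fun _ => (1 : ℂ))
    (g := F) (v := v) (by simp) (by simpa using h2) (by simpa using h3)
    (fun x _ => differentiableAt_const _) (fun x _ => hd x)
  simpa using this

lemma integrable_wirt {F : Model n → ℂ} (hF : ContDiff ℝ 1 F) (hc : HasCompactSupport F)
    (c : ℂ) (i : Fin n) : Integrable (wirt c i F) := by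
  have h1 : ∀ v, Integrable fun z => fderiv ℝ F z v := fun v =>
    ((hF.continuous_fderiv (by simp)).clm_apply
      continuous_const).integrable_of_hasCompactSupport (hc.fderiv_apply ℝ v)
  exact ((h1 _).add ((h1 _).const_mul c)).const_mul _

lemma integral_wirt_eq_zero {F : Model n → ℂ} (hF : ContDiff ℝ 1 F) (hc : HasCompactSupport F)
    (c : ℂ) (i : Fin n) : ∫ z, wirt c i F z = 0 := by
  have h1 : ∀ v, Integrable fun z => fderiv ℝ F z v := fun v =>
    ((hF.continuous_fderiv (by simp)).clm_apply
      continuous_const).integrable_of_hasCompactSupport (hc.fderiv_apply ℝ v)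
  simp only [wirt]
  rw [integral_const_mul, integral_add (h1 _) ((h1 _).const_mul c), integral_const_mul,
    integral_fderiv_eq_zero hF hc, integral_fderiv_eq_zero hF hc]
  simp

/-- A smooth `d`-closed form of type (1,1) on the open set `U`, given by its matrix of
coefficients. -/
structure ClosedFormOn (A : Model n → Matrix (Fin n) (Fin n) ℂ) (U : Set (Model n)) : Prop where
  smooth : ∀ i j, ContDiffOn ℝ ∞ (fun z => A z i j) U
  dz_symm : ∀ z ∈ U, ∀ i j k, dz k (fun w => A w i j) z = dz i (fun w => A w k j) z
  dzbar_symm : ∀ z ∈ U, ∀ i j k, dzbar k (fun w => A w i j) z = dzbar j (fun w => A w i k) z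

lemma contDiffAt_ofReal {f : Model n → ℝ} {z : Model n} {k : WithTop ℕ∞}
    (hf : ContDiffAt ℝ k f z) : ContDiffAt ℝ k (fun w => (f w : ℂ)) z :=
  Complex.ofRealCLM.contDiff.contDiffAt.comp z hf

lemma complexHessian_eq_wirt (f : Model n → ℝ) (i j : Fin n) (z : Model n) :
    complexHessian f z i j = wirt (-Complex.I) i (wirt Complex.I j fun w => (f w : ℂ)) z := by
  rw [← dz_eq_wirt, ← dzbar_eq_wirt]; rfl

lemma contDiffAt_complexHessian {f : Model n → ℝ} {z : Model n} (hf : ContDiffAt ℝ ∞ f z)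
    (i j : Fin n) : ContDiffAt ℝ ∞ (fun z => complexHessian f z i j) z := by
  simp only [complexHessian_eq_wirt]
  exact contDiffAt_wirt (k := ∞) (contDiffAt_wirt (contDiffAt_ofReal hf) (by simp) _ _)
    (by simp) _ _

lemma closedFormOn_complexHessian {f : Model n → ℝ} {U : Set (Model n)} (hU : IsOpen U)
    (hf : ContDiffOn ℝ ∞ f U) : ClosedFormOn (complexHessian f) U := by
  have h : ∀ z ∈ U, ContDiffAt ℝ ∞ f z := fun z hz => hf.contDiffAt (hU.mem_nhds hz)
  have h2 : (2 : WithTop ℕ∞) ≤ ∞ := WithTop.coe_le_coe.2 le_top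
  have hw : ∀ z ∈ U, ∀ c i, ContDiffAt ℝ 2 (wirt c i fun w => (f w : ℂ)) z := fun z hz c i =>
    (contDiffAt_wirt (m := ∞) (contDiffAt_ofReal (h z hz)) (by simp) c i).of_le h2
  refine ⟨fun i j z hz => (contDiffAt_complexHessian (h z hz) i j).contDiffWithinAt,
    fun z hz i j k => ?_, fun z hz i j k => ?_⟩
  · simp only [complexHessian_eq_wirt, dz_eq_wirt]
    exact wirt_comm (hw z hz _ _) _ _ _ _
  · simp only [complexHessian_eq_wirt, dzbar_eq_wirt]
    have e : ∀ l m, wirt Complex.I l (fun w => wirt (-Complex.I) i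
        (wirt Complex.I m fun w => (f w : ℂ)) w) z =
        wirt (-Complex.I) i (wirt Complex.I l (wirt Complex.I m fun w => (f w : ℂ))) z :=
      fun l m => wirt_comm (hw z hz _ _) _ _ _ _
    rw [e, e]
    refine wirt_congr ?_
    filter_upwards [hU.mem_nhds hz] with w hw
    exact wirt_comm ((contDiffAt_ofReal (h w hw)).of_le h2) _ _ _ _

lemma ClosedFormOn.add {A B : Model n → Matrix (Fin n) (Fin n) ℂ} {U : Set (Model n)}
    (hU : IsOpen U) (hA : ClosedFormOn A U) (hB : ClosedFormOn B U) :
    ClosedFormOn (fun z => A z + B z) U := by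
  have hd : ∀ {A : Model n → Matrix (Fin n) (Fin n) ℂ}, ClosedFormOn A U → ∀ z ∈ U, ∀ i j,
      DifferentiableAt ℝ (fun w => A w i j) z := fun hA z hz i j =>
    ((hA.smooth i j).contDiffAt (hU.mem_nhds hz)).differentiableAt (by simp)
  refine ⟨fun i j => (hA.smooth i j).add (hB.smooth i j), fun z hz i j k => ?_,
    fun z hz i j k => ?_⟩
  · have e : ∀ i j k, dz k (fun w => (A w + B w) i j) z =
        dz k (fun w => A w i j) z + dz k (fun w => B w i j) z := by
      intro i j k
      simp only [dz, Matrix.add_apply]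
      rw [fderiv_fun_add (hd hA z hz i j) (hd hB z hz i j)]
      simp; ring
    rw [e, e, hA.dz_symm z hz, hB.dz_symm z hz]
  · have e : ∀ i j k, dzbar k (fun w => (A w + B w) i j) z =
        dzbar k (fun w => A w i j) z + dzbar k (fun w => B w i j) z := by
      intro i j k
      simp only [dzbar, Matrix.add_apply]
      rw [fderiv_fun_add (hd hA z hz i j) (hd hB z hz i j)]
      simp; ring
    rw [e, e, hA.dzbar_symm z hz, hB.dzbar_symm z hz]

lemma ClosedFormOn.smul {A : Model n → Matrix (Fin n) (Fin n) ℂ} {U : Set (Model n)}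
    (hU : IsOpen U) (hA : ClosedFormOn A U) (r : ℝ) : ClosedFormOn (fun z => r • A z) U := by
  have hd : ∀ z ∈ U, ∀ i j,
      DifferentiableAt ℝ (fun w => A w i j) z := fun z hz i j =>
    ((hA.smooth i j).contDiffAt (hU.mem_nhds hz)).differentiableAt (by simp)
  refine ⟨fun i j => (hA.smooth i j).const_smul r, fun z hz i j k => ?_,
    fun z hz i j k => ?_⟩
  · have e : ∀ i j k, dz k (fun w => (r • A w) i j) z = r * dz k (fun w => A w i j) z := by
      intro i j k
      simp only [dz, Matrix.smul_apply]
      rw [fderiv_fun_const_smul (hd z hz i j)]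
      simp; ring
    rw [e, e, hA.dz_symm z hz]
  · have e : ∀ i j k, dzbar k (fun w => (r • A w) i j) z = r * dzbar k (fun w => A w i j) z := by
      intro i j k
      simp only [dzbar, Matrix.smul_apply]
      rw [fderiv_fun_const_smul (hd z hz i j)]
      simp; ring
    rw [e, e, hA.dzbar_symm z hz]

/-- A Hermitian form is `∂̄`-closed once it is `∂`-closed. -/
lemma closedFormOn_of_isHermitian {A : Model n → Matrix (Fin n) (Fin n) ℂ} {U : Set (Model n)}
    (hU : IsOpen U) (hs : ∀ i j, ContDiffOn ℝ ∞ (fun z => A z i j) U)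
    (hh : ∀ z ∈ U, (A z).IsHermitian)
    (hd : ∀ z ∈ U, ∀ i j k, dz k (fun w => A w i j) z = dz i (fun w => A w k j) z) :
    ClosedFormOn A U := by
  refine ⟨hs, hd, fun z hz i j k => ?_⟩
  have e : ∀ i j k, dzbar k (fun w => A w i j) z = (starRingEnd ℂ) (dz k (fun w => A w j i) z) := by
    intro i j k
    have h1 : (fun w => A w i j) =ᶠ[𝓝 z] fun w => (starRingEnd ℂ) (A w j i) := by
      filter_upwards [hU.mem_nhds hz] with w hw
      exact ((hh w hw).apply i j).symm
    have h2 : DifferentiableAt ℝ (fun w => A w j i) z :=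
      ((hs j i).contDiffAt (hU.mem_nhds hz)).differentiableAt (by simp)
    have h3 : fderiv ℝ (fun w => (starRingEnd ℂ) (A w j i)) z =
        (Complex.conjCLE : ℂ →L[ℝ] ℂ) ∘L fderiv ℝ (fun w => A w j i) z :=
      ((Complex.conjCLE : ℂ →L[ℝ] ℂ).hasFDerivAt.comp z h2.hasFDerivAt).fderiv
    rw [dzbar, h1.fderiv_eq, h3, dz]
    simp only [map_mul, map_div₀, map_one, map_ofNat, map_sub, Complex.conj_I]
    simp
  rw [e, e, hd z hz]

end Wirtinger

section SmoothIBP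

variable {n : ℕ}

lemma contDiff_of_zero_off {F : Model n → ℂ} {U K : Set (Model n)}
    {m : WithTop ℕ∞} (hF : ∀ z ∈ U, ContDiffAt ℝ m F z) (hK : IsClosed K) (hKU : K ⊆ U)
    (h0 : ∀ z, z ∉ K → F z = 0) : ContDiff ℝ m F := by
  rw [contDiff_iff_contDiffAt]
  intro z
  by_cases hz : z ∈ U
  · exact hF z hz
  · have : F =ᶠ[𝓝 z] fun _ => 0 := by
      filter_upwards [hK.isOpen_compl.mem_nhds fun h => hz (hKU h)] with w hw using h0 w hw
    exact contDiffAt_const.congr_of_eventuallyEq this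

lemma wirt_eq_zero_of_notMem {F : Model n → ℂ} {K : Set (Model n)} (hK : IsClosed K)
    (h0 : ∀ z, z ∉ K → F z = 0) (c : ℂ) (i : Fin n) {z : Model n} (hz : z ∉ K) :
    wirt c i F z = 0 := by
  have : F =ᶠ[𝓝 z] fun _ => 0 := by
    filter_upwards [hK.isOpen_compl.mem_nhds hz] with w hw using h0 w hw
  rw [wirt_congr this]; simp [wirt]

/-- The cofactors of closed forms are divergence free: in the sum over `σ`, transposing the
values at `k₀` and at the differentiated slot changes the sign. -/
lemma sum_sign_mul_wirt_prod {f : Fin n → Fin n → Model n → ℂ} (k₀ : Fin n) {z : Model n} (c : ℂ)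
    (hd : ∀ k i, DifferentiableAt ℝ (f k i) z)
    (hf : ∀ m i j, wirt c i (f m j) z = wirt c j (f m i) z) :
    ∑ σ : Equiv.Perm (Fin n), ((Equiv.Perm.sign σ : ℤ) : ℂ) *
      wirt c (σ k₀) (fun w => ∏ k ∈ Finset.univ.erase k₀, f k (σ k) w) z = 0 := by
  have h1 : ∀ σ : Equiv.Perm (Fin n), ((Equiv.Perm.sign σ : ℤ) : ℂ) *
      wirt c (σ k₀) (fun w => ∏ k ∈ Finset.univ.erase k₀, f k (σ k) w) z =
      ∑ m ∈ Finset.univ.erase k₀, ((Equiv.Perm.sign σ : ℤ) : ℂ) *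
        (wirt c (σ k₀) (f m (σ m)) z *
          ∏ k ∈ (Finset.univ.erase k₀).erase m, f k (σ k) z) := by
    intro σ
    rw [wirt_prod _ fun k _ => hd k (σ k), Finset.mul_sum]
  rw [Finset.sum_congr rfl fun σ _ => h1 σ, Finset.sum_comm]
  refine Finset.sum_eq_zero fun m hm => ?_
  have hmk : m ≠ k₀ := Finset.ne_of_mem_erase hm
  set g : Equiv.Perm (Fin n) → ℂ := fun σ => ((Equiv.Perm.sign σ : ℤ) : ℂ) *
    (wirt c (σ k₀) (f m (σ m)) z * ∏ k ∈ (Finset.univ.erase k₀).erase m, f k (σ k) z) with hg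
  have h2 : ∀ σ, g (σ * Equiv.swap k₀ m) = -g σ := by
    intro σ
    have h3 : ∏ k ∈ (Finset.univ.erase k₀).erase m, f k ((σ * Equiv.swap k₀ m) k) z =
        ∏ k ∈ (Finset.univ.erase k₀).erase m, f k (σ k) z := by
      refine Finset.prod_congr rfl fun k hk => ?_
      rw [Finset.mem_erase, Finset.mem_erase] at hk
      rw [Equiv.Perm.mul_apply, Equiv.swap_apply_of_ne_of_ne hk.2.1 hk.1]
    simp only [hg, h3]
    rw [Equiv.Perm.sign_mul, Equiv.Perm.sign_swap hmk.symm, Equiv.Perm.mul_apply,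
      Equiv.Perm.mul_apply, Equiv.swap_apply_left, Equiv.swap_apply_right, hf]
    simp
  have h3 : ∑ σ, g σ = -∑ σ, g σ := by
    conv_lhs => rw [← Equiv.sum_comp (Equiv.mulRight (Equiv.swap k₀ m)) g]
    rw [← Finset.sum_neg_distrib]
    exact Finset.sum_congr rfl fun σ _ => h2 σ
  exact self_eq_neg.1 h3

lemma complexHessian_eq_zero_of_notMem {f : Model n → ℝ} {K : Set (Model n)} (hK : IsClosed K)
    (h0 : ∀ z, z ∉ K → f z = 0) {z : Model n} (hz : z ∉ K) : complexHessian f z = 0 := by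
  ext i j
  rw [complexHessian_eq_wirt]
  exact wirt_eq_zero_of_notMem hK (fun w hw => wirt_eq_zero_of_notMem hK
    (fun w hw => by simp [h0 w hw]) _ _ hw) _ _ hz

lemma integrableOn_of_zero_off {F : Model n → ℂ} {U K : Set (Model n)} (hU : IsOpen U)
    (hF : ContinuousOn F U) (hK : IsCompact K) (hKU : K ⊆ U) (h0 : ∀ z, z ∉ K → F z = 0) :
    IntegrableOn F U := by
  have h1 : IntegrableOn F K := (hF.mono hKU).integrableOn_compact hK
  exact h1.of_forall_sdiff_eq_zero hU.measurableSet fun z hz => h0 z hz.2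

/-- Smooth integration by parts: both integrands differ by a divergence, because the cofactors of
closed forms are divergence free. -/
lemma integral_mul_wedgeC_complexHessian {U : Set (Model n)} (hU : IsOpen U)
    {A : Fin n → Model n → Matrix (Fin n) (Fin n) ℂ} (hA : ∀ k, ClosedFormOn (A k) U)
    (k₀ : Fin n) {v ψ : Model n → ℝ} (hv : ContDiffOn ℝ ∞ v U) (hψ : ContDiff ℝ ∞ ψ)
    (hc : HasCompactSupport ψ) (hs : tsupport ψ ⊆ U) :
    ∫ z in U, (v z : ℂ) * wedgeC (Function.update (fun k => A k z) k₀ (complexHessian ψ z)) =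
      ∫ z in U, (ψ z : ℂ) * wedgeC (Function.update (fun k => A k z) k₀ (complexHessian v z)) := by
  have hcl : IsClosed (tsupport ψ) := isClosed_tsupport ψ
  have hψ0 : ∀ z, z ∉ tsupport ψ → ψ z = 0 := fun z hz => image_eq_zero_of_notMem_tsupport hz
  set P : Equiv.Perm (Fin n) → Equiv.Perm (Fin n) → Model n → ℂ := fun σ τ z =>
    ∏ k ∈ Finset.univ.erase k₀, A k z (σ k) (τ k) with hP
  set vC : Model n → ℂ := fun w => (v w : ℂ) with hvC
  set pC : Model n → ℂ := fun w => (ψ w : ℂ) with hpC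
  set F₁ : Equiv.Perm (Fin n) → Equiv.Perm (Fin n) → Model n → ℂ := fun σ τ z =>
    (vC z * P σ τ z) * wirt Complex.I (τ k₀) pC z with hF₁
  set F₂ : Equiv.Perm (Fin n) → Equiv.Perm (Fin n) → Model n → ℂ := fun σ τ z =>
    (wirt (-Complex.I) (σ k₀) vC z * P σ τ z) * pC z with hF₂
  set s : Equiv.Perm (Fin n) → Equiv.Perm (Fin n) → ℂ := fun σ τ =>
    ((Equiv.Perm.sign σ : ℤ) : ℂ) * ((Equiv.Perm.sign τ : ℤ) : ℂ) with hs'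
  have hpC0 : ∀ z, z ∉ tsupport ψ → pC z = 0 := fun z hz => by simp [hpC, hψ0 z hz]
  have hdp0 : ∀ c i z, z ∉ tsupport ψ → wirt c i pC z = 0 := fun c i z hz =>
    wirt_eq_zero_of_notMem hcl hpC0 c i hz
  -- smoothness on `U`
  have sA : ∀ z ∈ U, ∀ k i j, ContDiffAt ℝ ∞ (fun z => A k z i j) z := fun z hz k i j =>
    ((hA k).smooth i j).contDiffAt (hU.mem_nhds hz)
  have sP : ∀ z ∈ U, ∀ σ τ, ContDiffAt ℝ ∞ (P σ τ) z := fun z hz σ τ =>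
    contDiffAt_prod fun k _ => sA z hz k _ _
  have sv : ∀ z ∈ U, ContDiffAt ℝ ∞ vC z := fun z hz =>
    contDiffAt_ofReal (hv.contDiffAt (hU.mem_nhds hz))
  have sp : ∀ z, ContDiffAt ℝ ∞ pC z := fun z => contDiffAt_ofReal hψ.contDiffAt
  have swv : ∀ z ∈ U, ∀ c i, ContDiffAt ℝ ∞ (wirt c i vC) z := fun z hz c i =>
    contDiffAt_wirt (sv z hz) (by simp) c i
  have swp : ∀ z, ∀ c i, ContDiffAt ℝ ∞ (wirt c i pC) z := fun z c i =>
    contDiffAt_wirt (sp z) (by simp) c i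
  have h1 : (1 : WithTop ℕ∞) ≤ ∞ := by exact_mod_cast le_top
  have h2 : (2 : WithTop ℕ∞) ≤ ∞ := WithTop.coe_le_coe.2 le_top
  have d : ∀ {F : Model n → ℂ} {z : Model n}, ContDiffAt ℝ ∞ F z → DifferentiableAt ℝ F z :=
    fun h => h.differentiableAt (by simp)
  have z₁ : ∀ σ τ z, z ∉ tsupport ψ → F₁ σ τ z = 0 := fun σ τ z hz => by
    simp [hF₁, hdp0 _ _ z hz]
  have z₂ : ∀ σ τ z, z ∉ tsupport ψ → F₂ σ τ z = 0 := fun σ τ z hz => by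
    simp [hF₂, hpC0 z hz]
  have c₁ : ∀ σ τ, ContDiff ℝ 1 (F₁ σ τ) := fun σ τ => contDiff_of_zero_off
    (fun z hz => (((sv z hz).mul (sP z hz σ τ)).mul (swp z _ _)).of_le h1) hcl hs (z₁ σ τ)
  have c₂ : ∀ σ τ, ContDiff ℝ 1 (F₂ σ τ) := fun σ τ => contDiff_of_zero_off
    (fun z hz => (((swv z hz _ _).mul (sP z hz σ τ)).mul (sp z)).of_le h1) hcl hs (z₂ σ τ)
  have k₁ : ∀ σ τ, HasCompactSupport (F₁ σ τ) := fun σ τ => HasCompactSupport.intro hc (z₁ σ τ)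
  have k₂ : ∀ σ τ, HasCompactSupport (F₂ σ τ) := fun σ τ => HasCompactSupport.intro hc (z₂ σ τ)
  -- the integrands differ by a divergence
  have key : ∀ z ∈ U,
      vC z * wedgeC (Function.update (fun k => A k z) k₀ (complexHessian ψ z)) -
        pC z * wedgeC (Function.update (fun k => A k z) k₀ (complexHessian v z)) =
      ∑ σ, ∑ τ, s σ τ * (wirt (-Complex.I) (σ k₀) (F₁ σ τ) z -
        wirt Complex.I (τ k₀) (F₂ σ τ) z) := by
    intro z hz
    have e₁ : ∀ σ τ, wirt (-Complex.I) (σ k₀) (F₁ σ τ) z =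
        wirt (-Complex.I) (σ k₀) vC z * P σ τ z * wirt Complex.I (τ k₀) pC z +
        vC z * wirt (-Complex.I) (σ k₀) (P σ τ) z * wirt Complex.I (τ k₀) pC z +
        vC z * P σ τ z * complexHessian ψ z (σ k₀) (τ k₀) := by
      intro σ τ
      refine (wirt_mul (F := fun w => vC w * P σ τ w) (G := wirt Complex.I (τ k₀) pC)
        ((d (sv z hz)).mul (d (sP z hz σ τ))) (d (swp z _ _))).trans ?_
      rw [wirt_mul (d (sv z hz)) (d (sP z hz σ τ)), complexHessian_eq_wirt]
      ring
    have e₂ : ∀ σ τ, wirt Complex.I (τ k₀) (F₂ σ τ) z =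
        wirt (-Complex.I) (σ k₀) vC z * P σ τ z * wirt Complex.I (τ k₀) pC z +
        pC z * wirt Complex.I (τ k₀) (P σ τ) z * wirt (-Complex.I) (σ k₀) vC z +
        pC z * P σ τ z * complexHessian v z (σ k₀) (τ k₀) := by
      intro σ τ
      refine (wirt_mul (F := fun w => wirt (-Complex.I) (σ k₀) vC w * P σ τ w) (G := pC)
        ((d (swv z hz _ _)).mul (d (sP z hz σ τ))) (d (sp z))).trans ?_
      rw [wirt_mul (d (swv z hz _ _)) (d (sP z hz σ τ)), complexHessian_eq_wirt,
        wirt_comm ((sv z hz).of_le h2)]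
      ring
    have g₁ : ∑ σ, ∑ τ, s σ τ * (vC z * wirt (-Complex.I) (σ k₀) (P σ τ) z *
        wirt Complex.I (τ k₀) pC z) = 0 := by
      rw [Finset.sum_comm]
      refine Finset.sum_eq_zero fun τ _ => ?_
      have := sum_sign_mul_wirt_prod (f := fun k i w => A k w i (τ k)) k₀ (-Complex.I) (z := z)
        (fun k i => d (sA z hz k _ _)) (fun m i j => by
          have := (hA m).dz_symm z hz j (τ m) i
          rwa [dz_eq_wirt, dz_eq_wirt] at this)
      calc _ = ((Equiv.Perm.sign τ : ℤ) : ℂ) * vC z * wirt Complex.I (τ k₀) pC z *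
            ∑ σ : Equiv.Perm (Fin n), ((Equiv.Perm.sign σ : ℤ) : ℂ) *
              wirt (-Complex.I) (σ k₀) (P σ τ) z := by
            rw [Finset.mul_sum]
            exact Finset.sum_congr rfl fun σ _ => by simp only [hs']; ring
        _ = 0 := by rw [this, mul_zero]
    have g₂ : ∑ σ, ∑ τ, s σ τ * (pC z * wirt Complex.I (τ k₀) (P σ τ) z *
        wirt (-Complex.I) (σ k₀) vC z) = 0 := by
      refine Finset.sum_eq_zero fun σ _ => ?_
      have := sum_sign_mul_wirt_prod (f := fun k j w => A k w (σ k) j) k₀ Complex.I (z := z)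
        (fun k i => d (sA z hz k _ _)) (fun m i j => (hA m).dzbar_symm z hz (σ m) j i)
      calc _ = ((Equiv.Perm.sign σ : ℤ) : ℂ) * pC z * wirt (-Complex.I) (σ k₀) vC z *
            ∑ τ : Equiv.Perm (Fin n), ((Equiv.Perm.sign τ : ℤ) : ℂ) *
              wirt Complex.I (τ k₀) (P σ τ) z := by
            rw [Finset.mul_sum]
            exact Finset.sum_congr rfl fun τ _ => by simp only [hs']; ring
        _ = 0 := by rw [this, mul_zero]
    have e : ∀ σ τ, s σ τ * (wirt (-Complex.I) (σ k₀) (F₁ σ τ) z -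
        wirt Complex.I (τ k₀) (F₂ σ τ) z) =
        vC z * (s σ τ * (complexHessian ψ z (σ k₀) (τ k₀) * P σ τ z)) -
        pC z * (s σ τ * (complexHessian v z (σ k₀) (τ k₀) * P σ τ z)) +
        s σ τ * (vC z * wirt (-Complex.I) (σ k₀) (P σ τ) z * wirt Complex.I (τ k₀) pC z) -
        s σ τ * (pC z * wirt Complex.I (τ k₀) (P σ τ) z * wirt (-Complex.I) (σ k₀) vC z) := by
      intro σ τ
      rw [e₁, e₂]; ring
    simp only [e, Finset.sum_add_distrib, Finset.sum_sub_distrib, g₁, g₂, wedgeC_update,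
      Finset.mul_sum]
    ring
  -- integrability
  have cH : ∀ {f : Model n → ℝ}, ContDiffOn ℝ ∞ f U → ContinuousOn (fun z =>
      wedgeC (Function.update (fun k => A k z) k₀ (complexHessian f z))) U := by
    intro f hf
    simp only [wedgeC_update]
    refine continuousOn_finsetSum _ fun σ _ => continuousOn_finsetSum _ fun τ _ =>
      continuousOn_const.mul (ContinuousOn.mul (fun z hz => ?_) fun z hz => ?_)
    · exact (contDiffAt_complexHessian (hf.contDiffAt (hU.mem_nhds hz))
        _ _).continuousAt.continuousWithinAt
    · exact (sP z hz σ τ).continuousAt.continuousWithinAt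
  have i₁ : IntegrableOn (fun z => vC z *
      wedgeC (Function.update (fun k => A k z) k₀ (complexHessian ψ z))) U := by
    refine integrableOn_of_zero_off hU (ContinuousOn.mul (fun z hz =>
      (sv z hz).continuousAt.continuousWithinAt) (cH hψ.contDiffOn)) hc hs fun z hz => ?_
    rw [complexHessian_eq_zero_of_notMem hcl hψ0 hz, wedgeC_update]
    simp
  have i₂ : IntegrableOn (fun z => pC z *
      wedgeC (Function.update (fun k => A k z) k₀ (complexHessian v z))) U := by
    refine integrableOn_of_zero_off hU (ContinuousOn.mul (fun z hz =>
      (sp z).continuousAt.continuousWithinAt) (cH hv)) hc hs fun z hz => ?_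
    rw [hpC0 z hz, zero_mul]
  rw [← sub_eq_zero, ← integral_sub i₁ i₂, setIntegral_congr_fun hU.measurableSet key,
    setIntegral_eq_integral_of_forall_compl_eq_zero]
  · have j₁ : ∀ σ τ, Integrable fun z => s σ τ * (wirt (-Complex.I) (σ k₀) (F₁ σ τ) z -
        wirt Complex.I (τ k₀) (F₂ σ τ) z) := fun σ τ =>
      ((integrable_wirt (c₁ σ τ) (k₁ σ τ) _ _).sub
        (integrable_wirt (c₂ σ τ) (k₂ σ τ) _ _)).const_mul _
    rw [integral_finsetSum _ fun σ _ => integrable_finsetSum _ fun τ _ => j₁ σ τ]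
    refine Finset.sum_eq_zero fun σ _ => ?_
    rw [integral_finsetSum _ fun τ _ => j₁ σ τ]
    refine Finset.sum_eq_zero fun τ _ => ?_
    rw [integral_const_mul, integral_sub (integrable_wirt (c₁ σ τ) (k₁ σ τ) _ _)
      (integrable_wirt (c₂ σ τ) (k₂ σ τ) _ _), integral_wirt_eq_zero (c₁ σ τ) (k₁ σ τ),
      integral_wirt_eq_zero (c₂ σ τ) (k₂ σ τ), sub_zero, mul_zero]
  · intro z hz
    refine Finset.sum_eq_zero fun σ _ => Finset.sum_eq_zero fun τ _ => ?_
    rw [wirt_eq_zero_of_notMem hcl (z₁ σ τ) _ _ fun h => hz (hs h),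
      wirt_eq_zero_of_notMem hcl (z₂ σ τ) _ _ fun h => hz (hs h), sub_zero, mul_zero]

end SmoothIBP

/-! ### Locally bounded measurable functions -/

section LInfLoc

variable {n : ℕ} {E : Type*} [NormedAddCommGroup E]

/-- The function `f` is of class `L^∞_loc` on `U`. -/
def LInfLoc (U : Set (Model n)) (f : Model n → E) : Prop :=
  ∀ K ⊆ U, IsCompact K → MemLp f ⊤ (volume.restrict K)

variable {U V : Set (Model n)} {f g : Model n → E}

lemma LInfLoc.add (hf : LInfLoc U f) (hg : LInfLoc U g) : LInfLoc U fun z => f z + g z :=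
  fun K hK hc => (hf K hK hc).add (hg K hK hc)

lemma LInfLoc.sub (hf : LInfLoc U f) (hg : LInfLoc U g) : LInfLoc U fun z => f z - g z :=
  fun K hK hc => (hf K hK hc).sub (hg K hK hc)

lemma LInfLoc.sum {ι : Type*} {s : Finset ι} {f : ι → Model n → E}
    (hf : ∀ i ∈ s, LInfLoc U (f i)) : LInfLoc U fun z => ∑ i ∈ s, f i z :=
  fun K hK hc => memLp_finsetSum s fun i hi => hf i hi K hK hc

lemma LInfLoc.mul {𝕜 : Type*} [NormedRing 𝕜] {f g : Model n → 𝕜} (hf : LInfLoc U f)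
    (hg : LInfLoc U g) : LInfLoc U fun z => f z * g z :=
  fun K hK hc => (hg K hK hc).mul (hf K hK hc)

lemma LInfLoc.ofReal {f : Model n → ℝ} (hf : LInfLoc U f) : LInfLoc U fun z => (f z : ℂ) :=
  fun K hK hc => (hf K hK hc).ofReal

lemma LInfLoc.re {f : Model n → ℂ} (hf : LInfLoc U f) : LInfLoc U fun z => (f z).re :=
  fun K hK hc => (hf K hK hc).re

lemma LInfLoc.congr (hf : LInfLoc U f) (h : f =ᵐ[volume.restrict U] g) : LInfLoc U g :=
  fun K hK hc => (hf K hK hc).ae_eq (ae_restrict_of_ae_restrict_of_subset hK h)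

lemma LInfLoc.of_continuousOn (hf : ContinuousOn f U) : LInfLoc U f := by
  intro K hK hc
  obtain ⟨C, hC⟩ := hc.exists_bound_of_continuousOn (hf.mono hK)
  refine memLp_top_of_bound ((hf.mono hK).aestronglyMeasurable_of_isCompact hc hc.measurableSet) C ?_
  exact (ae_restrict_iff' hc.measurableSet).2 (Eventually.of_forall hC)

lemma LInfLoc.const (c : E) : LInfLoc U fun _ => c := LInfLoc.of_continuousOn continuousOn_const

lemma LInfLoc.prod {𝕜 : Type*} [NormedCommRing 𝕜] {ι : Type*} (s : Finset ι)
    {f : ι → Model n → 𝕜} (hf : ∀ i ∈ s, LInfLoc U (f i)) :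
    LInfLoc U fun z => ∏ i ∈ s, f i z := by
  classical
  induction s using Finset.induction_on with
  | empty => simpa using LInfLoc.const (1 : 𝕜)
  | insert i s hi ih =>
    simp only [Finset.prod_insert hi]
    exact (hf i (Finset.mem_insert_self i s)).mul
      (ih fun j hj => hf j (Finset.mem_insert_of_mem hj))

lemma LInfLoc.wedgeC {A : Fin n → Model n → Matrix (Fin n) (Fin n) ℂ}
    (hA : ∀ k i j, LInfLoc U fun z => A k z i j) : LInfLoc U fun z => wedgeC fun k => A k z :=
  LInfLoc.sum fun _ _ => LInfLoc.sum fun _ _ => (LInfLoc.const _).mul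
    (LInfLoc.prod _ fun k _ => hA k _ _)

lemma LInfLoc.wedge {A : Fin n → Model n → Matrix (Fin n) (Fin n) ℂ}
    (hA : ∀ k i j, LInfLoc U fun z => A k z i j) : LInfLoc U fun z => wedge fun k => A k z :=
  (LInfLoc.wedgeC hA).re

lemma LInfLoc.exists_bound (hf : LInfLoc U f) {K : Set (Model n)} (hK : K ⊆ U)
    (hc : IsCompact K) : ∃ C : ℝ, 0 ≤ C ∧ ∀ᵐ z ∂(volume.restrict K), ‖f z‖ ≤ C := by
  have h := hf K hK hc
  refine ⟨(eLpNorm f ⊤ (volume.restrict K)).toReal, ENNReal.toReal_nonneg, ?_⟩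
  have h2 := h.2.ne
  filter_upwards [ae_le_eLpNormEssSup (f := f) (μ := volume.restrict K)] with z hz
  rw [← eLpNorm_exponent_top] at hz
  rw [← toReal_enorm]
  exact ENNReal.toReal_mono h2 hz

lemma LInfLoc.integrableOn (hf : LInfLoc U f) {K : Set (Model n)} (hK : K ⊆ U)
    (hc : IsCompact K) : IntegrableOn f K := by
  have : IsFiniteMeasure (volume.restrict K) := ⟨by
    rw [Measure.restrict_apply_univ]; exact hc.measure_lt_top⟩
  exact (hf K hK hc).integrable le_top

lemma LInfLoc.locallyIntegrableOn (hU : IsOpen U) (hf : LInfLoc U f) :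
    LocallyIntegrableOn f U volume :=
  (locallyIntegrableOn_iff hU.isLocallyClosed).2 fun _ hK hc => hf.integrableOn hK hc

lemma LInfLoc.integrableOn_of_zero_off (hf : LInfLoc U f) (hU : IsOpen U) {K : Set (Model n)}
    (hK : K ⊆ U) (hc : IsCompact K) (h0 : ∀ᵐ z ∂(volume.restrict U), z ∉ K → f z = 0) :
    IntegrableOn f U := by
  have h1 := hf.integrableOn hK hc
  refine h1.of_ae_sdiff_eq_zero hU.measurableSet.nullMeasurableSet ?_
  filter_upwards [(ae_restrict_iff' hU.measurableSet).1 h0] with z hz h using hz h.1 h.2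

/-- A property which holds almost everywhere near each point of `U` holds almost everywhere
on `U`. -/
lemma ae_of_locally_ae {p : Model n → Prop} (h : ∀ z ∈ U, ∃ V ∈ 𝓝 z, ∀ᵐ w, w ∈ V → p w) :
    ∀ᵐ z, z ∈ U → p z := by
  have : volume {z | ¬ (z ∈ U → p z)} = 0 := by
    refine measure_null_of_locally_null _ fun z hz => ?_
    rw [mem_ofPred_eq, Classical.not_imp] at hz
    obtain ⟨V, hV, hp⟩ := h z hz.1
    refine ⟨V ∩ {z | ¬ (z ∈ U → p z)}, inter_mem (mem_nhdsWithin_of_mem_nhds hV)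
      self_mem_nhdsWithin, ?_⟩
    refine measure_mono_null ?_ hp
    intro w hw hc
    exact hw.2 fun _ => hc hw.1
  exact this

lemma setIntegral_eq_of_zero_off {F : Type*} [NormedAddCommGroup F] [NormedSpace ℝ F]
    {f : Model n → F} {U K : Set (Model n)} (hU : IsOpen U) (hK : K ⊆ U)
    (h0 : ∀ z, z ∉ K → f z = 0) : ∫ z in U, f z = ∫ z in K, f z :=
  setIntegral_eq_of_subset_of_forall_sdiff_eq_zero hU.measurableSet hK fun z hz => h0 z hz.2

/-- Dominated convergence for uniformly bounded functions which vanish off a compact set. -/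
lemma tendsto_setIntegral_of_bounded {E : Type*} [NormedAddCommGroup E] [NormedSpace ℝ E]
    {F : ℕ → Model n → E} {f : Model n → E}
    {K : Set (Model n)} (hU : IsOpen U) (hK : K ⊆ U) (hc : IsCompact K)
    (hm : ∀ k, AEStronglyMeasurable (F k) (volume.restrict K)) (C : ℝ)
    (hC : ∀ k, ∀ᵐ z ∂(volume.restrict K), ‖F k z‖ ≤ C)
    (h0 : ∀ k z, z ∉ K → F k z = 0) (h0' : ∀ z, z ∉ K → f z = 0)
    (hlim : ∀ᵐ z ∂(volume.restrict K), Tendsto (fun k => F k z) atTop (𝓝 (f z))) :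
    Tendsto (fun k => ∫ z in U, F k z) atTop (𝓝 (∫ z in U, f z)) := by
  have : IsFiniteMeasure (volume.restrict K) := ⟨by
    rw [Measure.restrict_apply_univ]; exact hc.measure_lt_top⟩
  rw [setIntegral_eq_of_zero_off hU hK h0']
  simp only [setIntegral_eq_of_zero_off hU hK (h0 _)]
  exact tendsto_integral_of_dominated_convergence (fun _ => C) hm (integrable_const C) hC hlim

end LInfLoc

/-! ### Weak complex Hessians -/

section WeakHess

variable {n : ℕ}

/-- The locally integrable matrix function `H` is the distributional complex Hessian of `f` on
the open set `U`. -/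
def WeakHess (U : Set (Model n)) (f : Model n → ℝ)
    (H : Model n → Matrix (Fin n) (Fin n) ℂ) : Prop :=
  ∀ i j, LocallyIntegrableOn (fun z => H z i j) U volume ∧
    ∀ χ : Model n → ℝ, ContDiff ℝ ∞ χ → HasCompactSupport χ → tsupport χ ⊆ U →
      ∫ z in U, (f z : ℂ) * complexHessian χ z i j = ∫ z in U, H z i j * (χ z : ℂ)

variable {U V : Set (Model n)} {f g : Model n → ℝ} {H H' : Model n → Matrix (Fin n) (Fin n) ℂ}

lemma complexHessian_zero_off_tsupport (χ : Model n → ℝ) {z : Model n} (hz : z ∉ tsupport χ) :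
    complexHessian χ z = 0 :=
  complexHessian_eq_zero_of_notMem (isClosed_tsupport χ)
    (fun _ hw => image_eq_zero_of_notMem_tsupport hw) hz

lemma WeakHess.mono (h : WeakHess U f H) (hU : IsOpen U) (hV : IsOpen V) (hVU : V ⊆ U) :
    WeakHess V f H := by
  refine fun i j => ⟨(h i j).1.mono_set hVU, fun χ h1 h2 h3 => ?_⟩
  have h4 := (h i j).2 χ h1 h2 (h3.trans hVU)
  have e1 : ∀ z, z ∉ tsupport χ → (f z : ℂ) * complexHessian χ z i j = 0 := fun z hz => by
    rw [complexHessian_zero_off_tsupport χ hz]; simp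
  have e2 : ∀ z, z ∉ tsupport χ → H z i j * (χ z : ℂ) = 0 := fun z hz => by
    rw [image_eq_zero_of_notMem_tsupport hz]; simp
  rw [setIntegral_eq_of_zero_off hV h3 e1, setIntegral_eq_of_zero_off hV h3 e2]
  rwa [setIntegral_eq_of_zero_off hU (h3.trans hVU) e1,
    setIntegral_eq_of_zero_off hU (h3.trans hVU) e2] at h4

lemma integrableOn_mul_test {F : Model n → ℂ} (hF : LocallyIntegrableOn F U volume)
    (hU : IsOpen U) {χ : Model n → ℝ} (h1 : ContDiff ℝ ∞ χ) (h2 : HasCompactSupport χ)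
    (h3 : tsupport χ ⊆ U) : IntegrableOn (fun z => F z * (χ z : ℂ)) U := by
  have h4 : IntegrableOn F (tsupport χ) := hF.integrableOn_compact_subset h3 h2
  have h5 : IntegrableOn (fun z => F z * (χ z : ℂ)) (tsupport χ) :=
    h4.mul_continuousOn (Complex.continuous_ofReal.comp h1.continuous).continuousOn h2
  exact h5.of_forall_sdiff_eq_zero hU.measurableSet fun z hz => by
    rw [image_eq_zero_of_notMem_tsupport hz.2]; simp

lemma WeakHess.unique (hU : IsOpen U) (h : WeakHess U f H) (h' : WeakHess U f H') :
    ∀ᵐ z ∂(volume.restrict U), H z = H' z := by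
  have h1 : ∀ i j, ∀ᵐ z, z ∈ U → H z i j - H' z i j = 0 := by
    intro i j
    refine hU.ae_eq_zero_of_integral_contDiff_smul_eq_zero
      ((h i j).1.sub (h' i j).1) fun χ c1 c2 c3 => ?_
    have e1 : ∫ z in U, (H z i j * (χ z : ℂ) - H' z i j * (χ z : ℂ)) = 0 := by
      rw [integral_sub (integrableOn_mul_test (h i j).1 hU c1 c2 c3)
        (integrableOn_mul_test (h' i j).1 hU c1 c2 c3), ← (h i j).2 χ c1 c2 c3,
        ← (h' i j).2 χ c1 c2 c3, sub_self]
    rw [← e1, ← setIntegral_eq_integral_of_forall_compl_eq_zero (s := U) fun z hz => by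
      rw [image_eq_zero_of_notMem_tsupport fun h => hz (c3 h), zero_smul]]
    refine integral_congr_ae (Eventually.of_forall fun z => ?_)
    simp only [Complex.real_smul]
    ring
  rw [ae_restrict_iff' hU.measurableSet]
  have h2 : ∀ᵐ z, ∀ i j, z ∈ U → H z i j - H' z i j = 0 := by
    rw [ae_all_iff]; intro i; rw [ae_all_iff]; exact h1 i
  filter_upwards [h2] with z hz hzU
  ext i j
  exact sub_eq_zero.1 (hz i j hzU)

lemma continuous_complexHessian {χ : Model n → ℝ} (h : ContDiff ℝ ∞ χ) (i j : Fin n) :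
    Continuous fun z => complexHessian χ z i j :=
  continuous_iff_continuousAt.2 fun _ =>
    (contDiffAt_complexHessian h.contDiffAt i j).continuousAt

lemma LInfLoc.integrableOn_mul_hessian (hU : IsOpen U) (hf : LInfLoc U f) {χ : Model n → ℝ}
    (h1 : ContDiff ℝ ∞ χ) (h2 : HasCompactSupport χ) (h3 : tsupport χ ⊆ U) (i j : Fin n) :
    IntegrableOn (fun z => (f z : ℂ) * complexHessian χ z i j) U :=
  (hf.ofReal.mul (LInfLoc.of_continuousOn
    (continuous_complexHessian h1 i j).continuousOn)).integrableOn_of_zero_off hU h3 h2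
    (Eventually.of_forall fun z hz => by rw [complexHessian_zero_off_tsupport χ hz]; simp)

lemma WeakHess.add (hU : IsOpen U) (hf : LInfLoc U f) (hg : LInfLoc U g) (h : WeakHess U f H)
    (h' : WeakHess U g H') : WeakHess U (fun z => f z + g z) fun z => H z + H' z := by
  refine fun i j => ⟨(h i j).1.add (h' i j).1, fun χ c1 c2 c3 => ?_⟩
  have e1 : ∀ z, ((f z + g z : ℝ) : ℂ) * complexHessian χ z i j =
      (f z : ℂ) * complexHessian χ z i j + (g z : ℂ) * complexHessian χ z i j := fun z => by
    push_cast; ring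
  simp only [e1, Matrix.add_apply, add_mul]
  rw [integral_add (hf.integrableOn_mul_hessian hU c1 c2 c3 i j)
    (hg.integrableOn_mul_hessian hU c1 c2 c3 i j),
    integral_add (integrableOn_mul_test (h i j).1 hU c1 c2 c3)
    (integrableOn_mul_test (h' i j).1 hU c1 c2 c3), (h i j).2 χ c1 c2 c3, (h' i j).2 χ c1 c2 c3]

lemma WeakHess.const_mul (h : WeakHess U f H) (t : ℝ) :
    WeakHess U (fun z => t * f z) fun z => t • H z := by
  refine fun i j => ⟨(h i j).1.smul t, fun χ c1 c2 c3 => ?_⟩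
  have e1 : ∀ z, ((t * f z : ℝ) : ℂ) * complexHessian χ z i j =
      (t : ℂ) * ((f z : ℂ) * complexHessian χ z i j) := fun z => by push_cast; ring
  have e2 : ∀ z, (t • H z) i j * (χ z : ℂ) = (t : ℂ) * (H z i j * (χ z : ℂ)) := fun z => by
    rw [Matrix.smul_apply, Complex.real_smul]; ring
  simp only [e1, e2]
  rw [integral_const_mul, integral_const_mul, (h i j).2 χ c1 c2 c3]

lemma WeakHess.congr (h : WeakHess U f H) (hf : f =ᵐ[volume.restrict U] g)
    (hH : H =ᵐ[volume.restrict U] H') : WeakHess U g H' := by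
  refine fun i j => ⟨fun z hz => ?_, fun χ c1 c2 c3 => ?_⟩
  · obtain ⟨s, hs, hi⟩ := (h i j).1 z hz
    refine ⟨s ∩ U, inter_mem hs self_mem_nhdsWithin, ?_⟩
    refine (hi.mono_set inter_subset_left).congr ?_
    filter_upwards [ae_restrict_of_ae_restrict_of_subset inter_subset_right hH] with w hw
    rw [hw]
  · have := (h i j).2 χ c1 c2 c3
    have e1 : ∫ z in U, (f z : ℂ) * complexHessian χ z i j =
        ∫ z in U, (g z : ℂ) * complexHessian χ z i j := integral_congr_ae (by
      filter_upwards [hf] with z hz; rw [hz])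
    have e2 : ∫ z in U, H z i j * (χ z : ℂ) = ∫ z in U, H' z i j * (χ z : ℂ) :=
      integral_congr_ae (by filter_upwards [hH] with z hz; rw [hz])
    rw [← e1, ← e2, this]

end WeakHess

/-! ### Functions of class `C^{1,1}` -/

section C11

variable {n : ℕ} {U : Set (Model n)}

/-- Near a compact subset of `U`, a locally Lipschitz function agrees with a Lipschitz one. -/
lemma exists_lipschitz_extension (hU : IsOpen U) {g : Model n → ℝ} (hg : LocallyLipschitzOn U g)
    {K : Set (Model n)} (hK : IsCompact K) (hKU : K ⊆ U) :
    ∃ (C : NNReal) (G : Model n → ℝ), LipschitzWith C G ∧ ∀ z ∈ K, g =ᶠ[𝓝 z] G := by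
  obtain ⟨L, hL, hKL, hLU⟩ := exists_compact_between hK hU hKU
  obtain ⟨C, hC⟩ := (hg.mono hLU).exists_lipschitzOnWith_of_compact hL
  obtain ⟨G, hG, he⟩ := hC.extend_real
  refine ⟨C, G, hG, fun z hz => ?_⟩
  filter_upwards [isOpen_interior.mem_nhds (hKL hz)] with w hw using he (interior_subset hw)

lemma LInfLoc.fderiv_of_locallyLipschitzOn (hU : IsOpen U) {g : Model n → ℝ}
    (hg : LocallyLipschitzOn U g) (v : Model n) : LInfLoc U fun z => fderiv ℝ g z v := by
  intro K hKU hK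
  obtain ⟨C, G, hG, he⟩ := exists_lipschitz_extension hU hg hK hKU
  refine memLp_top_of_bound (measurable_fderiv_apply_const ℝ g v).aestronglyMeasurable
    (C * ‖v‖) ((ae_restrict_iff' hK.measurableSet).2 (Eventually.of_forall fun z hz => ?_))
  rw [(he z hz).fderiv_eq]
  exact (ContinuousLinearMap.le_opNorm _ _).trans
    (mul_le_mul_of_nonneg_right (norm_fderiv_le_of_lipschitz ℝ hG) (norm_nonneg v))

/-- Integration by parts for locally Lipschitz functions. -/
lemma integral_fderiv_mul_of_locallyLipschitzOn (hU : IsOpen U) {g : Model n → ℝ}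
    (hg : LocallyLipschitzOn U g) {χ : Model n → ℝ} (h1 : ContDiff ℝ ∞ χ)
    (h2 : HasCompactSupport χ) (h3 : tsupport χ ⊆ U) (v : Model n) :
    ∫ z in U, fderiv ℝ g z v * χ z = -∫ z in U, g z * fderiv ℝ χ z v := by
  obtain ⟨C, G, hG, he⟩ := exists_lipschitz_extension hU hg h2 h3
  obtain ⟨D, hD⟩ := h1.lipschitzWith_of_hasCompactSupport h2 (by simp)
  have hχ0 : ∀ z, z ∉ tsupport χ → χ z = 0 := fun z hz => image_eq_zero_of_notMem_tsupport hz
  have hd0 : ∀ z, z ∉ tsupport χ → fderiv ℝ χ z v = 0 := fun z hz => by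
    rw [image_eq_zero_of_notMem_tsupport fun h => hz (tsupport_fderiv_subset ℝ h)]; simp
  have key := LipschitzWith.integral_lineDeriv_mul_eq (μ := (volume : Measure (Model n))) hG hD h2 v
  have e1 : ∫ z in U, fderiv ℝ g z v * χ z = ∫ z, lineDeriv ℝ G z v * χ z := by
    rw [setIntegral_eq_integral_of_forall_compl_eq_zero fun z hz => by
      rw [hχ0 z fun h => hz (h3 h), mul_zero]]
    refine integral_congr_ae ?_
    filter_upwards [hG.ae_differentiableAt (μ := (volume : Measure (Model n)))] with z hz
    by_cases h : z ∈ tsupport χ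
    · rw [(he z h).fderiv_eq, hz.lineDeriv_eq_fderiv]
    · rw [hχ0 z h, mul_zero, mul_zero]
  have e2 : ∫ z in U, g z * fderiv ℝ χ z v = -∫ z, lineDeriv ℝ χ z (-v) * G z := by
    rw [setIntegral_eq_integral_of_forall_compl_eq_zero fun z hz => by
      rw [hd0 z fun h => hz (h3 h), mul_zero], ← integral_neg]
    refine integral_congr_ae (Eventually.of_forall fun z => ?_)
    have hz : DifferentiableAt ℝ χ z := h1.differentiable (by simp) z
    simp only
    rw [hz.lineDeriv_eq_fderiv, map_neg]
    by_cases h : z ∈ tsupport χ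
    · rw [(he z h).self_of_nhds]; ring
    · rw [hd0 z h]; ring
  rw [e1, e2, neg_neg, key]

lemma locallyLipschitzOn_of_contDiffOn {F : Type*} [NormedAddCommGroup F] [NormedSpace ℝ F]
    (hU : IsOpen U) {f : Model n → F} (hf : ContDiffOn ℝ 1 f U) :
    LocallyLipschitzOn U f := by
  intro z hz
  obtain ⟨C, t, ht, h⟩ := (hf.contDiffAt (hU.mem_nhds hz)).exists_lipschitzOnWith
  exact ⟨C, t, mem_nhdsWithin_of_mem_nhds ht, h⟩

lemma locallyLipschitzOn_fderiv_apply {f : Model n → ℝ} (hf : LocallyLipschitzOn U (fderiv ℝ f))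
    (w : Model n) : LocallyLipschitzOn U fun z => fderiv ℝ f z w := by
  intro z hz
  obtain ⟨C, t, ht, h⟩ := hf hz
  exact ⟨_, t, ht, ((ContinuousLinearMap.apply ℝ ℝ w).lipschitz.comp_lipschitzOnWith h)⟩

/-- Rademacher's theorem for the derivative of a function of class `C^{1,1}`. -/
lemma ae_differentiableAt_fderiv (hU : IsOpen U) {f : Model n → ℝ}
    (hf : LocallyLipschitzOn U (fderiv ℝ f)) :
    ∀ᵐ z ∂(volume.restrict U), DifferentiableAt ℝ (fderiv ℝ f) z := by
  rw [ae_restrict_iff' hU.measurableSet]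
  refine ae_of_locally_ae fun z hz => ?_
  obtain ⟨C, t, ht, h⟩ := hf hz
  rw [hU.nhdsWithin_eq hz] at ht
  refine ⟨interior t, interior_mem_nhds.2 ht, ?_⟩
  filter_upwards [h.ae_differentiableWithinAt_of_mem (μ := (volume : Measure (Model n)))]
    with w hw hwt
  exact (hw (interior_subset hwt)).differentiableAt (mem_interior_iff_mem_nhds.1 hwt)

lemma fderiv_fderiv_apply {f : Model n → ℝ} {z : Model n}
    (h : DifferentiableAt ℝ (fderiv ℝ f) z) (v w : Model n) :
    fderiv ℝ (fun y => fderiv ℝ f y w) z v = fderiv ℝ (fderiv ℝ f) z v w := by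
  have := ((ContinuousLinearMap.apply ℝ ℝ w).hasFDerivAt.comp z h.hasFDerivAt).fderiv
  have e4 : (fun y => fderiv ℝ f y w) = (ContinuousLinearMap.apply ℝ ℝ w) ∘ fderiv ℝ f := rfl
  rw [e4, this]; rfl

variable {f : Model n → ℝ}

lemma differentiableAt_of_contDiffOn_one (hU : IsOpen U) (hf : ContDiffOn ℝ 1 f U) {z : Model n}
    (hz : z ∈ U) : ∀ᶠ w in 𝓝 z, DifferentiableAt ℝ f w := by
  filter_upwards [hU.mem_nhds hz] with w hw
  exact (hf.contDiffAt (hU.mem_nhds hw)).differentiableAt (by simp)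

lemma ae_twice_of_c11 (hU : IsOpen U) (hf : ContDiffOn ℝ 1 f U)
    (hf' : LocallyLipschitzOn U (fderiv ℝ f)) :
    ∀ᵐ z ∂(volume.restrict U), (∀ᶠ w in 𝓝 z, DifferentiableAt ℝ f w) ∧
      DifferentiableAt ℝ (fderiv ℝ f) z := by
  filter_upwards [ae_differentiableAt_fderiv hU hf', ae_restrict_mem hU.measurableSet] with z h hz
  exact ⟨differentiableAt_of_contDiffOn_one hU hf hz, h⟩

lemma LInfLoc.fderiv_fderiv (hU : IsOpen U) (hf' : LocallyLipschitzOn U (fderiv ℝ f))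
    (v w : Model n) : LInfLoc U fun z => fderiv ℝ (fderiv ℝ f) z v w :=
  (LInfLoc.fderiv_of_locallyLipschitzOn hU (locallyLipschitzOn_fderiv_apply hf' w) v).congr (by
    filter_upwards [ae_differentiableAt_fderiv hU hf'] with z hz using fderiv_fderiv_apply hz v w)

lemma LInfLoc.sesqPart {B : Model n → Model n →L[ℝ] Model n →L[ℝ] ℝ}
    (hB : ∀ v w, LInfLoc U fun z => B z v w) (v w : Model n) :
    LInfLoc U fun z => sesqPart (B z) v w :=
  (LInfLoc.const _).mul ((((hB _ _).ofReal.add ((LInfLoc.const _).mul (hB _ _).ofReal)).sub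
    ((LInfLoc.const _).mul (hB _ _).ofReal)).add (hB _ _).ofReal)

lemma LInfLoc.complexHessian (hU : IsOpen U) (hf : ContDiffOn ℝ 1 f U)
    (hf' : LocallyLipschitzOn U (fderiv ℝ f)) (i j : Fin n) :
    LInfLoc U fun z => complexHessian f z i j :=
  (LInfLoc.sesqPart (LInfLoc.fderiv_fderiv hU hf') (Pi.single i 1) (Pi.single j 1)).congr (by
    filter_upwards [ae_twice_of_c11 hU hf hf'] with z hz
    exact (complexHessian_apply hz.1 hz.2 i j).symm)

/-- The second derivatives of a function of class `C^{1,1}` are its weak second derivatives. -/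
lemma integral_mul_fderiv_fderiv (hU : IsOpen U) (hf : ContDiffOn ℝ 1 f U)
    (hf' : LocallyLipschitzOn U (fderiv ℝ f)) {χ : Model n → ℝ} (h1 : ContDiff ℝ ∞ χ)
    (h2 : HasCompactSupport χ) (h3 : tsupport χ ⊆ U) (v w : Model n) :
    ∫ z in U, f z * fderiv ℝ (fderiv ℝ χ) z v w = ∫ z in U, fderiv ℝ (fderiv ℝ f) z v w * χ z := by
  have hχd : ContDiff ℝ ∞ (fderiv ℝ χ) := h1.fderiv_right (by simp)
  have hχv : ∀ v, ContDiff ℝ ∞ fun z => fderiv ℝ χ z v := fun v => hχd.clm_apply contDiff_const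
  have hs : ∀ z v w, fderiv ℝ (fderiv ℝ χ) z v w = fderiv ℝ (fderiv ℝ χ) z w v := fun z =>
    second_derivative_symmetric_of_eventually (𝕜 := ℝ)
      (Eventually.of_forall fun w => (h1.differentiable (by simp) w).hasFDerivAt)
      (hχd.differentiable (by simp) z).hasFDerivAt
  have e1 : ∫ z in U, fderiv ℝ (fderiv ℝ f) z v w * χ z =
      ∫ z in U, fderiv ℝ (fun y => fderiv ℝ f y w) z v * χ z := by
    refine integral_congr_ae ?_
    filter_upwards [ae_differentiableAt_fderiv hU hf'] with z hz
    rw [fderiv_fderiv_apply hz]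
  have hts : tsupport (fun z => fderiv ℝ χ z v) ⊆ tsupport χ := tsupport_fderiv_apply_subset ℝ v
  have e2 := integral_fderiv_mul_of_locallyLipschitzOn hU (locallyLipschitzOn_fderiv_apply hf' w)
    h1 h2 h3 v
  have e3 := integral_fderiv_mul_of_locallyLipschitzOn hU (locallyLipschitzOn_of_contDiffOn hU hf)
    (hχv v) (h2.fderiv_apply ℝ v) (hts.trans h3) w
  rw [e1, e2, e3, neg_neg]
  refine integral_congr_ae (Eventually.of_forall fun z => ?_)
  simp only
  rw [fderiv_fderiv_apply (hχd.differentiable (by simp) z), hs]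

lemma integral_quarter_combination {g₁ g₂ g₃ g₄ : Model n → ℂ} (h₁ : IntegrableOn g₁ U)
    (h₂ : IntegrableOn g₂ U) (h₃ : IntegrableOn g₃ U) (h₄ : IntegrableOn g₄ U) :
    ∫ z in U, (1 / 4 : ℂ) * (g₁ z + Complex.I * g₂ z - Complex.I * g₃ z + g₄ z) =
      (1 / 4 : ℂ) * ((∫ z in U, g₁ z) + Complex.I * (∫ z in U, g₂ z) -
        Complex.I * (∫ z in U, g₃ z) + ∫ z in U, g₄ z) := by
  have h₂' : IntegrableOn (fun z => Complex.I * g₂ z) U := h₂.const_mul _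
  have h₃' : IntegrableOn (fun z => Complex.I * g₃ z) U := h₃.const_mul _
  have h₁₂ : IntegrableOn (fun z => g₁ z + Complex.I * g₂ z) U := h₁.add h₂'
  have h₁₃ : IntegrableOn (fun z => g₁ z + Complex.I * g₂ z - Complex.I * g₃ z) U := h₁₂.sub h₃'
  rw [integral_const_mul, integral_add h₁₃ h₄, integral_sub h₁₂ h₃', integral_add h₁ h₂',
    integral_const_mul, integral_const_mul]

/-- The pointwise complex Hessian of a function of class `C^{1,1}` is its weak complex Hessian: the
derivative of `f` is locally Lipschitz, so the second derivatives exist almost everywhere and are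
the weak ones. -/
lemma weakHess_of_c11 (hU : IsOpen U) (hf : ContDiffOn ℝ 1 f U)
    (hf' : LocallyLipschitzOn U (fderiv ℝ f)) : WeakHess U f (complexHessian f) := by
  refine fun i j => ⟨(LInfLoc.complexHessian hU hf hf' i j).locallyIntegrableOn hU,
    fun χ h1 h2 h3 => ?_⟩
  set a : Model n := Pi.single i 1
  set b : Model n := Pi.single j 1
  have hχd : ContDiff ℝ ∞ (fderiv ℝ χ) := h1.fderiv_right (by simp)
  have hχ0 : ∀ z, z ∉ tsupport χ → χ z = 0 := fun z hz => image_eq_zero_of_notMem_tsupport hz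
  have hχ2 : ∀ z, z ∉ tsupport χ → fderiv ℝ (fderiv ℝ χ) z = 0 := fun z hz =>
    image_eq_zero_of_notMem_tsupport fun h =>
      hz (tsupport_fderiv_subset ℝ (tsupport_fderiv_subset ℝ h))
  have i1 : ∀ v w, IntegrableOn (fun z => ((f z * fderiv ℝ (fderiv ℝ χ) z v w : ℝ) : ℂ)) U :=
    fun v w => by
      have hl : LInfLoc U fun z => fderiv ℝ (fderiv ℝ χ) z v w := LInfLoc.of_continuousOn
        (((hχd.fderiv_right (m := ∞) (by simp)).continuous.clm_apply
          continuous_const).clm_apply continuous_const).continuousOn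
      exact ((LInfLoc.of_continuousOn hf.continuousOn).mul hl).ofReal.integrableOn_of_zero_off
        hU h3 h2 (Eventually.of_forall fun z hz => by simp [hχ2 z hz])
  have i2 : ∀ v w, IntegrableOn (fun z => ((fderiv ℝ (fderiv ℝ f) z v w * χ z : ℝ) : ℂ)) U :=
    fun v w => ((LInfLoc.fderiv_fderiv hU hf' v w).mul (LInfLoc.of_continuousOn
      h1.continuous.continuousOn)).ofReal.integrableOn_of_zero_off
        hU h3 h2 (Eventually.of_forall fun z hz => by simp [hχ0 z hz])
  have key : ∀ v w, ∫ z in U, ((f z * fderiv ℝ (fderiv ℝ χ) z v w : ℝ) : ℂ) =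
      ∫ z in U, ((fderiv ℝ (fderiv ℝ f) z v w * χ z : ℝ) : ℂ) := fun v w => by
    rw [integral_complex_ofReal, integral_complex_ofReal, integral_mul_fderiv_fderiv hU hf hf' h1 h2 h3]
  have e1 : ∀ z, (f z : ℂ) * complexHessian χ z i j = (1 / 4 : ℂ) *
      (((f z * fderiv ℝ (fderiv ℝ χ) z a b : ℝ) : ℂ) +
      Complex.I * ((f z * fderiv ℝ (fderiv ℝ χ) z a (Complex.I • b) : ℝ) : ℂ) -
      Complex.I * ((f z * fderiv ℝ (fderiv ℝ χ) z (Complex.I • a) b : ℝ) : ℂ) +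
      ((f z * fderiv ℝ (fderiv ℝ χ) z (Complex.I • a) (Complex.I • b) : ℝ) : ℂ)) := fun z => by
    have hz := contDiffAt_twice (h1.contDiffAt.of_le (WithTop.coe_le_coe.2 le_top) :
      ContDiffAt ℝ 2 χ z)
    rw [complexHessian_apply hz.1 hz.2, WeakCSCK.sesqPart]
    push_cast
    ring
  have e2 : (fun z => complexHessian f z i j * (χ z : ℂ)) =ᵐ[volume.restrict U]
      fun z => (1 / 4 : ℂ) *
      (((fderiv ℝ (fderiv ℝ f) z a b * χ z : ℝ) : ℂ) +
      Complex.I * ((fderiv ℝ (fderiv ℝ f) z a (Complex.I • b) * χ z : ℝ) : ℂ) -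
      Complex.I * ((fderiv ℝ (fderiv ℝ f) z (Complex.I • a) b * χ z : ℝ) : ℂ) +
      ((fderiv ℝ (fderiv ℝ f) z (Complex.I • a) (Complex.I • b) * χ z : ℝ) : ℂ)) := by
    filter_upwards [ae_twice_of_c11 hU hf hf'] with z hz
    rw [complexHessian_apply hz.1 hz.2, WeakCSCK.sesqPart]
    push_cast
    ring
  rw [integral_congr_ae e2]
  simp only [e1]
  rw [integral_quarter_combination (i1 _ _) (i1 _ _) (i1 _ _) (i1 _ _),
    integral_quarter_combination (i2 _ _) (i2 _ _) (i2 _ _) (i2 _ _), key, key, key, key]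

lemma c11_of_contDiffOn (hU : IsOpen U) (hf : ContDiffOn ℝ ∞ f U) :
    ContDiffOn ℝ 1 f U ∧ LocallyLipschitzOn U (fderiv ℝ f) := by
  have h1 : (1 : WithTop ℕ∞) ≤ ∞ := by exact_mod_cast le_top
  exact ⟨hf.of_le h1, locallyLipschitzOn_of_contDiffOn hU
    ((hf.fderiv_of_isOpen hU (m := ∞) (by simp)).of_le h1)⟩

lemma weakHess_of_contDiffOn (hU : IsOpen U) (hf : ContDiffOn ℝ ∞ f U) :
    WeakHess U f (complexHessian f) :=
  weakHess_of_c11 hU (c11_of_contDiffOn hU hf).1 (c11_of_contDiffOn hU hf).2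

end C11

section

open scoped Convolution

/-! ### Mollification -/

section Mollify

variable {n : ℕ}

lemma complexHessian_reflect {φ : Model n → ℝ} (hφ : ContDiff ℝ ∞ φ) (z t : Model n) :
    complexHessian (fun y => φ (z - y)) t = complexHessian φ (z - t) := by
  have hτ : ContDiffAt ℂ 2 (fun y : Model n => z - y) t := contDiffAt_const.sub contDiffAt_id
  have h := complexHessian_comp (τ := fun y : Model n => z - y) hτ
    (hφ.contDiffAt.of_le (WithTop.coe_le_coe.2 le_top) : ContDiffAt ℝ 2 φ (z - t))
  have hj : jacobian (fun y : Model n => z - y) t = -1 := by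
    ext a i
    have : fderiv ℂ (fun y : Model n => z - y) t = -ContinuousLinearMap.id ℂ (Model n) := by
      rw [fderiv_const_sub]; simp
    rw [jacobian, Matrix.of_apply, this]
    simp [Pi.single_apply, Matrix.one_apply]
  have hm : (-1 : Matrix (Fin n) (Fin n) ℂ).map (starRingEnd ℂ) = -1 := by
    ext a i
    by_cases h : a = i <;> simp [h]
  rw [hj, hm] at h
  simpa [Function.comp_def] using h

lemma fderiv_convolution_apply {g φ : Model n → ℝ} (hg : LocallyIntegrable g volume)
    (hφ : ContDiff ℝ ∞ φ) (hc : HasCompactSupport φ) (z w : Model n) :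
    fderiv ℝ (g ⋆[ContinuousLinearMap.lsmul ℝ ℝ, volume] φ) z w =
      (g ⋆[ContinuousLinearMap.lsmul ℝ ℝ, volume] fun y => fderiv ℝ φ y w) z := by
  rw [(hc.hasFDerivAt_convolution_right (ContinuousLinearMap.lsmul ℝ ℝ) hg
    (hφ.of_le (by exact_mod_cast le_top)) z).fderiv]
  exact convolution_precompR_apply (ContinuousLinearMap.lsmul ℝ ℝ) hg (hc.fderiv ℝ)
    (hφ.continuous_fderiv (by simp)) z w

lemma contDiff_convolution {g φ : Model n → ℝ} (hg : LocallyIntegrable g volume)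
    (hφ : ContDiff ℝ ∞ φ) (hc : HasCompactSupport φ) :
    ContDiff ℝ ∞ (g ⋆[ContinuousLinearMap.lsmul ℝ ℝ, volume] φ) :=
  hc.contDiff_convolution_right (n := ⊤) (ContinuousLinearMap.lsmul ℝ ℝ) hg hφ

lemma complexHessian_convolution {g φ : Model n → ℝ} (hg : LocallyIntegrable g volume)
    (hφ : ContDiff ℝ ∞ φ) (hc : HasCompactSupport φ) (z : Model n) (i j : Fin n) :
    complexHessian (g ⋆[ContinuousLinearMap.lsmul ℝ ℝ, volume] φ) z i j =
      ∫ t, (g t : ℂ) * complexHessian φ (z - t) i j := by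
  have h2 : (2 : WithTop ℕ∞) ≤ ∞ := WithTop.coe_le_coe.2 le_top
  have hφd : ContDiff ℝ ∞ (fderiv ℝ φ) := hφ.fderiv_right (by simp)
  have hφv : ∀ v, ContDiff ℝ ∞ fun z => fderiv ℝ φ z v := fun v => hφd.clm_apply contDiff_const
  have hFt := contDiffAt_twice ((contDiff_convolution hg hφ hc).contDiffAt.of_le h2 :
    ContDiffAt ℝ 2 _ z)
  have hφ2 : ∀ v w, ContDiff ℝ ∞ fun z => fderiv ℝ (fun y => fderiv ℝ φ y w) z v := fun v w =>
    ((hφv w).fderiv_right (m := ∞) (by simp)).clm_apply contDiff_const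
  have hφt : ∀ y, (∀ᶠ w in 𝓝 y, DifferentiableAt ℝ φ w) ∧ DifferentiableAt ℝ (fderiv ℝ φ) y :=
    fun y => contDiffAt_twice (hφ.contDiffAt.of_le h2)
  have hD : ∀ v w, fderiv ℝ (fderiv ℝ (g ⋆[ContinuousLinearMap.lsmul ℝ ℝ, volume] φ)) z v w =
      ∫ t, g t * fderiv ℝ (fderiv ℝ φ) (z - t) v w := by
    intro v w
    rw [← fderiv_fderiv_apply hFt.2]
    have e1 : (fun y => fderiv ℝ (g ⋆[ContinuousLinearMap.lsmul ℝ ℝ, volume] φ) y w) =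
        (g ⋆[ContinuousLinearMap.lsmul ℝ ℝ, volume] fun y => fderiv ℝ φ y w) := by
      funext y; exact fderiv_convolution_apply hg hφ hc y w
    rw [e1, fderiv_convolution_apply hg (hφv w) (hc.fderiv_apply ℝ w), convolution_def]
    refine integral_congr_ae (Eventually.of_forall fun t => ?_)
    simp only [ContinuousLinearMap.lsmul_apply, smul_eq_mul]
    rw [fderiv_fderiv_apply (hφt _).2]
  have hI : ∀ v w, IntegrableOn (fun t => ((g t * fderiv ℝ (fderiv ℝ φ) (z - t) v w : ℝ) : ℂ))
      univ := by
    intro v w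
    have h1 := ((hc.fderiv_apply ℝ w).fderiv_apply ℝ v).convolutionExists_right
      (ContinuousLinearMap.lsmul ℝ ℝ) hg (hφ2 v w).continuous z
    rw [integrableOn_univ]
    refine (Integrable.congr h1 (Eventually.of_forall fun t => ?_)).ofReal
    simp only [ContinuousLinearMap.lsmul_apply, smul_eq_mul]
    rw [fderiv_fderiv_apply (hφt _).2]
    rfl
  rw [complexHessian_apply hFt.1 hFt.2, sesqPart]
  simp only [hD]
  have hq := integral_quarter_combination (hI (Pi.single i 1) (Pi.single j 1))
    (hI (Pi.single i 1) (Complex.I • Pi.single j 1))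
    (hI (Complex.I • Pi.single i 1) (Pi.single j 1))
    (hI (Complex.I • Pi.single i 1) (Complex.I • Pi.single j 1))
  simp only [Measure.restrict_univ, integral_complex_ofReal] at hq
  rw [← hq]
  refine integral_congr_ae (Eventually.of_forall fun t => ?_)
  simp only
  rw [complexHessian_apply (hφt _).1 (hφt _).2, sesqPart]
  push_cast
  ring

lemma norm_convolution_le_of_ae_bound {E : Type*} [NormedAddCommGroup E] [NormedSpace ℝ E]
    {φ : ContDiffBump (0 : Model n)} {g : Model n → E} {C : ℝ}
    (hC : ∀ᵐ z, ‖g z‖ ≤ C) (z : Model n) :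
    ‖(φ.normed volume ⋆[ContinuousLinearMap.lsmul ℝ ℝ, volume] g) z‖ ≤ C := by
  have h1 : ∀ᵐ t, ‖g (z - t)‖ ≤ C :=
    (quasiMeasurePreserving_sub_left (volume : Measure (Model n)) z).ae hC
  rw [convolution_def]
  calc ‖∫ t, ContinuousLinearMap.lsmul ℝ ℝ (φ.normed volume t) (g (z - t))‖
      ≤ ∫ t, φ.normed volume t * C := by
        refine norm_integral_le_of_norm_le (φ.integrable_normed.mul_const C) ?_
        filter_upwards [h1] with t ht
        rw [ContinuousLinearMap.lsmul_apply, norm_smul, Real.norm_of_nonneg (φ.nonneg_normed t)]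
        exact mul_le_mul_of_nonneg_left ht (φ.nonneg_normed t)
    _ = C := by rw [integral_mul_const, φ.integral_normed, one_mul]

variable {U : Set (Model n)} {f : Model n → ℝ} {H : Model n → Matrix (Fin n) (Fin n) ℂ}

/-- Near a compact set `K`, a locally bounded function with locally bounded weak complex Hessian
is an almost everywhere limit of smooth functions which are bounded together with their complex
Hessians, and whose complex Hessians converge almost everywhere to the weak complex Hessian. The
last clause keeps the supports of the approximations within distance `δ` of that of `f`. -/
lemma WeakHess.exists_smooth_approx (hU : IsOpen U) (hf : LInfLoc U f)
    (hH : ∀ i j, LInfLoc U fun z => H z i j) (hw : WeakHess U f H) {K : Set (Model n)}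
    (hK : IsCompact K) (hKU : K ⊆ U) {δ : ℝ} (hδ : 0 < δ) :
    ∃ (F : ℕ → Model n → ℝ) (C : ℝ), (∀ k, ContDiff ℝ ∞ (F k)) ∧ (∀ k z, |F k z| ≤ C) ∧
      (∀ k, ∀ z ∈ K, ∀ i j, ‖complexHessian (F k) z i j‖ ≤ C) ∧
      (∀ᵐ z ∂(volume.restrict K), Tendsto (fun k => F k z) atTop (𝓝 (f z))) ∧
      (∀ᵐ z ∂(volume.restrict K), ∀ i j,
        Tendsto (fun k => complexHessian (F k) z i j) atTop (𝓝 (H z i j))) ∧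
      ∀ k z, (∀ w ∈ Metric.ball z δ, f w = 0) → F k z = 0 := by
  obtain ⟨r, hr, hrU⟩ := hK.exists_cthickening_subset_open hU hKU
  set L := Metric.cthickening r K with hL
  have hLc : IsCompact L := hK.cthickening
  have hKL : K ⊆ L := Metric.self_subset_cthickening K
  set f' : Model n → ℝ := L.indicator f with hf'
  set H' : Fin n → Fin n → Model n → ℂ := fun i j => L.indicator fun z => H z i j with hH'
  have hf'i : Integrable f' := (hf.integrableOn hrU hLc).integrable_indicator hLc.measurableSet
  have hH'i : ∀ i j, Integrable (H' i j) := fun i j =>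
    ((hH i j).integrableOn hrU hLc).integrable_indicator hLc.measurableSet
  -- a common bound
  obtain ⟨C₀, hC₀, hfC⟩ := hf.exists_bound hrU hLc
  choose C₁ hC₁ hHC using fun i j => (hH i j).exists_bound hrU hLc
  set C := C₀ + ∑ i, ∑ j, C₁ i j with hC
  have hC₀C : C₀ ≤ C := le_add_of_nonneg_right
    (Finset.sum_nonneg fun i _ => Finset.sum_nonneg fun j _ => hC₁ i j)
  have hC₁C : ∀ i j, C₁ i j ≤ C := fun i j => by
    have h1 : C₁ i j ≤ ∑ j, C₁ i j :=
      Finset.single_le_sum (f := fun j => C₁ i j) (fun j _ => hC₁ i j) (Finset.mem_univ j)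
    have h2 : ∑ j, C₁ i j ≤ ∑ i, ∑ j, C₁ i j :=
      Finset.single_le_sum (f := fun i => ∑ j, C₁ i j)
        (fun i _ => Finset.sum_nonneg fun j _ => hC₁ i j) (Finset.mem_univ i)
    linarith
  have hCn : 0 ≤ C := hC₀.trans hC₀C
  have hf'C : ∀ᵐ z, ‖f' z‖ ≤ C := by
    filter_upwards [(ae_restrict_iff' hLc.measurableSet).1 hfC] with z hz
    by_cases h : z ∈ L
    · rw [hf', indicator_of_mem h]; exact (hz h).trans hC₀C
    · rw [hf', indicator_of_notMem h]; simpa using hCn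
  have hH'C : ∀ i j, ∀ᵐ z, ‖H' i j z‖ ≤ C := fun i j => by
    filter_upwards [(ae_restrict_iff' hLc.measurableSet).1 (hHC i j)] with z hz
    by_cases h : z ∈ L
    · simp only [hH', indicator_of_mem h]; exact (hz h).trans (hC₁C i j)
    · simp only [hH', indicator_of_notMem h]; simpa using hCn
  -- the mollifiers
  set ρ : ℝ := min r δ with hρ
  have hρ0 : 0 < ρ := lt_min hr hδ
  set φ : ℕ → ContDiffBump (0 : Model n) := fun k =>
    { rIn := ρ / (k + 1) / 2
      rOut := ρ / (k + 1)
      rIn_pos := by positivity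
      rIn_lt_rOut := half_lt_self (by positivity) } with hφ
  have hφr : ∀ k, (φ k).rOut ≤ ρ := fun k => by
    refine div_le_self hρ0.le ?_
    have : (0 : ℝ) ≤ k := k.cast_nonneg
    linarith
  have hφlim : Tendsto (fun k => (φ k).rOut) atTop (𝓝 0) := by
    have := tendsto_one_div_add_atTop_nhds_zero_nat (𝕜 := ℝ)
    simpa [hφ, div_eq_mul_inv] using this.const_mul ρ
  have hφK : ∀ᶠ k in atTop, (φ k).rOut ≤ 2 * (φ k).rIn :=
    Eventually.of_forall fun k => by simp only [hφ]; linarith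
  have hφs : ∀ k, ContDiff ℝ ∞ ((φ k).normed volume) := fun k => (φ k).contDiff_normed (n := ⊤)
  have hφc : ∀ k, HasCompactSupport ((φ k).normed volume) := fun k =>
    (φ k).hasCompactSupport_normed
  set F : ℕ → Model n → ℝ := fun k =>
    (f' ⋆[ContinuousLinearMap.lsmul ℝ ℝ, volume] (φ k).normed volume) with hF
  have hFflip : ∀ k, F k =
      ((φ k).normed volume ⋆[ContinuousLinearMap.lsmul ℝ ℝ, volume] f') := by
    intro k
    funext z
    simp only [hF]
    rw [convolution_def, convolution_eq_swap]
    refine integral_congr_ae (Eventually.of_forall fun t => ?_)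
    simp [mul_comm]
  -- the Hessian of the mollification is the mollification of the weak Hessian
  have hHess : ∀ k, ∀ z ∈ K, ∀ i j, complexHessian (F k) z i j =
      ((φ k).normed volume ⋆[ContinuousLinearMap.lsmul ℝ ℝ, volume] H' i j) z := by
    intro k z hz i j
    set χ : Model n → ℝ := fun t => (φ k).normed volume (z - t) with hχ
    have hχs : ContDiff ℝ ∞ χ := (hφs k).comp (contDiff_const.sub contDiff_id)
    have hχ0 : ∀ t, t ∉ Metric.closedBall z (φ k).rOut → χ t = 0 := fun t ht => by
      refine image_eq_zero_of_notMem_tsupport (f := (φ k).normed volume) ?_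
      rw [(φ k).tsupport_normed_eq]
      intro h
      apply ht
      rw [Metric.mem_closedBall, dist_comm, dist_eq_norm]
      simpa using h
    have hcb : Metric.closedBall z (φ k).rOut ⊆ L := fun t ht =>
      Metric.mem_cthickening_of_dist_le t z r K hz
        ((Metric.mem_closedBall.1 ht).trans ((hφr k).trans (min_le_left _ _)))
    have hχc : HasCompactSupport χ := HasCompactSupport.intro (isCompact_closedBall z _) hχ0
    have hχt : tsupport χ ⊆ L :=
      (closure_minimal (fun t ht => by_contra fun h => Function.mem_support.1 ht (hχ0 t h))
        Metric.isClosed_closedBall).trans hcb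
    have e := (hw i j).2 χ hχs hχc (hχt.trans hrU)
    rw [hF, complexHessian_convolution hf'i.locallyIntegrable (hφs k) (hφc k),
      convolution_eq_swap]
    have e1 : ∫ t, (f' t : ℂ) * complexHessian ((φ k).normed volume) (z - t) i j =
        ∫ t in U, (f t : ℂ) * complexHessian χ t i j := by
      rw [setIntegral_eq_integral_of_forall_compl_eq_zero fun t ht => by
        rw [complexHessian_zero_off_tsupport χ fun h => ht (hrU (hχt h))]; simp]
      refine integral_congr_ae (Eventually.of_forall fun t => ?_)
      simp only [hχ]
      rw [complexHessian_reflect (hφs k)]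
      by_cases h : t ∈ L
      · rw [hf', indicator_of_mem h]
      · have h0 := complexHessian_zero_off_tsupport χ fun h' => h (hχt h')
        rw [hχ, complexHessian_reflect (hφs k)] at h0
        rw [h0]; simp
    have e2 : ∫ t, ContinuousLinearMap.lsmul ℝ ℝ ((φ k).normed volume (z - t)) (H' i j t) =
        ∫ t in U, H t i j * (χ t : ℂ) := by
      rw [setIntegral_eq_integral_of_forall_compl_eq_zero fun t ht => by
        rw [image_eq_zero_of_notMem_tsupport fun h => ht (hrU (hχt h))]; simp]
      refine integral_congr_ae (Eventually.of_forall fun t => ?_)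
      simp only [ContinuousLinearMap.lsmul_apply, Complex.real_smul, hH']
      by_cases h : t ∈ L
      · rw [indicator_of_mem h, mul_comm]
      · rw [indicator_of_notMem h, image_eq_zero_of_notMem_tsupport fun h' => h (hχt h')]; simp
    rw [e1, e2, e]
  refine ⟨F, C, fun k => contDiff_convolution hf'i.locallyIntegrable (hφs k) (hφc k), ?_, ?_, ?_,
    ?_, ?_⟩
  · intro k z
    rw [hFflip, ← Real.norm_eq_abs]
    exact norm_convolution_le_of_ae_bound hf'C z
  · intro k z hz i j
    rw [hHess k z hz]
    exact norm_convolution_le_of_ae_bound (hH'C i j) z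
  · rw [ae_restrict_iff' hK.measurableSet]
    filter_upwards [ContDiffBump.ae_convolution_tendsto_right_of_locallyIntegrable
      (μ := (volume : Measure (Model n))) hφlim hφK hf'i.locallyIntegrable] with z hz hzK
    have e : f' z = f z := indicator_of_mem (hKL hzK) f
    simp only [hFflip]
    rwa [e] at hz
  · rw [ae_restrict_iff' hK.measurableSet]
    have h1 : ∀ᵐ z, ∀ i j, Tendsto (fun k => ((φ k).normed volume
        ⋆[ContinuousLinearMap.lsmul ℝ ℝ, volume] H' i j) z) atTop (𝓝 (H' i j z)) := by
      rw [ae_all_iff]; intro i; rw [ae_all_iff]; intro j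
      exact ContDiffBump.ae_convolution_tendsto_right_of_locallyIntegrable
        hφlim hφK (hH'i i j).locallyIntegrable
    filter_upwards [h1] with z hz hzK i j
    have e : H' i j z = H z i j := indicator_of_mem (hKL hzK) _
    simp only [hHess _ z hzK]
    rw [← e]
    exact hz i j
  · intro k z hz
    simp only [hF]
    rw [convolution_def]
    refine integral_eq_zero_of_ae (Eventually.of_forall fun t => ?_)
    simp only [ContinuousLinearMap.lsmul_apply, smul_eq_mul, Pi.zero_apply]
    by_cases h : t ∈ Metric.ball z δ
    · have : f' t = 0 := by
        by_cases h' : t ∈ L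
        · rw [hf', indicator_of_mem h', hz t h]
        · rw [hf', indicator_of_notMem h']
      rw [this, zero_mul]
    · have : (φ k).normed volume (z - t) = 0 := by
        have : z - t ∉ Function.support ((φ k).normed volume) := by
          rw [(φ k).support_normed_eq]
          intro h'
          apply h
          rw [Metric.mem_ball, dist_comm, dist_eq_norm]
          have : ‖z - t‖ < (φ k).rOut := by simpa using h'
          exact this.trans_le ((hφr k).trans (min_le_right _ _))
        exact Function.notMem_support.1 this
      rw [this, mul_zero]

/-- Weak complex Hessians are stable under bounded almost everywhere convergence. -/
lemma weakHess_of_tendsto (hU : IsOpen U) (hH : ∀ i j, LInfLoc U fun z => H z i j)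
    {F : ℕ → Model n → ℝ} {HF : ℕ → Model n → Matrix (Fin n) (Fin n) ℂ}
    (hFw : ∀ k, WeakHess U (F k) (HF k)) (hFc : ∀ k, ContinuousOn (F k) U)
    (hHFc : ∀ k i j, ContinuousOn (fun z => HF k z i j) U) (C : ℝ)
    (hFC : ∀ k, ∀ z ∈ U, |F k z| ≤ C) (hHC : ∀ k, ∀ z ∈ U, ∀ i j, ‖HF k z i j‖ ≤ C)
    (hFl : ∀ᵐ z ∂(volume.restrict U), Tendsto (fun k => F k z) atTop (𝓝 (f z)))
    (hHl : ∀ᵐ z ∂(volume.restrict U), ∀ i j,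
      Tendsto (fun k => HF k z i j) atTop (𝓝 (H z i j))) : WeakHess U f H := by
  refine fun i j => ⟨(hH i j).locallyIntegrableOn hU, fun χ c1 c2 c3 => ?_⟩
  have hχ : ContinuousOn (fun z => complexHessian χ z i j) (tsupport χ) :=
    (continuous_complexHessian c1 i j).continuousOn
  have hχ' : Continuous fun z => (χ z : ℂ) := Complex.continuous_ofReal.comp c1.continuous
  obtain ⟨D₁, hD₁⟩ := c2.exists_bound_of_continuousOn hχ
  obtain ⟨D₂, hD₂⟩ := c2.exists_bound_of_continuousOn hχ'.continuousOn
  have t1 : Tendsto (fun k => ∫ z in U, (F k z : ℂ) * complexHessian χ z i j) atTop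
      (𝓝 (∫ z in U, (f z : ℂ) * complexHessian χ z i j)) := by
    refine tendsto_setIntegral_of_bounded hU c3 c2 (fun k => ?_) (C * D₁) (fun k => ?_)
      (fun k z hz => by rw [complexHessian_zero_off_tsupport χ hz]; simp)
      (fun z hz => by rw [complexHessian_zero_off_tsupport χ hz]; simp) ?_
    · exact ((Complex.continuous_ofReal.comp_continuousOn
        ((hFc k).mono c3)).mul hχ).aestronglyMeasurable_of_isCompact c2 c2.measurableSet
    · refine (ae_restrict_iff' c2.measurableSet).2 (Eventually.of_forall fun z hz => ?_)
      rw [norm_mul, Complex.norm_real]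
      exact mul_le_mul (hFC k z (c3 hz)) (hD₁ z hz) (norm_nonneg _)
        ((abs_nonneg _).trans (hFC k z (c3 hz)))
    · filter_upwards [ae_restrict_of_ae_restrict_of_subset c3 hFl] with z hz
      exact ((Complex.continuous_ofReal.tendsto _).comp hz).mul_const _
  have t2 : Tendsto (fun k => ∫ z in U, HF k z i j * (χ z : ℂ)) atTop
      (𝓝 (∫ z in U, H z i j * (χ z : ℂ))) := by
    refine tendsto_setIntegral_of_bounded hU c3 c2 (fun k => ?_) (C * D₂) (fun k => ?_)
      (fun k z hz => by rw [image_eq_zero_of_notMem_tsupport hz]; simp)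
      (fun z hz => by rw [image_eq_zero_of_notMem_tsupport hz]; simp) ?_
    · exact (((hHFc k i j).mono c3).mul
        hχ'.continuousOn).aestronglyMeasurable_of_isCompact c2 c2.measurableSet
    · refine (ae_restrict_iff' c2.measurableSet).2 (Eventually.of_forall fun z hz => ?_)
      rw [norm_mul]
      exact mul_le_mul (hHC k z (c3 hz) i j) (hD₂ z hz) (norm_nonneg _)
        ((norm_nonneg _).trans (hHC k z (c3 hz) i j))
    · filter_upwards [ae_restrict_of_ae_restrict_of_subset c3 hHl] with z hz
      exact (hz i j).mul_const _
  refine tendsto_nhds_unique t1 ?_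
  simp only [fun k => (hFw k i j).2 χ c1 c2 c3]
  exact t2

end Mollify

end

/-! ### Consequences of mollification: integration by parts and change of coordinates -/

section Consequences

variable {n : ℕ}

lemma norm_wedgeC_le {A : Fin n → Matrix (Fin n) (Fin n) ℂ} {D : ℝ}
    (h : ∀ k i j, ‖A k i j‖ ≤ D) :
    ‖wedgeC A‖ ≤ (Fintype.card (Equiv.Perm (Fin n)) : ℝ) *
      ((Fintype.card (Equiv.Perm (Fin n)) : ℝ) * D ^ n) := by
  have h1 : ∀ σ τ : Equiv.Perm (Fin n), ‖((Equiv.Perm.sign σ : ℤ) : ℂ) *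
      ((Equiv.Perm.sign τ : ℤ) : ℂ) * ∏ k, A k (σ k) (τ k)‖ ≤ D ^ n := by
    intro σ τ
    have hs : ∀ σ : Equiv.Perm (Fin n), ‖((Equiv.Perm.sign σ : ℤ) : ℂ)‖ = 1 := fun σ => by
      rcases Int.units_eq_one_or (Equiv.Perm.sign σ) with h | h <;> simp [h]
    rw [norm_mul, norm_mul, hs, hs, one_mul, one_mul, norm_prod]
    calc ∏ k, ‖A k (σ k) (τ k)‖ ≤ ∏ _k : Fin n, D :=
          Finset.prod_le_prod (fun k _ => norm_nonneg _) fun k _ => h k _ _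
      _ = D ^ n := by simp
  calc ‖wedgeC A‖ ≤ ∑ _σ : Equiv.Perm (Fin n), ∑ _τ : Equiv.Perm (Fin n), D ^ n :=
        norm_sum_le_of_le _ fun σ _ => norm_sum_le_of_le _ fun τ _ => h1 σ τ
    _ = _ := by simp

lemma tendsto_wedgeC {ι : Type*} {l : Filter ι} {A : ι → Fin n → Matrix (Fin n) (Fin n) ℂ}
    {A' : Fin n → Matrix (Fin n) (Fin n) ℂ}
    (h : ∀ k i j, Tendsto (fun m => A m k i j) l (𝓝 (A' k i j))) :
    Tendsto (fun m => wedgeC (A m)) l (𝓝 (wedgeC A')) :=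
  tendsto_finsetSum _ fun _ _ => tendsto_finsetSum _ fun _ _ =>
    (tendsto_finsetProd _ fun k _ => h k _ _).const_mul _

lemma continuousOn_wedgeC {s : Set (Model n)} {A : Model n → Fin n → Matrix (Fin n) (Fin n) ℂ}
    (h : ∀ k i j, ContinuousOn (fun z => A z k i j) s) : ContinuousOn (fun z => wedgeC (A z)) s :=
  fun z hz => tendsto_wedgeC fun k i j => h k i j z hz

lemma update_apply_apply {α : Type*} (A : α → Fin n → Matrix (Fin n) (Fin n) ℂ) (k₀ k : Fin n)
    (X : α → Matrix (Fin n) (Fin n) ℂ) (a : α) (i j : Fin n) :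
    Function.update (A a) k₀ (X a) k i j = if k = k₀ then X a i j else A a k i j := by
  by_cases h : k = k₀
  · subst h; simp
  · simp [h]

lemma exists_bound_entries {K : Set (Model n)} (hK : IsCompact K)
    {A : Model n → Matrix (Fin n) (Fin n) ℂ} (hA : ∀ i j, ContinuousOn (fun z => A z i j) K) :
    ∃ D : ℝ, 0 ≤ D ∧ ∀ z ∈ K, ∀ i j, ‖A z i j‖ ≤ D := by
  choose D hD using fun i j => hK.exists_bound_of_continuousOn (hA i j)
  refine ⟨∑ i, ∑ j, |D i j|, Finset.sum_nonneg fun i _ => Finset.sum_nonneg fun j _ =>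
    abs_nonneg _, fun z hz i j => ?_⟩
  have h1 : |D i j| ≤ ∑ j, |D i j| :=
    Finset.single_le_sum (f := fun j => |D i j|) (fun j _ => abs_nonneg _) (Finset.mem_univ j)
  have h2 : ∑ j, |D i j| ≤ ∑ i, ∑ j, |D i j| :=
    Finset.single_le_sum (f := fun i => ∑ j, |D i j|)
      (fun i _ => Finset.sum_nonneg fun j _ => abs_nonneg _) (Finset.mem_univ i)
  exact (hD i j z hz).trans ((le_abs_self _).trans (h1.trans h2))

variable {U : Set (Model n)} {u v : Model n → ℝ} {Hu Hv : Model n → Matrix (Fin n) (Fin n) ℂ}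

/-- Integration by parts for functions with locally bounded weak complex Hessians. Mollifying `u`
and `v` near the support of `ψ` reduces it to the smooth case, and both sides converge by dominated
convergence, because the mollified Hessians are bounded and converge almost everywhere. -/
lemma WeakHess.integral_mul_wedgeC (hU : IsOpen U)
    (hv : LInfLoc U v) (hHv : ∀ i j, LInfLoc U fun z => Hv z i j) (hwv : WeakHess U v Hv)
    (hu : LInfLoc U u) (hHu : ∀ i j, LInfLoc U fun z => Hu z i j) (hwu : WeakHess U u Hu)
    {B : Fin n → Model n → Matrix (Fin n) (Fin n) ℂ} (hB : ∀ k, ClosedFormOn (B k) U)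
    (c : Fin n → ℝ) (k₀ : Fin n) {ψ : Model n → ℝ} (hψ : ContDiff ℝ ∞ ψ)
    (hc : HasCompactSupport ψ) (hs : tsupport ψ ⊆ U) :
    ∫ z in U, (v z : ℂ) * wedgeC (Function.update (fun k => B k z + c k • Hu z) k₀
        (complexHessian ψ z)) =
      ∫ z in U, (ψ z : ℂ) * wedgeC (Function.update (fun k => B k z + c k • Hu z) k₀ (Hv z)) := by
  set K := tsupport ψ with hK
  obtain ⟨F, C, hF, hFC, hFHC, hFl, hFHl, -⟩ := hwu.exists_smooth_approx hU hu hHu hc hs one_pos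
  obtain ⟨G, C', hG, hGC, hGHC, hGl, hGHl, -⟩ := hwv.exists_smooth_approx hU hv hHv hc hs one_pos
  have hBc : ∀ k i j, ContinuousOn (fun z => B k z i j) K := fun k i j =>
    ((hB k).smooth i j).continuousOn.mono hs
  choose D hD0 hD using fun k => exists_bound_entries hc (hBc k)
  obtain ⟨D', hD'0, hD'⟩ := exists_bound_entries hc (A := complexHessian ψ) fun i j =>
    (continuous_complexHessian hψ i j).continuousOn
  obtain ⟨P, hP⟩ := hc.exists_bound_of_continuousOn hψ.continuous.continuousOn
  set E : ℝ := (∑ k, D k) + (∑ k, |c k|) * |C| + |C'| + D' with hE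
  have hDk : ∀ k, D k ≤ ∑ k, D k := fun k =>
    Finset.single_le_sum (f := D) (fun k _ => hD0 k) (Finset.mem_univ k)
  have hck : ∀ k, |c k| ≤ ∑ k, |c k| := fun k =>
    Finset.single_le_sum (f := fun k => |c k|) (fun k _ => abs_nonneg _) (Finset.mem_univ k)
  have hS1 : 0 ≤ ∑ k, D k := Finset.sum_nonneg fun k _ => hD0 k
  have hS2 : 0 ≤ (∑ k, |c k|) * |C| :=
    mul_nonneg (Finset.sum_nonneg fun k _ => abs_nonneg _) (abs_nonneg _)
  have hA : ∀ m, ∀ z ∈ K, ∀ k i j, ‖(B k z + c k • complexHessian (F m) z) i j‖ ≤ E := by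
    intro m z hz k i j
    rw [Matrix.add_apply, Matrix.smul_apply]
    refine (norm_add_le _ _).trans ?_
    rw [norm_smul, Real.norm_eq_abs]
    have h1 : |c k| * ‖complexHessian (F m) z i j‖ ≤ (∑ k, |c k|) * |C| :=
      mul_le_mul (hck k) ((hFHC m z hz i j).trans (le_abs_self _)) (norm_nonneg _)
        (Finset.sum_nonneg fun k _ => abs_nonneg _)
    have h2 := (hD k z hz i j).trans (hDk k)
    have h3 := abs_nonneg C'
    linarith
  have hX : ∀ m, ∀ z ∈ K, ∀ i j, ‖complexHessian (G m) z i j‖ ≤ E := fun m z hz i j => by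
    have h1 := (hGHC m z hz i j).trans (le_abs_self _)
    linarith
  have hY : ∀ z ∈ K, ∀ i j, ‖complexHessian ψ z i j‖ ≤ E := fun z hz i j => by
    have h1 := hD' z hz i j
    have h3 := abs_nonneg C'
    linarith
  set N : ℝ := (Fintype.card (Equiv.Perm (Fin n)) : ℝ) *
      ((Fintype.card (Equiv.Perm (Fin n)) : ℝ) * E ^ n) with hN
  have hcomp : ∀ m, ClosedFormOn (complexHessian (F m)) U := fun m =>
    closedFormOn_complexHessian hU (hF m).contDiffOn
  have hAm : ∀ m k, ClosedFormOn (fun z => B k z + c k • complexHessian (F m) z) U := fun m k =>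
    (hB k).add hU ((hcomp m).smul hU (c k))
  have hAc : ∀ m k i j, ContinuousOn (fun z => (B k z + c k • complexHessian (F m) z) i j) K :=
    fun m k i j => ((hAm m k).smooth i j).continuousOn.mono hs
  have hlimA : ∀ᵐ z ∂(volume.restrict K), ∀ k i j, Tendsto
      (fun m => (B k z + c k • complexHessian (F m) z) i j) atTop
      (𝓝 ((B k z + c k • Hu z) i j)) := by
    filter_upwards [hFHl] with z hz k i j
    simp only [Matrix.add_apply, Matrix.smul_apply]
    exact ((hz i j).const_smul (c k)).const_add _
  have z1 : ∀ z, z ∉ K → ∀ A : Fin n → Matrix (Fin n) (Fin n) ℂ,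
      wedgeC (Function.update A k₀ (complexHessian ψ z)) = 0 := fun z hz A => by
    rw [complexHessian_zero_off_tsupport ψ hz, wedgeC_update]; simp
  have z2 : ∀ z, z ∉ K → (ψ z : ℂ) = 0 := fun z hz => by
    rw [image_eq_zero_of_notMem_tsupport hz]; simp
  have t1 : Tendsto (fun m => ∫ z in U, (G m z : ℂ) * wedgeC (Function.update
      (fun k => B k z + c k • complexHessian (F m) z) k₀ (complexHessian ψ z))) atTop
      (𝓝 (∫ z in U, (v z : ℂ) * wedgeC (Function.update (fun k => B k z + c k • Hu z) k₀
        (complexHessian ψ z)))) := by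
    refine tendsto_setIntegral_of_bounded hU hs hc (fun m => ?_) (C' * N) (fun m => ?_)
      (fun m z hz => by rw [z1 z hz, mul_zero]) (fun z hz => by rw [z1 z hz, mul_zero]) ?_
    · refine ContinuousOn.aestronglyMeasurable_of_isCompact (ContinuousOn.mul
        (Complex.continuous_ofReal.comp (hG m).continuous).continuousOn
        (continuousOn_wedgeC fun k i j => ?_)) hc hc.measurableSet
      simp only [update_apply_apply (fun z k => B k z + c k • complexHessian (F m) z)]
      split_ifs
      · exact (continuous_complexHessian hψ i j).continuousOn
      · exact hAc m k i j
    · refine (ae_restrict_iff' hc.measurableSet).2 (Eventually.of_forall fun z hz => ?_)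
      rw [norm_mul, Complex.norm_real]
      refine mul_le_mul (hGC m z) (norm_wedgeC_le fun k i j => ?_) (norm_nonneg _)
        ((abs_nonneg _).trans (hGC m z))
      rw [update_apply_apply (fun z k => B k z + c k • complexHessian (F m) z)]
      split_ifs
      · exact hY z hz i j
      · exact hA m z hz k i j
    · filter_upwards [hGl, hlimA] with z h1 h2
      refine ((Complex.continuous_ofReal.tendsto _).comp h1).mul (tendsto_wedgeC fun k i j => ?_)
      rw [update_apply_apply (fun z k => B k z + c k • Hu z)]
      simp only [fun m =>
        update_apply_apply (fun z k => B k z + c k • complexHessian (F m) z) k₀ k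
          (complexHessian ψ) z i j]
      split_ifs
      · exact tendsto_const_nhds
      · exact h2 k i j
  have t2 : Tendsto (fun m => ∫ z in U, (ψ z : ℂ) * wedgeC (Function.update
      (fun k => B k z + c k • complexHessian (F m) z) k₀ (complexHessian (G m) z))) atTop
      (𝓝 (∫ z in U, (ψ z : ℂ) * wedgeC (Function.update (fun k => B k z + c k • Hu z) k₀
        (Hv z)))) := by
    refine tendsto_setIntegral_of_bounded hU hs hc (fun m => ?_) (P * N) (fun m => ?_)
      (fun m z hz => by rw [z2 z hz, zero_mul]) (fun z hz => by rw [z2 z hz, zero_mul]) ?_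
    · refine ContinuousOn.aestronglyMeasurable_of_isCompact (ContinuousOn.mul
        (Complex.continuous_ofReal.comp hψ.continuous).continuousOn
        (continuousOn_wedgeC fun k i j => ?_)) hc hc.measurableSet
      simp only [update_apply_apply (fun z k => B k z + c k • complexHessian (F m) z)]
      split_ifs
      · exact (continuous_complexHessian (hG m) i j).continuousOn
      · exact hAc m k i j
    · refine (ae_restrict_iff' hc.measurableSet).2 (Eventually.of_forall fun z hz => ?_)
      rw [norm_mul, Complex.norm_real]
      refine mul_le_mul (hP z hz) (norm_wedgeC_le fun k i j => ?_) (norm_nonneg _)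
        ((norm_nonneg _).trans (hP z hz))
      rw [update_apply_apply (fun z k => B k z + c k • complexHessian (F m) z)]
      split_ifs
      · exact hX m z hz i j
      · exact hA m z hz k i j
    · filter_upwards [hGHl, hlimA] with z h1 h2
      refine Tendsto.const_mul _ (tendsto_wedgeC fun k i j => ?_)
      rw [update_apply_apply (fun z k => B k z + c k • Hu z)]
      simp only [fun m =>
        update_apply_apply (fun z k => B k z + c k • complexHessian (F m) z) k₀ k
          (complexHessian (G m)) z i j]
      split_ifs
      · exact h1 i j
      · exact h2 k i j
  refine tendsto_nhds_unique t1 ?_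
  simp only [fun m => integral_mul_wedgeC_complexHessian hU (hAm m) k₀ (hG m).contDiffOn hψ hc hs]
  exact t2

/-- Weak complex Hessians transform as forms of type (1,1) under biholomorphic maps: the chain rule
holds for the mollifications `F m` of `f'`, passes to the limit of `F m ∘ τ`, and weak complex
Hessians are unique. The hypothesis `hnull` allows an almost everywhere limit to be composed with
`τ`. -/
lemma WeakHess.ae_eq_comp {O U' : Set (Model n)} (hO : IsOpen O) (hU' : IsOpen U')
    {τ : Model n → Model n} (hτ : ∀ z ∈ O, ContDiffAt ℂ ω τ z) (hmaps : MapsTo τ O U')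
    (hnull : ∀ N : Set (Model n), volume N = 0 → volume (O ∩ τ ⁻¹' N) = 0)
    {f f' : Model n → ℝ} {H H' : Model n → Matrix (Fin n) (Fin n) ℂ}
    (hff' : ∀ z ∈ O, f z = f' (τ z)) (hw : WeakHess O f H) (hf' : LInfLoc U' f')
    (hH' : ∀ i j, LInfLoc U' fun z => H' z i j) (hw' : WeakHess U' f' H') :
    ∀ᵐ z, z ∈ O → H z = (jacobian τ z).transpose * H' (τ z) *
      (jacobian τ z).map (starRingEnd ℂ) := by
  have h2ω : (2 : WithTop ℕ∞) ≤ ω := le_top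
  have hτr : ∀ z ∈ O, ContDiffAt ℝ ∞ τ z := fun z hz =>
    ((hτ z hz).restrict_scalars ℝ).of_le le_top
  have hae : ∀ {p : Model n → Prop}, (∀ᵐ y, p y) → ∀ᵐ z, z ∈ O → p (τ z) := by
    intro p hp
    have := hnull _ (show volume {y | ¬ p y} = 0 from hp)
    refine measure_mono_null (fun z hz => ?_) this
    rw [mem_compl_iff, mem_ofPred_eq, Classical.not_imp] at hz
    exact ⟨hz.1, hz.2⟩
  refine ae_of_locally_ae fun z₀ hz₀ => ?_
  obtain ⟨r, hr, hrU⟩ := Metric.nhds_basis_closedBall.mem_iff.1 (hU'.mem_nhds (hmaps hz₀))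
  set K' := Metric.closedBall (τ z₀) r with hK'
  have hK'c : IsCompact K' := isCompact_closedBall _ _
  have hnear : O ∩ τ ⁻¹' (Metric.ball (τ z₀) r) ∈ 𝓝 z₀ := inter_mem (hO.mem_nhds hz₀)
    ((hτ z₀ hz₀).continuousAt.preimage_mem_nhds (Metric.ball_mem_nhds _ hr))
  obtain ⟨s, hs, hsO⟩ := Metric.nhds_basis_closedBall.mem_iff.1 hnear
  set W := Metric.ball z₀ s with hW
  have hWo : IsOpen W := Metric.isOpen_ball
  have hWc : W ⊆ Metric.closedBall z₀ s := Metric.ball_subset_closedBall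
  have hWO : W ⊆ O := fun z hz => (hsO (hWc hz)).1
  have hWK : ∀ z ∈ W, τ z ∈ K' := fun z hz => Metric.ball_subset_closedBall (hsO (hWc hz)).2
  obtain ⟨F, C, hF, hFC, hFHC, hFl, hFHl, -⟩ :=
    hw'.exists_smooth_approx hU' hf' hH' hK'c hrU one_pos
  have hJc : ∀ i j, ContinuousOn (fun z => jacobian τ z i j) (Metric.closedBall z₀ s) := by
    intro i j z hz
    have h1 : ContDiffAt ℂ 1 (fderiv ℂ τ) z :=
      (hτ z (hsO hz).1).fderiv_right (by exact_mod_cast le_top)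
    have h2 : ContinuousAt (fun z => fderiv ℂ τ z (Pi.single j 1)) z :=
      h1.continuousAt.clm_apply continuousAt_const
    exact ((continuous_apply i).continuousAt.comp h2).continuousWithinAt
  obtain ⟨D, hD0, hD⟩ := exists_bound_entries (isCompact_closedBall z₀ s) hJc
  have hFτ : ∀ m, ContDiffOn ℝ ∞ (F m ∘ τ) W := fun m z hz =>
    ((hF m).contDiffAt.comp z (hτr z (hWO hz))).contDiffWithinAt
  have hchain : ∀ m, ∀ z ∈ W, complexHessian (F m ∘ τ) z = (jacobian τ z).transpose *
      complexHessian (F m) (τ z) * (jacobian τ z).map (starRingEnd ℂ) := fun m z hz =>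
    complexHessian_comp ((hτ z (hWO hz)).of_le h2ω)
      ((hF m).contDiffAt.of_le (WithTop.coe_le_coe.2 le_top))
  have hexp : ∀ (J X : Matrix (Fin n) (Fin n) ℂ) (i j : Fin n),
      (J.transpose * X * J.map (starRingEnd ℂ)) i j =
        ∑ b, (∑ a, J a i * X a b) * (starRingEnd ℂ) (J b j) := fun J X i j => by
    simp [Matrix.mul_apply]
  set HW : Model n → Matrix (Fin n) (Fin n) ℂ := fun z => (jacobian τ z).transpose * H' (τ z) *
      (jacobian τ z).map (starRingEnd ℂ) with hHW
  set C₂ : ℝ := |C| + ∑ _b : Fin n, (∑ _a : Fin n, D * |C|) * D with hC₂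
  have hS : 0 ≤ ∑ _b : Fin n, (∑ _a : Fin n, D * |C|) * D := Finset.sum_nonneg fun b _ =>
    mul_nonneg (Finset.sum_nonneg fun a _ => mul_nonneg hD0 (abs_nonneg _)) hD0
  have hbd : ∀ m, ∀ z ∈ W, ∀ i j, ‖complexHessian (F m ∘ τ) z i j‖ ≤ C₂ := by
    intro m z hz i j
    rw [hchain m z hz, hexp]
    have : ‖∑ b, (∑ a, jacobian τ z a i * complexHessian (F m) (τ z) a b) *
        (starRingEnd ℂ) (jacobian τ z b j)‖ ≤ ∑ _b : Fin n, (∑ _a : Fin n, D * |C|) * D := by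
      refine norm_sum_le_of_le _ fun b _ => ?_
      rw [norm_mul, RCLike.norm_conj]
      refine mul_le_mul (norm_sum_le_of_le _ fun a _ => ?_) (hD z (hWc hz) b j) (norm_nonneg _)
        (Finset.sum_nonneg fun a _ => mul_nonneg hD0 (abs_nonneg _))
      rw [norm_mul]
      exact mul_le_mul (hD z (hWc hz) a i) ((hFHC m _ (hWK z hz) a b).trans (le_abs_self _))
        (norm_nonneg _) hD0
    have := abs_nonneg C
    linarith
  have hlim1 : ∀ᵐ z ∂(volume.restrict W), Tendsto (fun m => (F m ∘ τ) z) atTop (𝓝 (f z)) := by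
    rw [ae_restrict_iff' hWo.measurableSet]
    filter_upwards [hae ((ae_restrict_iff' hK'c.measurableSet).1 hFl)] with z hz hzW
    rw [hff' z (hWO hzW)]
    exact hz (hWO hzW) (hWK z hzW)
  have hlim2 : ∀ᵐ z ∂(volume.restrict W), ∀ i j,
      Tendsto (fun m => complexHessian (F m ∘ τ) z i j) atTop (𝓝 (HW z i j)) := by
    rw [ae_restrict_iff' hWo.measurableSet]
    filter_upwards [hae ((ae_restrict_iff' hK'c.measurableSet).1 hFHl)] with z hz hzW i j
    simp only [hHW]
    simp only [fun m => hchain m z hzW, hexp]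
    exact tendsto_finsetSum _ fun b _ => (tendsto_finsetSum _ fun a _ =>
      (hz (hWO hzW) (hWK z hzW) a b).const_mul _).mul_const _
  have hcont : ∀ m i j, ContinuousOn (fun z => complexHessian (F m ∘ τ) z i j) W :=
    fun m i j z hz => (contDiffAt_complexHessian ((hFτ m).contDiffAt (hWo.mem_nhds hz))
      i j).continuousAt.continuousWithinAt
  have hHWl : ∀ i j, LInfLoc W fun z => HW z i j := by
    intro i j K hKW hK
    refine memLp_top_of_bound (aestronglyMeasurable_of_tendsto_ae atTop
      (f := fun m z => complexHessian (F m ∘ τ) z i j)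
      (fun m => ((hcont m i j).mono hKW).aestronglyMeasurable_of_isCompact hK hK.measurableSet)
      ((ae_restrict_of_ae_restrict_of_subset hKW hlim2).mono fun z hz => hz i j)) C₂ ?_
    filter_upwards [ae_restrict_of_ae_restrict_of_subset hKW hlim2,
      ae_restrict_mem hK.measurableSet] with z hz hzK
    exact le_of_tendsto (hz i j).norm (Eventually.of_forall fun m => hbd m z (hKW hzK) i j)
  have hwW : WeakHess W f HW := weakHess_of_tendsto hWo hHWl
    (fun m => weakHess_of_contDiffOn hWo (hFτ m)) (fun m => (hFτ m).continuousOn) hcont C₂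
    (fun m z _ => ((hFC m (τ z)).trans (le_abs_self _)).trans (by linarith)) hbd hlim1 hlim2
  refine ⟨W, Metric.ball_mem_nhds z₀ hs, ?_⟩
  exact (ae_restrict_iff' hWo.measurableSet).1
    ((hw.mono hO hWo hWO).unique hWo hwW)

end Consequences

/-! ### Transition maps -/

section Transition

variable {n : ℕ} {M : Type*} [TopologicalSpace M]

/-- The domain of the transition map `e' ∘ e⁻¹`. -/
def overlap (e e' : OpenPartialHomeomorph M (Model n)) : Set (Model n) :=
  e.target ∩ e.symm ⁻¹' e'.source

/-- The transition map `e' ∘ e⁻¹`. -/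
noncomputable def transition (e e' : OpenPartialHomeomorph M (Model n)) : Model n → Model n :=
  fun z => e' (e.symm z)

variable {e e' : OpenPartialHomeomorph M (Model n)}

lemma isOpen_overlap : IsOpen (overlap e e') :=
  e.symm.isOpen_inter_preimage e'.open_source

lemma overlap_subset : overlap e e' ⊆ e.target := inter_subset_left

lemma transition_mem {z : Model n} (hz : z ∈ overlap e e') : transition e e' z ∈ overlap e' e := by
  refine ⟨e'.map_source hz.2, ?_⟩
  rw [mem_preimage, transition, e'.left_inv hz.2]
  exact e.map_target hz.1

lemma symm_transition {z : Model n} (hz : z ∈ overlap e e') :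
    e'.symm (transition e e' z) = e.symm z := e'.left_inv hz.2

lemma transition_transition {z : Model n} (hz : z ∈ overlap e e') :
    transition e' e (transition e e' z) = z := by
  rw [transition, symm_transition hz, e.right_inv hz.1]

lemma image_transition : transition e e' '' overlap e e' = overlap e' e := by
  refine Subset.antisymm (image_subset_iff.2 fun z hz => transition_mem hz) fun z hz => ?_
  exact ⟨transition e' e z, transition_mem hz, transition_transition hz⟩

lemma injOn_transition : InjOn (transition e e') (overlap e e') := fun z hz w hw h => by
  rw [← transition_transition hz, h, transition_transition hw]

lemma jacobian_eq_toMatrix' (τ : Model n → Model n) (z : Model n) :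
    jacobian τ z = LinearMap.toMatrix' (fderiv ℂ τ z : Model n →ₗ[ℂ] Model n) := by
  ext a i
  rw [LinearMap.toMatrix'_apply]
  simp [jacobian]

/-- The real Jacobian determinant of a holomorphic map is the square of the modulus of the complex
one. -/
lemma det_fderiv_real {τ : Model n → Model n} {z : Model n} (h : DifferentiableAt ℂ τ z) :
    (fderiv ℝ τ z).det = Complex.normSq (jacobian τ z).det := by
  rw [h.fderiv_restrictScalars ℝ, jacobian_eq_toMatrix', LinearMap.det_toMatrix',
    ContinuousLinearMap.det]
  have : ((fderiv ℂ τ z).restrictScalars ℝ : Model n →ₗ[ℝ] Model n) =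
      (fderiv ℂ τ z : Model n →ₗ[ℂ] Model n).restrictScalars ℝ := rfl
  rw [this, LinearMap.det_restrictScalars, Algebra.norm_complex_apply]

variable [ChartedSpace (Model n) M] [IsManifold 𝓘(ℂ, Model n) ω M]

lemma contDiffAt_transition (he : e ∈ atlas (Model n) M) (he' : e' ∈ atlas (Model n) M)
    {z : Model n} (hz : z ∈ overlap e e') : ContDiffAt ℂ ω (transition e e') z := by
  have h := (contDiffGroupoid ω 𝓘(ℂ, Model n)).compatible he he'
  have h1 := (contDiffGroupoid ω 𝓘(ℂ, Model n)).mem_of_eqOnSource h (Setoid.refl _)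
  rw [contDiffGroupoid, mem_groupoid_of_pregroupoid] at h1
  have h2 : ContDiffOn ℂ ω (transition e e') (overlap e e') := by
    have := h1.1
    change ContDiffOn ℂ ω (fun z => e' (e.symm z)) (e.target ∩ e.symm ⁻¹' e'.source)
    simpa [contDiffPregroupoid, Function.comp_def] using this
  exact h2.contDiffAt (isOpen_overlap.mem_nhds hz)

lemma differentiableAt_transition (he : e ∈ atlas (Model n) M) (he' : e' ∈ atlas (Model n) M)
    {z : Model n} (hz : z ∈ overlap e e') : DifferentiableAt ℂ (transition e e') z :=
  (contDiffAt_transition he he' hz).differentiableAt (by simp)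

lemma jacobian_mul_jacobian (he : e ∈ atlas (Model n) M) (he' : e' ∈ atlas (Model n) M)
    {z : Model n} (hz : z ∈ overlap e e') :
    jacobian (transition e' e) (transition e e' z) * jacobian (transition e e') z = 1 := by
  have h1 := differentiableAt_transition he he' hz
  have h2 := differentiableAt_transition he' he (transition_mem hz)
  have h3 : transition e' e ∘ transition e e' =ᶠ[𝓝 z] id := by
    filter_upwards [isOpen_overlap.mem_nhds hz] with w hw using transition_transition hw
  have h4 := fderiv_comp z h2 h1
  rw [h3.fderiv_eq, fderiv_id] at h4
  rw [jacobian_eq_toMatrix', jacobian_eq_toMatrix', ← LinearMap.toMatrix'_comp]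
  have h5 : ((fderiv ℂ (transition e' e) (transition e e' z) : Model n →ₗ[ℂ] Model n) ∘ₗ
      (fderiv ℂ (transition e e') z : Model n →ₗ[ℂ] Model n)) = LinearMap.id := by
    ext1 i
    ext
    simp only [LinearMap.coe_comp, Function.comp_apply, ContinuousLinearMap.coe_coe]
    have := congrArg (fun L : Model n →L[ℂ] Model n => L (LinearMap.single ℂ (fun _ => ℂ) i 1)) h4
    simpa using (congrFun this _).symm
  rw [h5, LinearMap.toMatrix'_id]

lemma det_jacobian_ne_zero (he : e ∈ atlas (Model n) M) (he' : e' ∈ atlas (Model n) M)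
    {z : Model n} (hz : z ∈ overlap e e') : (jacobian (transition e e') z).det ≠ 0 := by
  intro h
  have := congrArg Matrix.det (jacobian_mul_jacobian he he' hz)
  rw [Matrix.det_mul, h, mul_zero, Matrix.det_one] at this
  exact zero_ne_one this

lemma volume_preimage_transition (he : e ∈ atlas (Model n) M) (he' : e' ∈ atlas (Model n) M)
    (N : Set (Model n)) (hN : volume N = 0) :
    volume (overlap e e' ∩ transition e e' ⁻¹' N) = 0 := by
  have h1 : volume (transition e' e '' (overlap e' e ∩ N)) = 0 := by
    refine addHaar_image_eq_zero_of_differentiableOn_of_addHaar_eq_zero volume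
      (fun w hw => ?_) (measure_mono_null inter_subset_right hN)
    exact ((differentiableAt_transition he' he hw.1).restrictScalars ℝ).differentiableWithinAt
  refine measure_mono_null (fun z hz => ?_) h1
  exact ⟨transition e e' z, ⟨transition_mem hz.1, hz.2⟩, transition_transition hz.1⟩

variable (n M) in
/-- The smooth real manifold underlying a complex manifold. -/
lemma isManifold_real : IsManifold 𝓘(ℝ, Model n) ∞ M := by
  refine isManifold_of_contDiffOn 𝓘(ℝ, Model n) ∞ M fun e e' he he' => ?_
  have h : ContDiffOn ℝ ∞ (transition e e') (overlap e e') := fun z hz =>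
    (((contDiffAt_transition he he' hz).restrict_scalars ℝ).of_le le_top).contDiffWithinAt
  change ContDiffOn ℝ ∞ (fun z => e' (e.symm z)) (e.target ∩ e.symm ⁻¹' e'.source) at h
  simpa [Function.comp_def] using h

end Transition

/-! ### Forms with locally bounded coefficients -/

section Forms

variable {n : ℕ} {M : Type*} [TopologicalSpace M] [ChartedSpace (Model n) M]

/-- The local expressions of an (n,n)-form, or of a function, are of class `L^∞_loc` in every
chart of the atlas. -/
def IsLoc (α : LocalFun n M) : Prop := ∀ e ∈ atlas (Model n) M, LInfLoc e.target (α e)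

/-- The entries of the coefficient matrices are of class `L^∞_loc` in every chart of the atlas. -/
def IsLocForm (A : LocalForm n M) : Prop :=
  ∀ e ∈ atlas (Model n) M, ∀ i j, LInfLoc e.target fun z => A e z i j

/-- The transformation law of functions, almost everywhere. -/
def TransformsAsFun (f : LocalFun n M) : Prop :=
  ∀ e ∈ atlas (Model n) M, ∀ e' ∈ atlas (Model n) M, ∀ᵐ z, z ∈ overlap e e' →
    f e z = f e' (transition e e' z)

/-- The transformation law of (n,n)-forms, almost everywhere. -/
def TransformsAsDensity (α : LocalFun n M) : Prop :=
  ∀ e ∈ atlas (Model n) M, ∀ e' ∈ atlas (Model n) M, ∀ᵐ z, z ∈ overlap e e' →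
    α e z = Complex.normSq (jacobian (transition e e') z).det * α e' (transition e e' z)

/-- The transformation law of (1,1)-forms, almost everywhere. -/
def TransformsAsForm (A : LocalForm n M) : Prop :=
  ∀ e ∈ atlas (Model n) M, ∀ e' ∈ atlas (Model n) M, ∀ᵐ z, z ∈ overlap e e' →
    A e z = (jacobian (transition e e') z).transpose * A e' (transition e e' z) *
      (jacobian (transition e e') z).map (starRingEnd ℂ)

/-- Equality of local expressions almost everywhere in every chart. -/
def AEEqual {β : Type*} (α α' : OpenPartialHomeomorph M (Model n) → Model n → β) : Prop :=
  ∀ e ∈ atlas (Model n) M, ∀ᵐ z ∂(volume.restrict e.target), α e z = α' e z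

/-- An (n,n)-form with locally bounded measurable coefficients. -/
structure IsDensity (α : LocalFun n M) : Prop where
  loc : IsLoc α
  trans : TransformsAsDensity α

/-- A (1,1)-form with locally bounded measurable coefficients. -/
structure IsForm (A : LocalForm n M) : Prop where
  loc : IsLocForm A
  trans : TransformsAsForm A

/-- A locally bounded measurable function, given by its local expressions. -/
structure IsFun (f : LocalFun n M) : Prop where
  loc : IsLoc f
  trans : TransformsAsFun f

lemma IsLoc.add {α β : LocalFun n M} (hα : IsLoc α) (hβ : IsLoc β) : IsLoc (α + β) :=
  fun e he => (hα e he).add (hβ e he)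

lemma IsLoc.mul {α β : LocalFun n M} (hα : IsLoc α) (hβ : IsLoc β) : IsLoc (α * β) :=
  fun e he => (hα e he).mul (hβ e he)

lemma IsLoc.const_smul {α : LocalFun n M} (hα : IsLoc α) (c : ℝ) : IsLoc (c • α) :=
  fun e he => (LInfLoc.const c).mul (hα e he)

lemma IsLoc.sum {ι : Type*} {s : Finset ι} {α : ι → LocalFun n M} (h : ∀ i ∈ s, IsLoc (α i)) :
    IsLoc (∑ i ∈ s, α i) := fun e he => by
  have : (∑ i ∈ s, α i) e = fun z => ∑ i ∈ s, α i e z := by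
    funext z; simp
  rw [this]
  exact LInfLoc.sum fun i hi => h i hi e he

lemma IsLoc.wedge {A : Fin n → LocalForm n M} (hA : ∀ k, IsLocForm (A k)) :
    IsLoc fun e z => wedge fun k => A k e z := fun e he => LInfLoc.wedge fun k => hA k e he

lemma IsDensity.wedge {A : Fin n → LocalForm n M} (hA : ∀ k, IsForm (A k)) :
    IsDensity fun e z => WeakCSCK.wedge fun k => A k e z := by
  refine ⟨IsLoc.wedge fun k => (hA k).loc, fun e he e' he' => ?_⟩
  have h : ∀ᵐ z, ∀ k, z ∈ overlap e e' →
      A k e z = (jacobian (transition e e') z).transpose * A k e' (transition e e' z) *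
        (jacobian (transition e e') z).map (starRingEnd ℂ) :=
    ae_all_iff.2 fun k => (hA k).trans e he e' he'
  filter_upwards [h] with z hz hzo
  rw [← wedge_transform]
  congr 1
  funext k
  exact hz k hzo

lemma IsFun.mul_density {f α : LocalFun n M} (hf : IsFun f) (hα : IsDensity α) :
    IsDensity (f * α) := by
  refine ⟨hf.loc.mul hα.loc, fun e he e' he' => ?_⟩
  filter_upwards [hf.trans e he e' he', hα.trans e he e' he'] with z h1 h2 hz
  simp only [Pi.mul_apply]
  rw [h1 hz, h2 hz]; ring

lemma IsForm.add {A B : LocalForm n M} (hA : IsForm A) (hB : IsForm B) :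
    IsForm fun e z => A e z + B e z := by
  refine ⟨fun e he i j => (hA.loc e he i j).add (hB.loc e he i j), fun e he e' he' => ?_⟩
  filter_upwards [hA.trans e he e' he', hB.trans e he e' he'] with z h1 h2 hz
  rw [h1 hz, h2 hz, Matrix.mul_add, Matrix.add_mul]

lemma IsForm.smul {A : LocalForm n M} (hA : IsForm A) (c : ℝ) : IsForm fun e z => c • A e z := by
  refine ⟨fun e he i j => ?_, fun e he e' he' => ?_⟩
  · have : (fun z => (c • A e z) i j) = fun z => (c : ℂ) * A e z i j := by
      funext z; simp
    rw [this]
    exact (LInfLoc.const _).mul (hA.loc e he i j)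
  filter_upwards [hA.trans e he e' he'] with z h1 hz
  rw [h1 hz, Matrix.mul_smul, Matrix.smul_mul]

lemma IsForm.zero : IsForm (fun _ _ => 0 : LocalForm n M) :=
  ⟨fun _ _ _ _ => LInfLoc.const _, fun _ _ _ _ => Eventually.of_forall fun _ _ => by simp⟩

lemma isFun_localExpr {f : M → ℝ} (hf : IsLoc (n := n) (localExpr f)) :
    IsFun (n := n) (localExpr f) :=
  ⟨hf, fun e _ e' _ => Eventually.of_forall fun z hz => by
    rw [localExpr, localExpr, symm_transition hz]⟩

lemma isLoc_localExpr_of_continuous {f : M → ℝ} (hf : Continuous f) :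
    IsLoc (n := n) (localExpr f) := fun e _ =>
  LInfLoc.of_continuousOn (hf.comp_continuousOn e.continuousOn_symm)

end Forms

/-! ### Integration over the manifold -/

section Integral

lemma isCompact_image_chart {n : ℕ} {M : Type*} [TopologicalSpace M] {K : Set M} (hK : IsCompact K)
    {e : OpenPartialHomeomorph M (Model n)} (h : K ⊆ e.source) :
    IsCompact (e '' K) ∧ e '' K ⊆ e.target ∧
      ∀ z ∈ e.target, z ∉ e '' K → e.symm z ∉ K :=
  ⟨hK.image_of_continuousOn (e.continuousOn.mono h),
    image_subset_iff.2 fun _ hx => e.map_source (h hx),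
    fun _ hz hzK hc => hzK ⟨_, hc, e.right_inv hz⟩⟩

variable {n : ℕ} {M : Type*} [TopologicalSpace M] [ChartedSpace (Model n) M]

lemma exists_finset_support [CompactSpace M] (ρ : PartitionOfUnity M M univ) :
    ∃ T : Finset M, ∀ x ∉ T, ∀ y, ρ x y = 0 := by
  have h := ρ.locallyFinite.finite_nonempty_of_compact
  refine ⟨h.toFinset, fun x hx y => by_contra fun hy => hx ?_⟩
  rw [Set.Finite.mem_toFinset]
  exact ⟨y, hy⟩

lemma sum_partition (ρ : PartitionOfUnity M M univ) {T : Finset M}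
    (hT : ∀ x ∉ T, ∀ y, ρ x y = 0) (y : M) : ∑ x ∈ T, ρ x y = 1 := by
  rw [← ρ.sum_eq_one (mem_univ y)]
  exact (finsum_eq_sum_of_support_subset _ fun x hx => by
    by_contra h
    exact hx (hT x h y)).symm

variable [CompactSpace M] [T2Space M]

lemma partition_subordinate (x : M) :
    tsupport (partition n M x) ⊆ (chartAt (Model n) x).source :=
  (exists_partition (n := n) (M := M)).choose_spec x

lemma partition_eq_zero (x : M) {y : M} (hy : y ∉ tsupport (partition n M x)) :
    partition n M x y = 0 := image_eq_zero_of_notMem_tsupport hy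

/-- The compact part of the chart at `x` on which the partition function of index `x` lives. -/
def chartSupport (n : ℕ) {M : Type*} [TopologicalSpace M] [ChartedSpace (Model n) M]
    [CompactSpace M] [T2Space M] (x : M) : Set (Model n) :=
  chartAt (Model n) x '' tsupport (partition n M x)

lemma isCompact_chartSupport (x : M) : IsCompact (chartSupport n x) :=
  (isCompact_image_chart (isClosed_tsupport _).isCompact (partition_subordinate x)).1

lemma chartSupport_subset (x : M) : chartSupport n x ⊆ (chartAt (Model n) x).target :=
  (isCompact_image_chart (isClosed_tsupport _).isCompact (partition_subordinate x)).2.1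

lemma partition_eq_zero_of_notMem (x : M) {z : Model n} (hz : z ∈ (chartAt (Model n) x).target)
    (hzK : z ∉ chartSupport n x) : partition n M x ((chartAt (Model n) x).symm z) = 0 :=
  partition_eq_zero x ((isCompact_image_chart (isClosed_tsupport _).isCompact
    (partition_subordinate x)).2.2 z hz hzK)

lemma isLoc_partition (x : M) : IsLoc (n := n) (localExpr fun y => partition n M x y) :=
  isLoc_localExpr_of_continuous (partition n M x).continuous

lemma integrableOn_partition_mul {α : LocalFun n M} (hα : IsLoc α) (x : M) :
    IntegrableOn (fun z => partition n M x ((chartAt (Model n) x).symm z) *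
      (2 ^ n * α (chartAt (Model n) x) z)) (chartAt (Model n) x).target := by
  have h1 := (isLoc_partition x _ (chart_mem_atlas (Model n) x)).mul
    ((LInfLoc.const ((2 : ℝ) ^ n)).mul (hα _ (chart_mem_atlas (Model n) x)))
  refine h1.integrableOn_of_zero_off (chartAt (Model n) x).open_target (chartSupport_subset x)
    (isCompact_chartSupport x) ?_
  filter_upwards [ae_restrict_mem (chartAt (Model n) x).open_target.measurableSet] with z hz hzK
  rw [localExpr, partition_eq_zero_of_notMem x hz hzK, zero_mul]

lemma integral_eq_sum {T : Finset M} (hT : ∀ x ∉ T, ∀ y, partition n M x y = 0)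
    (α : LocalFun n M) : integral α = ∑ x ∈ T, ∫ z in (chartAt (Model n) x).target,
      partition n M x ((chartAt (Model n) x).symm z) * (2 ^ n * α (chartAt (Model n) x) z) := by
  refine finsum_eq_sum_of_support_subset _ fun x hx => ?_
  by_contra h
  refine hx ?_
  simp [hT x h]

lemma integral_congr {α β : LocalFun n M} (h : AEEqual α β) : integral α = integral β := by
  refine finsum_congr fun x => integral_congr_ae ?_
  filter_upwards [h _ (chart_mem_atlas (Model n) x)] with z hz
  rw [hz]

lemma integral_add' {α β : LocalFun n M} (hα : IsLoc α) (hβ : IsLoc β) :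
    integral (α + β) = integral α + integral β := by
  obtain ⟨T, hT⟩ := exists_finset_support (partition n M)
  rw [integral_eq_sum hT, integral_eq_sum hT, integral_eq_sum hT, ← Finset.sum_add_distrib]
  refine Finset.sum_congr rfl fun x _ => ?_
  rw [← MeasureTheory.integral_add (integrableOn_partition_mul hα x)
    (integrableOn_partition_mul hβ x)]
  refine integral_congr_ae (Eventually.of_forall fun z => ?_)
  simp only [Pi.add_apply]; ring

lemma integral_smul (c : ℝ) (α : LocalFun n M) : integral (c • α) = c * integral α := by
  obtain ⟨T, hT⟩ := exists_finset_support (partition n M)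
  rw [integral_eq_sum hT, integral_eq_sum hT, Finset.mul_sum]
  refine Finset.sum_congr rfl fun x _ => ?_
  rw [← integral_const_mul]
  refine integral_congr_ae (Eventually.of_forall fun z => ?_)
  simp only [Pi.smul_apply, smul_eq_mul]; ring

lemma integral_sub' {α β : LocalFun n M} (hα : IsLoc α) (hβ : IsLoc β) :
    integral (α - β) = integral α - integral β := by
  have h : α - β = α + (-1 : ℝ) • β := by simp [sub_eq_add_neg]
  rw [h, integral_add' hα (hβ.const_smul _), integral_smul]; ring

lemma integral_sum {ι : Type*} (s : Finset ι) {α : ι → LocalFun n M}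
    (h : ∀ i ∈ s, IsLoc (α i)) : integral (∑ i ∈ s, α i) = ∑ i ∈ s, integral (α i) := by
  classical
  induction s using Finset.induction_on with
  | empty =>
    simp only [Finset.sum_empty]
    simpa using integral_smul (0 : ℝ) (0 : LocalFun n M)
  | insert i s hi ih =>
    rw [Finset.sum_insert hi, Finset.sum_insert hi,
      integral_add' (h i (Finset.mem_insert_self i s))
        (IsLoc.sum fun j hj => h j (Finset.mem_insert_of_mem hj)),
      ih fun j hj => h j (Finset.mem_insert_of_mem hj)]

/-- Differentiation under the integral sign. -/
lemma hasDerivAt_integral {F F' : ℝ → LocalFun n M} {δ : ℝ} (hδ : 0 < δ)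
    (hF : ∀ t, |t| < δ → IsLoc (F t)) (hF' : IsLoc (F' 0))
    (hb : ∀ e ∈ atlas (Model n) M, ∀ K ⊆ e.target, IsCompact K → ∃ C : ℝ,
      ∀ᵐ z ∂(volume.restrict K), ∀ t, |t| < δ → |F' t e z| ≤ C)
    (hd : ∀ e ∈ atlas (Model n) M, ∀ᵐ z ∂(volume.restrict e.target), ∀ t, |t| < δ →
      HasDerivAt (fun t => F t e z) (F' t e z) t) :
    HasDerivAt (fun t => integral (F t)) (integral (F' 0)) 0 := by
  obtain ⟨T, hT⟩ := exists_finset_support (partition n M)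
  simp only [integral_eq_sum hT]
  refine HasDerivAt.fun_sum fun x _ => ?_
  set e := chartAt (Model n) x with he
  have hea : e ∈ atlas (Model n) M := chart_mem_atlas (Model n) x
  have hK := isCompact_chartSupport (n := n) x
  have hKt := chartSupport_subset (n := n) x
  have hred : ∀ α : LocalFun n M, ∫ z in e.target,
      partition n M x (e.symm z) * (2 ^ n * α e z) = ∫ z in chartSupport n x,
      partition n M x (e.symm z) * (2 ^ n * α e z) := fun α =>
    setIntegral_eq_of_subset_of_forall_sdiff_eq_zero e.open_target.measurableSet hKt
      fun z hz => by rw [partition_eq_zero_of_notMem x hz.1 hz.2, zero_mul]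
  have hred' : (fun t => ∫ z in e.target, partition n M x (e.symm z) * (2 ^ n * F t e z)) =
      fun t => ∫ z in chartSupport n x, partition n M x (e.symm z) * (2 ^ n * F t e z) :=
    funext fun t => hred (F t)
  rw [hred', hred (F' 0)]
  have hm : ∀ {α : LocalFun n M}, IsLoc α → Integrable (fun z => partition n M x (e.symm z) *
      (2 ^ n * α e z)) (volume.restrict (chartSupport n x)) := fun hα =>
    ((isLoc_partition x e hea).mul ((LInfLoc.const ((2 : ℝ) ^ n)).mul
      (hα e hea))).integrableOn hKt hK
  obtain ⟨C, hC⟩ := hb e hea _ hKt hK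
  have : IsFiniteMeasure (volume.restrict (chartSupport n x)) := ⟨by
    rw [Measure.restrict_apply_univ]; exact hK.measure_lt_top⟩
  have hs : {t : ℝ | |t| < δ} ∈ 𝓝 (0 : ℝ) := by
    have := Metric.ball_mem_nhds (0 : ℝ) hδ
    refine mem_of_superset this fun t ht => ?_
    simpa [Real.dist_eq] using ht
  refine (hasDerivAt_integral_of_dominated_loc_of_deriv_le
    (F := fun t z => partition n M x (e.symm z) * (2 ^ n * F t e z))
    (F' := fun t z => partition n M x (e.symm z) * (2 ^ n * F' t e z))
    (bound := fun _ => 2 ^ n * C) hs ?_ (hm (hF 0 (by simpa using hδ))) (hm hF').1 ?_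
    (integrable_const _) ?_).2
  · filter_upwards [hs] with t ht using (hm (hF t ht)).1
  · filter_upwards [hC] with z hz t ht
    have h1 : |partition n M x (e.symm z)| ≤ 1 := by
      rw [abs_of_nonneg ((partition n M).nonneg x _)]
      exact (partition n M).le_one x _
    rw [norm_mul, norm_mul, Real.norm_eq_abs, Real.norm_eq_abs, Real.norm_eq_abs,
      abs_of_nonneg (by positivity : (0 : ℝ) ≤ 2 ^ n)]
    have h2 := hz t ht
    have h3 : 0 ≤ (2 : ℝ) ^ n * |F' t e z| := by positivity
    calc _ ≤ 1 * (2 ^ n * |F' t e z|) := mul_le_mul_of_nonneg_right h1 h3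
      _ ≤ 2 ^ n * C := by
        rw [one_mul]; exact mul_le_mul_of_nonneg_left h2 (by positivity)
  · filter_upwards [ae_restrict_of_ae_restrict_of_subset hKt (hd e hea)] with z hz t ht
    exact ((hz t ht).const_mul _).const_mul _

variable [IsManifold 𝓘(ℂ, Model n) ω M]

/-- The integral of an (n,n)-form which vanishes off a compact subset of one chart can be computed
in this chart. -/
lemma integral_eq_chart {α : LocalFun n M} (hα : IsDensity α)
    {e : OpenPartialHomeomorph M (Model n)} (he : e ∈ atlas (Model n) M) {K : Set M}
    (hK : IsCompact K) (hKe : K ⊆ e.source)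
    (h0 : ∀ e' ∈ atlas (Model n) M, ∀ᵐ z, z ∈ e'.target → e'.symm z ∉ K → α e' z = 0) :
    integral α = ∫ z in e.target, 2 ^ n * α e z := by
  obtain ⟨T, hT⟩ := exists_finset_support (partition n M)
  obtain ⟨hc1, hc2, hc3⟩ := isCompact_image_chart hK hKe
  rw [integral_eq_sum hT]
  have h1 : ∀ x ∈ T, ∫ z in (chartAt (Model n) x).target,
      partition n M x ((chartAt (Model n) x).symm z) * (2 ^ n * α (chartAt (Model n) x) z) =
      ∫ z in e.target, partition n M x (e.symm z) * (2 ^ n * α e z) := by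
    intro x _
    set e' := chartAt (Model n) x with he'
    have hea : e' ∈ atlas (Model n) M := chart_mem_atlas (Model n) x
    have s1 : ∫ z in e'.target, partition n M x (e'.symm z) * (2 ^ n * α e' z) =
        ∫ z in overlap e' e, partition n M x (e'.symm z) * (2 ^ n * α e' z) := by
      refine setIntegral_eq_of_subset_of_ae_sdiff_eq_zero
        e'.open_target.measurableSet.nullMeasurableSet overlap_subset ?_
      filter_upwards [h0 e' hea] with z hz hzd
      rw [hz hzd.1 fun h => hzd.2 ⟨hzd.1, hKe h⟩, mul_zero, mul_zero]
    have s2 : ∫ z in e.target, partition n M x (e.symm z) * (2 ^ n * α e z) =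
        ∫ z in overlap e e', partition n M x (e.symm z) * (2 ^ n * α e z) := by
      refine setIntegral_eq_of_subset_of_forall_sdiff_eq_zero e.open_target.measurableSet
        overlap_subset fun z hz => ?_
      rw [partition_eq_zero x fun h => hz.2 ⟨hz.1, partition_subordinate x h⟩, zero_mul]
    rw [s1, s2, ← image_transition (e := e') (e' := e),
      integral_image_eq_integral_abs_det_fderiv_smul volume isOpen_overlap.measurableSet
        (fun z hz => ((differentiableAt_transition hea he hz).restrictScalars
          ℝ).hasFDerivAt.hasFDerivWithinAt) injOn_transition]
    refine integral_congr_ae ((ae_restrict_iff' isOpen_overlap.measurableSet).2 ?_)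
    filter_upwards [hα.trans e' hea e he] with z hz hzo
    rw [hz hzo, symm_transition hzo, det_fderiv_real (differentiableAt_transition hea he hzo),
      abs_of_nonneg (Complex.normSq_nonneg _), smul_eq_mul]
    ring
  rw [Finset.sum_congr rfl h1, ← integral_finsetSum]
  · refine integral_congr_ae (Eventually.of_forall fun z => ?_)
    simp only
    rw [← Finset.sum_mul, sum_partition _ hT, one_mul]
  · intro x _
    have h2 := (isLoc_partition x e he).mul
      ((LInfLoc.const ((2 : ℝ) ^ n)).mul (hα.loc e he))
    refine h2.integrableOn_of_zero_off e.open_target hc2 hc1 ?_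
    refine (ae_restrict_iff' e.open_target.measurableSet).2 ?_
    filter_upwards [h0 e he] with z hz hzt hzK
    rw [hz hzt (hc3 z hzt hzK), mul_zero, mul_zero]

end Integral

/-! ### Estimates for positive semidefinite matrices -/

section PosSemidef

open Matrix

variable {n : ℕ}

lemma _root_.Matrix.PosSemidef.real_smul {A : Matrix (Fin n) (Fin n) ℂ} (hA : A.PosSemidef) {r : ℝ}
    (hr : 0 ≤ r) : (r • A).PosSemidef := hA.smul hr

lemma _root_.Matrix.PosSemidef.re_diag_nonneg {A : Matrix (Fin n) (Fin n) ℂ} (hA : A.PosSemidef)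
    (i : Fin n) : 0 ≤ (A i i).re := (Complex.le_def.1 hA.diag_nonneg).1

open scoped MatrixOrder in
/-- The entries of a positive semidefinite matrix are controlled by its diagonal. -/
lemma norm_apply_le_of_posSemidef {A : Matrix (Fin n) (Fin n) ℂ} (hA : A.PosSemidef)
    (i j : Fin n) : ‖A i j‖ ≤ (A i i).re + (A j j).re := by
  obtain ⟨B, rfl⟩ : ∃ B : Matrix (Fin n) (Fin n) ℂ, A = Bᴴ * B := by
    exact CStarAlgebra.nonneg_iff_eq_star_mul_self.1 hA.nonneg
  have hd : ∀ i, ((Bᴴ * B) i i).re = ∑ k, ‖B k i‖ ^ 2 := fun i => by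
    simp only [Matrix.mul_apply, Matrix.conjTranspose_apply, Complex.re_sum, RCLike.star_def]
    refine Finset.sum_congr rfl fun k _ => ?_
    rw [← Complex.normSq_eq_norm_sq, Complex.normSq_apply]
    simp
  rw [hd, hd, Matrix.mul_apply, ← Finset.sum_add_distrib]
  refine (norm_sum_le _ _).trans (Finset.sum_le_sum fun k _ => ?_)
  rw [norm_mul, Matrix.conjTranspose_apply, norm_star]
  nlinarith [sq_nonneg (‖B k i‖ - ‖B k j‖), sq_nonneg (‖B k i‖ + ‖B k j‖)]

/-- A Hermitian form squeezed between `-LG` and `LG` has entries bounded in terms of `L` and of the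
entries of `G`. -/
lemma norm_apply_le_of_sandwich {G H : Matrix (Fin n) (Fin n) ℂ} {L D : ℝ}
    (h1 : (L • G - H).PosSemidef) (h2 : (L • G + H).PosSemidef) (hD : ∀ i j, ‖G i j‖ ≤ D)
    (i j : Fin n) : ‖H i j‖ ≤ 5 * |L| * D := by
  have hG : ∀ i j, ‖(L • G) i j‖ ≤ |L| * D := fun i j => by
    rw [Matrix.smul_apply, norm_smul, Real.norm_eq_abs]
    exact mul_le_mul_of_nonneg_left (hD i j) (abs_nonneg L)
  have hd : ∀ i, ((L • G - H) i i).re ≤ 2 * (|L| * D) := fun i => by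
    have e1 := h2.re_diag_nonneg i
    have e2 := (Complex.re_le_norm _).trans (hG i i)
    simp only [Matrix.sub_apply, Matrix.add_apply, Complex.sub_re, Complex.add_re] at e1 ⊢
    linarith
  have e3 := norm_apply_le_of_posSemidef h1 i j
  have e4 : H i j = (L • G) i j - (L • G - H) i j := by simp
  rw [e4]
  refine (norm_sub_le _ _).trans ?_
  linarith [hG i j, hd i, hd j]

lemma star_dotProduct_self_eq (v : Fin n → ℂ) :
    (star v ⬝ᵥ v) = ((∑ i, ‖v i‖ ^ 2 : ℝ) : ℂ) := by
  simp only [dotProduct, Pi.star_apply, Complex.ofReal_sum]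
  refine Finset.sum_congr rfl fun i _ => ?_
  rw [RCLike.star_def, ← Complex.normSq_eq_conj_mul_self, Complex.normSq_eq_norm_sq]

lemma isHermitian_real_smul {A : Matrix (Fin n) (Fin n) ℂ} (hA : A.IsHermitian) (r : ℝ) :
    (r • A).IsHermitian := by
  rw [Matrix.IsHermitian, Matrix.conjTranspose_smul, hA.eq]; simp

lemma dotProduct_mulVec_eq_re {A : Matrix (Fin n) (Fin n) ℂ} (hA : A.IsHermitian)
    (v : Fin n → ℂ) : star v ⬝ᵥ (A *ᵥ v) = ((star v ⬝ᵥ (A *ᵥ v)).re : ℂ) := by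
  refine Complex.ext (by simp) ?_
  simpa using hA.im_star_dotProduct_mulVec_self v

lemma posSemidef_iff_re {A : Matrix (Fin n) (Fin n) ℂ} (hA : A.IsHermitian) :
    A.PosSemidef ↔ ∀ v, 0 ≤ (star v ⬝ᵥ (A *ᵥ v)).re := by
  rw [posSemidef_iff_dotProduct_mulVec]
  refine ⟨fun h v => (Complex.le_def.1 (h.2 v)).1, fun h => ⟨hA, fun v => ?_⟩⟩
  rw [dotProduct_mulVec_eq_re hA]
  exact_mod_cast h v

/-- A Hermitian matrix with entries bounded by `D` is at least `-nD`. -/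
lemma posSemidef_of_norm_apply_le {H : Matrix (Fin n) (Fin n) ℂ} (hH : H.IsHermitian) {D : ℝ}
    (hD : ∀ i j, ‖H i j‖ ≤ D) : ((n * D) • (1 : Matrix (Fin n) (Fin n) ℂ) + H).PosSemidef := by
  have hh := (isHermitian_real_smul (isHermitian_one (n := Fin n) (α := ℂ)) (n * D)).add hH
  rw [posSemidef_iff_re hh]
  intro v
  rw [add_mulVec, dotProduct_add, smul_mulVec, one_mulVec, dotProduct_smul, star_dotProduct_self_eq,
    Complex.add_re, Complex.real_smul, ← Complex.ofReal_mul, Complex.ofReal_re]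
  have h1 : ‖star v ⬝ᵥ (H *ᵥ v)‖ ≤ ∑ i, ∑ j, D * ((‖v i‖ ^ 2 + ‖v j‖ ^ 2) / 2) := by
    simp only [dotProduct, mulVec, Finset.mul_sum]
    refine (norm_sum_le _ _).trans (Finset.sum_le_sum fun i _ => (norm_sum_le _ _).trans
      (Finset.sum_le_sum fun j _ => ?_))
    rw [norm_mul, norm_mul, Pi.star_apply, norm_star]
    have := hD i j
    have h0 := norm_nonneg (H i j)
    have e1 : ‖v i‖ * (‖H i j‖ * ‖v j‖) = ‖H i j‖ * (‖v i‖ * ‖v j‖) := by ring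
    rw [e1]
    refine mul_le_mul this ?_ (by positivity) (h0.trans this)
    nlinarith [sq_nonneg (‖v i‖ - ‖v j‖)]
  have h2 : ∑ i, ∑ j, D * ((‖v i‖ ^ 2 + ‖v j‖ ^ 2) / 2) = n * D * ∑ i, ‖v i‖ ^ 2 := by
    simp only [add_div, mul_add, Finset.sum_add_distrib, Finset.sum_const, Finset.card_univ,
      Fintype.card_fin, ← Finset.mul_sum, ← Finset.sum_div, nsmul_eq_mul]
    ring
  have h3 := (abs_le.1 (Complex.abs_re_le_norm (star v ⬝ᵥ (H *ᵥ v)))).1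
  linarith

/-- A continuous family of positive definite matrices over a compact set is uniformly positive. -/
lemma exists_pos_lower_bound {K : Set (Model n)} (hK : IsCompact K)
    {G : Model n → Matrix (Fin n) (Fin n) ℂ} (hc : ∀ i j, ContinuousOn (fun z => G z i j) K)
    (hG : ∀ z ∈ K, (G z).PosDef) :
    ∃ m : ℝ, 0 < m ∧ ∀ z ∈ K, (G z - m • (1 : Matrix (Fin n) (Fin n) ℂ)).PosSemidef := by
  set S : Set (Fin n → ℂ) := {v | ∑ i, ‖v i‖ ^ 2 = 1} with hS
  have hSc : IsCompact S := by
    refine Metric.isCompact_of_isClosed_isBounded (isClosed_eq (by fun_prop) continuous_const) ?_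
    refine (Metric.isBounded_closedBall (x := (0 : Fin n → ℂ)) (r := 1)).subset fun v hv => ?_
    rw [mem_closedBall_zero_iff, pi_norm_le_iff_of_nonneg zero_le_one]
    intro i
    have h1 : ‖v i‖ ^ 2 ≤ ∑ i, ‖v i‖ ^ 2 :=
      Finset.single_le_sum (f := fun i => ‖v i‖ ^ 2) (fun _ _ => by positivity)
        (Finset.mem_univ i)
    have h2 : ∑ i, ‖v i‖ ^ 2 = 1 := hv
    nlinarith [norm_nonneg (v i)]
  have hcont : ContinuousOn (fun p : Model n × (Fin n → ℂ) =>
      (star p.2 ⬝ᵥ (G p.1 *ᵥ p.2)).re) (K ×ˢ S) := by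
    refine Complex.continuous_re.comp_continuousOn ?_
    simp only [dotProduct, mulVec, Pi.star_apply]
    refine continuousOn_finsetSum _ fun i _ => ContinuousOn.mul ?_
      (continuousOn_finsetSum _ fun j _ => ContinuousOn.mul ?_ ?_)
    · exact ((continuous_apply i).comp continuous_snd).star.continuousOn
    · exact (hc i j).comp continuousOn_fst fun p hp => hp.1
    · exact ((continuous_apply j).comp continuous_snd).continuousOn
  obtain ⟨m, hm, hmin⟩ : ∃ m : ℝ, 0 < m ∧ ∀ z ∈ K, ∀ v ∈ S,
      m ≤ (star v ⬝ᵥ (G z *ᵥ v)).re := by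
    rcases (K ×ˢ S).eq_empty_or_nonempty with h | h
    · refine ⟨1, one_pos, fun z hz v hv => ?_⟩
      exact absurd (show (z, v) ∈ K ×ˢ S from ⟨hz, hv⟩) (by rw [h]; simp)
    · obtain ⟨p, hp, hpm⟩ := (hK.prod hSc).exists_isMinOn h hcont
      refine ⟨_, (hG p.1 hp.1).re_dotProduct_pos (x := p.2) fun h0 => ?_,
        fun z hz v hv => hpm (show (z, v) ∈ K ×ˢ S from ⟨hz, hv⟩)⟩
      have : ∑ i, ‖p.2 i‖ ^ 2 = 1 := hp.2
      rw [h0] at this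
      simp at this
  refine ⟨m, hm, fun z hz => ?_⟩
  have hh : (G z - m • (1 : Matrix (Fin n) (Fin n) ℂ)).IsHermitian :=
    (hG z hz).1.sub (isHermitian_real_smul isHermitian_one m)
  rw [posSemidef_iff_re hh]
  intro v
  rw [sub_mulVec, dotProduct_sub, smul_mulVec, one_mulVec, dotProduct_smul, star_dotProduct_self_eq,
    Complex.sub_re, Complex.real_smul, ← Complex.ofReal_mul, Complex.ofReal_re]
  set s := ∑ i, ‖v i‖ ^ 2 with hs
  rcases (Finset.sum_nonneg fun i _ => by positivity : 0 ≤ s).eq_or_lt with h0 | h0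
  · have : v = 0 := by
      funext i
      have := (Finset.sum_eq_zero_iff_of_nonneg (fun i _ => by positivity)).1 h0.symm i
        (Finset.mem_univ i)
      simpa using this
    have h1 : s = 0 := h0.symm
    rw [h1, this]; simp
  · have hw : ((Real.sqrt s)⁻¹ : ℂ) • v ∈ S := by
      change ∑ i, ‖(((Real.sqrt s)⁻¹ : ℂ) • v) i‖ ^ 2 = 1
      have : ∀ i, ‖(((Real.sqrt s)⁻¹ : ℂ) • v) i‖ ^ 2 = s⁻¹ * ‖v i‖ ^ 2 := fun i => by
        rw [Pi.smul_apply, norm_smul, mul_pow, norm_inv, Complex.norm_real, Real.norm_eq_abs,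
          inv_pow, sq_abs, Real.sq_sqrt h0.le]
      simp only [this]
      rw [← Finset.mul_sum, ← hs, inv_mul_cancel₀ h0.ne']
    have h1 := hmin z hz _ hw
    have h2 : star (((Real.sqrt s)⁻¹ : ℂ) • v) ⬝ᵥ (G z *ᵥ (((Real.sqrt s)⁻¹ : ℂ) • v)) =
        ((s⁻¹ : ℝ) : ℂ) * (star v ⬝ᵥ (G z *ᵥ v)) := by
      rw [star_smul, mulVec_smul, dotProduct_smul, smul_dotProduct, smul_smul, smul_eq_mul,
        RCLike.star_def, map_inv₀, Complex.conj_ofReal, ← mul_inv, ← Complex.ofReal_mul,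
        Real.mul_self_sqrt h0.le, Complex.ofReal_inv]
    rw [h2, Complex.re_ofReal_mul] at h1
    have h3 : m * s ≤ s⁻¹ * (star v ⬝ᵥ (G z *ᵥ v)).re * s := mul_le_mul_of_nonneg_right h1 h0.le
    have h4 : s⁻¹ * (star v ⬝ᵥ (G z *ᵥ v)).re * s = (star v ⬝ᵥ (G z *ᵥ v)).re := by
      have h5 : s ≠ 0 := h0.ne'
      rw [mul_assoc, mul_comm _ s, ← mul_assoc, inv_mul_cancel₀ h5, one_mul]
    linarith

lemma posDef_of_sub_posSemidef {A : Matrix (Fin n) (Fin n) ℂ} {η : ℝ} (hη : 0 < η)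
    (h : (A - η • (1 : Matrix (Fin n) (Fin n) ℂ)).PosSemidef) : A.PosDef := by
  have h1 : (η • (1 : Matrix (Fin n) (Fin n) ℂ)).PosDef := Matrix.PosDef.one.smul hη
  simpa using h1.posSemidef_add h

/-- The determinant of a matrix bounded below by `η` is at least `ηⁿ`. -/
lemma pow_le_det_of_posSemidef {A : Matrix (Fin n) (Fin n) ℂ} {η : ℝ} (hη : 0 < η)
    (h : (A - η • (1 : Matrix (Fin n) (Fin n) ℂ)).PosSemidef) : η ^ n ≤ A.det.re := by
  have hA := posDef_of_sub_posSemidef hη h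
  have hev : ∀ i, η ≤ hA.1.eigenvalues i := fun i => by
    rw [hA.1.eigenvalues_eq i]
    set v : Fin n → ℂ := (hA.1.eigenvectorBasis i).ofLp with hv
    have h1 := h.re_dotProduct_nonneg v
    rw [sub_mulVec, dotProduct_sub, smul_mulVec, one_mulVec, dotProduct_smul, star_dotProduct_self_eq,
      ] at h1
    have h2 : ∑ k, ‖v k‖ ^ 2 = 1 := by
      have := (hA.1.eigenvectorBasis).orthonormal.1 i
      rw [EuclideanSpace.norm_eq, Real.sqrt_eq_one] at this
      exact this
    rw [h2] at h1
    simp at h1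
    simpa using h1
  have hdet : A.det.re = ∏ i, hA.1.eigenvalues i := by
    have h1 : A.det = ((∏ i, hA.1.eigenvalues i : ℝ) : ℂ) := by
      rw [hA.1.det_eq_prod_eigenvalues]; push_cast; rfl
    rw [h1, Complex.ofReal_re]
  rw [hdet]
  calc η ^ n = ∏ _i : Fin n, η := by simp
    _ ≤ _ := Finset.prod_le_prod (fun _ _ => hη.le) fun i _ => hev i

lemma posSemidef_transpose_mul_mul {A : Matrix (Fin n) (Fin n) ℂ} (hA : A.PosSemidef)
    (J : Matrix (Fin n) (Fin n) ℂ) : (J.transpose * A * J.map (starRingEnd ℂ)).PosSemidef := by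
  have h := hA.conjTranspose_mul_mul_same (J.map (starRingEnd ℂ))
  have e : (J.map (starRingEnd ℂ))ᴴ = J.transpose := by
    ext i j; simp [Matrix.conjTranspose_apply]
  rwa [e] at h

end PosSemidef

/-! ### Functions with bounded complex Hessian on the manifold -/

section Potential

lemma isWeakDdbar_weakDdbar {n : ℕ} {M : Type*} [TopologicalSpace M]
    {e : OpenPartialHomeomorph M (Model n)} {v : M → ℝ}
    {H : Model n → Matrix (Fin n) (Fin n) ℂ} (h : IsWeakDdbar e v H) :
    IsWeakDdbar e v (weakDdbar v e) := by
  have hex : ∃ H, IsWeakDdbar e v H := ⟨H, h⟩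
  rw [weakDdbar, dif_pos hex]
  exact hex.choose_spec

variable {n : ℕ} {M : Type*} [TopologicalSpace M] [ChartedSpace (Model n) M]

/-- A locally bounded function `v` whose distributional complex Hessian is the locally bounded
matrix function `H`, in every chart of the atlas. -/
structure IsPotential (v : M → ℝ) (H : LocalForm n M) : Prop where
  loc : IsLoc (n := n) (localExpr v)
  locForm : IsLocForm H
  weak : ∀ e ∈ atlas (Model n) M, WeakHess e.target (localExpr v e) (H e)

namespace IsPotential

variable {v w : M → ℝ} {H H' : LocalForm n M}

lemma unique (h : IsPotential v H) (h' : IsPotential v H') : AEEqual H H' := fun e he =>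
  (h.weak e he).unique e.open_target (h'.weak e he)

lemma aeEqual_weakDdbar (h : IsPotential v H) : AEEqual (weakDdbar v) H := fun e he =>
  WeakHess.unique e.open_target (isWeakDdbar_weakDdbar (h.weak e he)) (h.weak e he)

lemma add (h : IsPotential v H) (h' : IsPotential w H') :
    IsPotential (fun x => v x + w x) fun e z => H e z + H' e z :=
  ⟨h.loc.add h'.loc, fun e he i j => (h.locForm e he i j).add (h'.locForm e he i j),
    fun e he => (h.weak e he).add e.open_target (h.loc e he) (h'.loc e he) (h'.weak e he)⟩

lemma const_mul (h : IsPotential v H) (t : ℝ) :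
    IsPotential (fun x => t * v x) fun e z => t • H e z := by
  refine ⟨h.loc.const_smul t, fun e he i j => ?_, fun e he => (h.weak e he).const_mul t⟩
  have : (fun z => (t • H e z) i j) = fun z => (t : ℂ) * H e z i j := by
    funext z; simp
  rw [this]
  exact (LInfLoc.const _).mul (h.locForm e he i j)

variable [IsManifold 𝓘(ℂ, Model n) ω M]

/-- The distributional complex Hessian of a function is a (1,1)-form: its coefficients in the
various charts transform accordingly. -/
lemma isForm (h : IsPotential v H) : IsForm H := by
  refine ⟨h.locForm, fun e he e' he' => ?_⟩
  refine WeakHess.ae_eq_comp isOpen_overlap e'.open_target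
    (fun z hz => contDiffAt_transition he he' hz)
    (fun z hz => overlap_subset (transition_mem hz))
    (volume_preimage_transition he he') (f := localExpr v e) (f' := localExpr v e')
    (fun z hz => ?_)
    ((h.weak e he).mono e.open_target isOpen_overlap overlap_subset) (h.loc e' he')
    (h.locForm e' he') (h.weak e' he')
  rw [localExpr, localExpr, symm_transition hz]

end IsPotential

lemma isPotential_zero : IsPotential (fun _ => 0 : M → ℝ) (fun _ _ => 0 : LocalForm n M) := by
  refine ⟨fun e _ => LInfLoc.const _, IsForm.zero.loc, fun e _ i j => ⟨?_, fun χ _ _ _ => ?_⟩⟩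
  · simpa using (locallyIntegrable_zero (μ := (volume : Measure (Model n)))
      (ε'' := ℂ)).locallyIntegrableOn e.target
  · simp [localExpr]

lemma isPotential_sum {ι : Type*} (s : Finset ι) {v : ι → M → ℝ} {H : ι → LocalForm n M}
    (h : ∀ i ∈ s, IsPotential (v i) (H i)) :
    IsPotential (fun x => ∑ i ∈ s, v i x) fun e z => ∑ i ∈ s, H i e z := by
  classical
  induction s using Finset.induction_on with
  | empty => simpa using isPotential_zero
  | insert i s hi ih =>
    simp only [Finset.sum_insert hi]
    exact (h i (Finset.mem_insert_self i s)).add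
      (ih fun j hj => h j (Finset.mem_insert_of_mem hj))

lemma isPotential_of_isC11 {ψ : M → ℝ} (h : IsC11 n ψ) : IsPotential ψ (ddbar (n := n) ψ) :=
  ⟨fun e he => LInfLoc.of_continuousOn (h e he).1.continuousOn,
    fun e he => LInfLoc.complexHessian e.open_target (h e he).1 (h e he).2,
    fun e he => weakHess_of_c11 e.open_target (h e he).1 (h e he).2⟩

section Smooth

variable [IsManifold 𝓘(ℂ, Model n) ω M]

lemma contDiffOn_localExpr {ψ : M → ℝ} (h : IsSmooth n ψ)
    {e : OpenPartialHomeomorph M (Model n)} (he : e ∈ atlas (Model n) M) :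
    ContDiffOn ℝ ∞ (localExpr ψ e) e.target := by
  have := isManifold_real n M
  have h1 : ContMDiffOn 𝓘(ℝ, Model n) 𝓘(ℝ, Model n) ∞ e.symm e.target :=
    contMDiffOn_symm_of_mem_maximalAtlas (IsManifold.subset_maximalAtlas he)
  have h2 : ContMDiffOn 𝓘(ℝ, Model n) 𝓘(ℝ, ℝ) ∞ (ψ ∘ e.symm) e.target :=
    (ContMDiff.contMDiffOn (s := univ) h).comp h1 fun _ _ => mem_univ _
  exact contMDiffOn_iff_contDiffOn.1 h2

lemma isC11_of_isSmooth {ψ : M → ℝ} (h : IsSmooth n ψ) : IsC11 n ψ := fun e he =>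
  c11_of_contDiffOn e.open_target (contDiffOn_localExpr h he)

lemma isPotential_of_isSmooth {ψ : M → ℝ} (h : IsSmooth n ψ) :
    IsPotential ψ (ddbar (n := n) ψ) := isPotential_of_isC11 (isC11_of_isSmooth h)

/-- The constant function `1`, with the zero form as its complex Hessian. -/
lemma isPotential_one : IsPotential (fun _ => 1 : M → ℝ) (fun _ _ => 0 : LocalForm n M) := by
  have h := isPotential_of_isSmooth (n := n) (M := M) (ψ := fun _ => 1) contMDiff_const
  have e : ddbar (n := n) (fun _ : M => (1 : ℝ)) = fun _ _ => 0 := by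
    funext e z
    ext i j
    have h0 : (dzbar j fun _ : Model n => (1 : ℂ)) = 0 := by
      funext w; simp [dzbar]
    simp [ddbar, complexHessian, localExpr, dz, h0]
  rwa [e] at h

/-- The complex Hessian of a smooth function transforms as a form at every point. -/
lemma ddbar_transform {ψ : M → ℝ} (h : IsSmooth n ψ)
    {e e' : OpenPartialHomeomorph M (Model n)} (he : e ∈ atlas (Model n) M)
    (he' : e' ∈ atlas (Model n) M) {z : Model n} (hz : z ∈ overlap e e') :
    ddbar ψ e z = (jacobian (transition e e') z).transpose * ddbar ψ e' (transition e e' z) *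
      (jacobian (transition e e') z).map (starRingEnd ℂ) := by
  have h1 : localExpr ψ e =ᶠ[𝓝 z] localExpr ψ e' ∘ transition e e' := by
    filter_upwards [isOpen_overlap.mem_nhds hz] with w hw
    rw [Function.comp_apply, localExpr, localExpr, symm_transition hw]
  rw [ddbar, complexHessian_congr h1, complexHessian_comp
    ((contDiffAt_transition he he' hz).of_le le_top)]
  · rfl
  · exact ((contDiffOn_localExpr h he').contDiffAt
      (e'.open_target.mem_nhds (overlap_subset (transition_mem hz)))).of_le
      (WithTop.coe_le_coe.2 le_top)

lemma isHermitian_ddbar {ψ : M → ℝ} (h : IsSmooth n ψ)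
    {e : OpenPartialHomeomorph M (Model n)} (he : e ∈ atlas (Model n) M) {z : Model n}
    (hz : z ∈ e.target) : (ddbar ψ e z).IsHermitian := by
  have h1 := contDiffAt_twice (((contDiffOn_localExpr h he).contDiffAt
    (e.open_target.mem_nhds hz)).of_le (WithTop.coe_le_coe.2 le_top))
  exact complexHessian_isHermitian h1.1 h1.2

lemma continuousOn_ddbar {ψ : M → ℝ} (h : IsSmooth n ψ)
    {e : OpenPartialHomeomorph M (Model n)} (he : e ∈ atlas (Model n) M) (i j : Fin n) :
    ContinuousOn (fun z => ddbar ψ e z i j) e.target := fun _ hz =>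
  (contDiffAt_complexHessian ((contDiffOn_localExpr h he).contDiffAt
    (e.open_target.mem_nhds hz)) i j).continuousAt.continuousWithinAt

end Smooth

/-! ### The Kähler form and the Ricci form -/

section Kahler

variable (ω₀ : KahlerMetric n M)

lemma KahlerMetric.closedFormOn {e : OpenPartialHomeomorph M (Model n)}
    (he : e ∈ atlas (Model n) M) : ClosedFormOn (ω₀.coeff e) e.target :=
  closedFormOn_of_isHermitian e.open_target (ω₀.smooth e he)
    (fun z hz => (ω₀.posDef e he z hz).1) (ω₀.closed e he)

lemma KahlerMetric.continuousOn_coeff {e : OpenPartialHomeomorph M (Model n)}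
    (he : e ∈ atlas (Model n) M) (i j : Fin n) :
    ContinuousOn (fun z => ω₀.coeff e z i j) e.target := (ω₀.smooth e he i j).continuousOn

lemma KahlerMetric.coeff_transform {e e' : OpenPartialHomeomorph M (Model n)}
    (he : e ∈ atlas (Model n) M) (he' : e' ∈ atlas (Model n) M) {z : Model n}
    (hz : z ∈ overlap e e') :
    ω₀.coeff e z = (jacobian (transition e e') z).transpose * ω₀.coeff e' (transition e e' z) *
      (jacobian (transition e e') z).map (starRingEnd ℂ) :=
  ω₀.transform e he e' he' z hz.1 hz.2

lemma KahlerMetric.isForm : IsForm ω₀.coeff :=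
  ⟨fun _ he i j => LInfLoc.of_continuousOn (ω₀.continuousOn_coeff he i j),
    fun _ he _ he' => Eventually.of_forall fun _ hz => ω₀.coeff_transform he he' hz⟩

lemma KahlerMetric.det_pos {e : OpenPartialHomeomorph M (Model n)}
    (he : e ∈ atlas (Model n) M) {z : Model n} (hz : z ∈ e.target) :
    0 < (ω₀.coeff e z).det.re := (Complex.lt_def.1 (ω₀.posDef e he z hz).det_pos).1

lemma contDiffOn_det {A : Model n → Matrix (Fin n) (Fin n) ℂ} {U : Set (Model n)}
    (h : ∀ i j, ContDiffOn ℝ ∞ (fun z => A z i j) U) :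
    ContDiffOn ℝ ∞ (fun z => (A z).det) U := by
  simp only [Matrix.det_apply]
  refine ContDiffOn.sum fun σ _ => ?_
  have : ContDiffOn ℝ ∞ (fun z => ∏ i, A z (σ i) i) U := contDiffOn_prod fun i _ => h _ _
  exact this.const_smul (Equiv.Perm.sign σ)

lemma KahlerMetric.contDiffOn_log_det {e : OpenPartialHomeomorph M (Model n)}
    (he : e ∈ atlas (Model n) M) :
    ContDiffOn ℝ ∞ (fun z => Real.log (ω₀.coeff e z).det.re) e.target := by
  refine ContDiffOn.log ?_ fun z hz => (ω₀.det_pos he hz).ne'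
  exact Complex.reCLM.contDiff.comp_contDiffOn (contDiffOn_det (ω₀.smooth e he))

lemma closedFormOn_ricci {e : OpenPartialHomeomorph M (Model n)}
    (he : e ∈ atlas (Model n) M) : ClosedFormOn (ricci ω₀ e) e.target := by
  have h := (closedFormOn_complexHessian e.open_target (ω₀.contDiffOn_log_det he)).smul
    e.open_target (-1)
  have e1 : ricci ω₀ e = fun z => (-1 : ℝ) •
      complexHessian (fun w => Real.log (ω₀.coeff e w).det.re) z := by
    funext z; simp [ricci]
  rwa [e1]

lemma det_transform (A J : Matrix (Fin n) (Fin n) ℂ) :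
    (J.transpose * A * J.map (starRingEnd ℂ)).det.re = Complex.normSq J.det * A.det.re := by
  have h : (J.map (starRingEnd ℂ)).det = (starRingEnd ℂ) J.det :=
    (RingHom.map_det (starRingEnd ℂ) J).symm
  rw [Matrix.det_mul, Matrix.det_mul, Matrix.det_transpose, h, mul_right_comm,
    Complex.mul_conj, Complex.re_ofReal_mul]

variable [IsManifold 𝓘(ℂ, Model n) ω M]

/-- Changing charts adds `log |h|²`, with `h` the holomorphic Jacobian determinant, to `log det g`,
and this function is pluriharmonic. -/
lemma isForm_ricci : IsForm (ricci ω₀) := by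
  refine ⟨fun e he i j => LInfLoc.of_continuousOn ((closedFormOn_ricci ω₀ he).smooth i
    j).continuousOn, fun e he e' he' => Eventually.of_forall fun z hz => ?_⟩
  set τ := transition e e' with hτ
  set f' : Model n → ℝ := fun w => Real.log (ω₀.coeff e' w).det.re with hf'
  set h : Model n → ℂ := fun w => (jacobian τ w).det with hh
  have hzt := e'.open_target.mem_nhds (overlap_subset (transition_mem hz))
  have h1 : (fun w => Real.log (ω₀.coeff e w).det.re) =ᶠ[𝓝 z]
      fun w => Real.log (Complex.normSq (h w)) + (f' ∘ τ) w := by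
    filter_upwards [isOpen_overlap.mem_nhds hz] with w hw
    rw [ω₀.coeff_transform he he' hw, det_transform, Real.log_mul]
    · rfl
    · exact (Complex.normSq_pos.2 (det_jacobian_ne_zero he he' hw)).ne'
    · exact (ω₀.det_pos he' (overlap_subset (transition_mem hw))).ne'
  have hτz := contDiffAt_transition he he' hz
  have hτR : ContDiffAt ℝ 2 τ z := (hτz.restrict_scalars ℝ).of_le le_top
  have hhz : ContDiffAt ℂ 2 h z := by
    have hfd : ContDiffAt ℂ 2 (fderiv ℂ τ) z := hτz.fderiv_right (m := 2) le_top
    simp only [hh, Matrix.det_apply]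
    refine ContDiffAt.sum fun σ _ => ?_
    have : ContDiffAt ℂ 2 (fun w => ∏ i, jacobian τ w (σ i) i) z := by
      refine contDiffAt_prod fun i _ => ?_
      change ContDiffAt ℂ 2 (fun w => fderiv ℂ τ w (Pi.single i 1) (σ i)) z
      exact contDiffAt_pi.1 (hfd.clm_apply contDiffAt_const) (σ i)
    exact this.const_smul (Equiv.Perm.sign σ)
  have hh0 : h z ≠ 0 := det_jacobian_ne_zero he he' hz
  have hf'z : ContDiffAt ℝ 2 f' (τ z) :=
    ((ω₀.contDiffOn_log_det he').contDiffAt hzt).of_le (WithTop.coe_le_coe.2 le_top)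
  have hlog : ContDiffAt ℝ 2 (fun w => Real.log (Complex.normSq (h w))) z := by
    have hr : ContDiffAt ℝ 2 h z := hhz.restrict_scalars ℝ
    have hn : ContDiffAt ℝ 2 (fun w => Complex.normSq (h w)) z := by
      simp only [Complex.normSq_apply]
      have hre : ContDiffAt ℝ 2 (fun w => (h w).re) z :=
        Complex.reCLM.contDiff.contDiffAt.comp z hr
      have him : ContDiffAt ℝ 2 (fun w => (h w).im) z :=
        Complex.imCLM.contDiff.contDiffAt.comp z hr
      exact (hre.mul hre).add (him.mul him)
    exact hn.log (Complex.normSq_pos.2 hh0).ne'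
  rw [ricci, complexHessian_congr h1, complexHessian_add (contDiffAt_twice hlog)
    (contDiffAt_twice (hf'z.comp z hτR)), complexHessian_log_normSq hhz hh0, zero_add,
    complexHessian_comp (hτz.of_le le_top) hf'z, ricci, Matrix.mul_neg, Matrix.neg_mul]

end Kahler

end Potential

lemma wedge_update_zero {n : ℕ} (A : Fin n → Matrix (Fin n) (Fin n) ℂ) (k₀ : Fin n) :
    wedge (Function.update A k₀ 0) = 0 := by
  simpa using wedge_update_smul A k₀ 0 0

lemma wedgeC_update_zero {n : ℕ} (A : Fin n → Matrix (Fin n) (Fin n) ℂ) (k₀ : Fin n) :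
    wedgeC (Function.update A k₀ 0) = 0 := by
  simpa using wedgeC_update_smul A k₀ 0 0

lemma localExpr_eq_zero {n : ℕ} {M : Type*} [TopologicalSpace M] {φ : M → ℝ}
    {e : OpenPartialHomeomorph M (Model n)} {z : Model n} (h : e.symm z ∉ tsupport φ) :
    localExpr φ e z = 0 := image_eq_zero_of_notMem_tsupport (f := φ) h

/-! ### Integration by parts on the manifold -/

section ChartExtension

variable {n : ℕ} {M : Type*} [TopologicalSpace M]

/-- A function on the model space which is `φ` in the chart `e` and zero outside of it. -/
noncomputable def chartExtension (e : OpenPartialHomeomorph M (Model n)) (φ : M → ℝ) :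
    Model n → ℝ := e.target.indicator (localExpr φ e)

lemma chartExtension_apply {e : OpenPartialHomeomorph M (Model n)} {φ : M → ℝ} {z : Model n}
    (hz : z ∈ e.target) : chartExtension e φ z = localExpr φ e z := indicator_of_mem hz _

variable {e : OpenPartialHomeomorph M (Model n)} {φ : M → ℝ}

lemma ddbar_eq_zero {φ : M → ℝ} {e : OpenPartialHomeomorph M (Model n)} {z : Model n}
    (hz : z ∈ e.target) (h : e.symm z ∉ tsupport φ) : ddbar φ e z = 0 := by
  have h1 : localExpr φ e =ᶠ[𝓝 z] fun _ => 0 := by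
    have hc : ContinuousAt e.symm z := e.continuousAt_symm hz
    filter_upwards [hc.preimage_mem_nhds ((isClosed_tsupport φ).isOpen_compl.mem_nhds h)]
      with w hw using localExpr_eq_zero hw
  rw [ddbar, complexHessian_congr h1]
  exact complexHessian_eq_zero_of_notMem isClosed_empty (fun _ _ => rfl) (notMem_empty z)

lemma complexHessian_chartExtension {z : Model n} (hz : z ∈ e.target) :
    complexHessian (chartExtension e φ) z = ddbar φ e z := by
  refine complexHessian_congr ?_
  filter_upwards [e.open_target.mem_nhds hz] with w hw using chartExtension_apply hw

variable [CompactSpace M]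

lemma chartExtension_eq_zero {z : Model n} (hφ : tsupport φ ⊆ e.source)
    (hz : z ∉ e '' tsupport φ) : chartExtension e φ z = 0 := by
  by_cases h : z ∈ e.target
  · rw [chartExtension_apply h]
    exact localExpr_eq_zero
      ((isCompact_image_chart (isClosed_tsupport φ).isCompact hφ).2.2 z h hz)
  · exact indicator_of_notMem h _

lemma tsupport_chartExtension_subset (hφ : tsupport φ ⊆ e.source) :
    tsupport (chartExtension e φ) ⊆ e '' tsupport φ := by
  have h := (isCompact_image_chart (isClosed_tsupport φ).isCompact hφ).1.isClosed
  refine closure_minimal (fun z hz => ?_) h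
  by_contra hc
  exact hz (chartExtension_eq_zero hφ hc)

lemma hasCompactSupport_chartExtension (hφ : tsupport φ ⊆ e.source) :
    HasCompactSupport (chartExtension e φ) :=
  (isCompact_image_chart (isClosed_tsupport φ).isCompact hφ).1.of_isClosed_subset
    (isClosed_tsupport _) (tsupport_chartExtension_subset hφ)

lemma tsupport_chartExtension_subset_target (hφ : tsupport φ ⊆ e.source) :
    tsupport (chartExtension e φ) ⊆ e.target :=
  (tsupport_chartExtension_subset hφ).trans
    (isCompact_image_chart (isClosed_tsupport φ).isCompact hφ).2.1

variable [ChartedSpace (Model n) M] [IsManifold 𝓘(ℂ, Model n) ω M]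

lemma contDiff_chartExtension (he : e ∈ atlas (Model n) M) (h : IsSmooth n φ)
    (hφ : tsupport φ ⊆ e.source) : ContDiff ℝ ∞ (chartExtension e φ) := by
  rw [contDiff_iff_contDiffAt]
  intro z
  by_cases hz : z ∈ e.target
  · refine ((contDiffOn_localExpr h he).contDiffAt (e.open_target.mem_nhds hz)).congr_of_eventuallyEq
      ?_
    filter_upwards [e.open_target.mem_nhds hz] with w hw using chartExtension_apply hw
  · have hz' : z ∉ tsupport (chartExtension e φ) := fun hc =>
      hz (tsupport_chartExtension_subset_target hφ hc)
    exact contDiffAt_const.congr_of_eventuallyEq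
      (notMem_tsupport_iff_eventuallyEq.1 hz')

end ChartExtension

lemma tsupport_mul_subset_of {M : Type*} [TopologicalSpace M] {χ ψ : M → ℝ} {s : Set M}
    (h : tsupport χ ⊆ s) :
    tsupport (fun x => χ x * ψ x) ⊆ s := (tsupport_mul_subset_left).trans h

section GlobalIBP

variable {n : ℕ} {M : Type*} [TopologicalSpace M] [ChartedSpace (Model n) M]

lemma IsSmooth.mul {f g : M → ℝ} (hf : IsSmooth n f) (hg : IsSmooth n g) :
    IsSmooth n fun x => f x * g x := ContMDiff.mul hf hg

/-- Splitting a (1,1)-form slot by a finite partition of unity. -/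
lemma aeEqual_ddbar_sum {T : Finset M} {χ : M → M → ℝ} (hχ : ∀ y, ∑ x ∈ T, χ x y = 1)
    {ψ : M → ℝ} (hψ : IsC11 n ψ) (hψχ : ∀ x ∈ T, IsC11 n fun y => χ x y * ψ y) :
    AEEqual (ddbar (n := n) ψ) fun e z => ∑ x ∈ T, ddbar (fun y => χ x y * ψ y) e z := by
  have h := isPotential_sum T fun x hx => isPotential_of_isC11 (hψχ x hx)
  have e1 : (fun y => ∑ x ∈ T, χ x y * ψ y) = ψ := by
    funext y
    rw [← Finset.sum_mul, hχ, one_mul]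
  rw [e1] at h
  exact (isPotential_of_isC11 hψ).unique h

lemma IsForm.update {A : Fin n → LocalForm n M} (hA : ∀ k, IsForm (A k)) {X : LocalForm n M}
    (hX : IsForm X) (k₀ : Fin n) :
    IsDensity fun e z => WeakCSCK.wedge (Function.update (fun k => A k e z) k₀ (X e z)) := by
  have h := IsDensity.wedge (A := Function.update A k₀ X) fun k => by
    by_cases hk : k = k₀
    · subst hk; simpa using hX
    · simpa [hk] using hA k
  have e1 : (fun e z => WeakCSCK.wedge (Function.update (fun k => A k e z) k₀ (X e z))) =
      fun e z => WeakCSCK.wedge fun k => Function.update A k₀ X k e z := by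
    funext e z
    congr 1
    funext k
    by_cases hk : k = k₀
    · subst hk; simp
    · simp [hk]
  rwa [e1]

variable [CompactSpace M] [T2Space M] [IsManifold 𝓘(ℂ, Model n) ω M]

variable (n M) in
/-- A finite smooth partition of unity subordinate to charts. -/
lemma exists_smooth_partition : ∃ (T : Finset M) (χ : M → M → ℝ), (∀ x, IsSmooth n (χ x)) ∧
    (∀ x, tsupport (χ x) ⊆ (chartAt (Model n) x).source) ∧ ∀ y, ∑ x ∈ T, χ x y = 1 := by
  have := isManifold_real n M
  obtain ⟨ρ, hρ⟩ := SmoothPartitionOfUnity.exists_isSubordinate_chartAt_source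
    𝓘(ℝ, Model n) M
  obtain ⟨T, hT⟩ := exists_finset_support ρ.toPartitionOfUnity
  exact ⟨T, fun x => ρ x, fun x => (ρ x).contMDiff, hρ, sum_partition ρ.toPartitionOfUnity hT⟩

variable {u v : M → ℝ} {Hu Hv : LocalForm n M}

/-- Integration by parts against a smooth function supported in one chart. -/
lemma integral_mul_wedge_ddbar_of_tsupport (hv : IsPotential v Hv) (hu : IsPotential u Hu)
    {B : Fin n → LocalForm n M} (hB : ∀ k, IsForm (B k))
    (hBc : ∀ k, ∀ e ∈ atlas (Model n) M, ClosedFormOn (B k e) e.target) (c : Fin n → ℝ)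
    (k₀ : Fin n) {φ : M → ℝ} (hφ : IsSmooth n φ) {e : OpenPartialHomeomorph M (Model n)}
    (he : e ∈ atlas (Model n) M) (hs : tsupport φ ⊆ e.source) :
    integral (localExpr v * fun e z => wedge (Function.update
      (fun k => B k e z + c k • Hu e z) k₀ (ddbar φ e z))) =
    integral (localExpr φ * fun e z => wedge (Function.update
      (fun k => B k e z + c k • Hu e z) k₀ (Hv e z))) := by
  have hA : ∀ k, IsForm fun e z => B k e z + c k • Hu e z := fun k =>
    (hB k).add (hu.isForm.smul (c k))
  have hφp := isPotential_of_isSmooth hφ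
  have hK := (isClosed_tsupport φ).isCompact
  have hKc := isCompact_image_chart hK hs
  have hFs := tsupport_chartExtension_subset_target hs
  have hmain := WeakHess.integral_mul_wedgeC e.open_target (hv.loc e he) (hv.locForm e he)
    (hv.weak e he) (hu.loc e he) (hu.locForm e he) (hu.weak e he) (B := fun k => B k e)
    (fun k => hBc k e he) c k₀ (contDiff_chartExtension he hφ hs)
    (hasCompactSupport_chartExtension hs) hFs
  rw [integral_eq_chart ((isFun_localExpr hv.loc).mul_density (IsForm.update hA hφp.isForm k₀))
      he hK hs, integral_eq_chart ((isFun_localExpr hφp.loc).mul_density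
      (IsForm.update hA hv.isForm k₀)) he hK hs]
  · rw [integral_const_mul, integral_const_mul]
    congr 1
    have hre : ∀ {f : Model n → ℂ}, IntegrableOn f e.target →
        ∫ z in e.target, (f z).re = (∫ z in e.target, f z).re := fun hf => integral_re hf
    have hloc : ∀ X : Model n → Matrix (Fin n) (Fin n) ℂ,
        (∀ i j, LInfLoc e.target fun z => X z i j) → LInfLoc e.target fun z =>
          wedgeC (Function.update (fun k => B k e z + c k • Hu e z) k₀ (X z)) := fun X hX => by
      refine LInfLoc.wedgeC (A := fun k z => Function.update
        (fun k => B k e z + c k • Hu e z) k₀ (X z) k) fun k i j => ?_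
      by_cases hk : k = k₀
      · simpa [hk] using hX i j
      · simpa [hk] using (hA k).loc e he i j
    have hφ0 : ∀ z ∈ e.target, z ∉ e '' tsupport φ → localExpr φ e z = 0 := fun z hz hzK =>
      localExpr_eq_zero (hKc.2.2 z hz hzK)
    have i1 : IntegrableOn (fun z => (localExpr v e z : ℂ) * wedgeC (Function.update
        (fun k => B k e z + c k • Hu e z) k₀ (ddbar φ e z))) e.target := by
      refine ((hv.loc e he).ofReal.mul (hloc _ (hφp.locForm e he))).integrableOn_of_zero_off
        e.open_target hKc.2.1 hKc.1 ?_
      filter_upwards [ae_restrict_mem e.open_target.measurableSet] with z hz hzK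
      rw [ddbar_eq_zero hz (hKc.2.2 z hz hzK), wedgeC_update_zero, mul_zero]
    have i2 : IntegrableOn (fun z => (localExpr φ e z : ℂ) * wedgeC (Function.update
        (fun k => B k e z + c k • Hu e z) k₀ (Hv e z))) e.target := by
      refine ((hφp.loc e he).ofReal.mul (hloc _ (hv.locForm e he))).integrableOn_of_zero_off
        e.open_target hKc.2.1 hKc.1 ?_
      filter_upwards [ae_restrict_mem e.open_target.measurableSet] with z hz hzK
      rw [hφ0 z hz hzK, Complex.ofReal_zero, zero_mul]
    have e1 := hre i1
    have e2 := hre i2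
    simp only [Complex.re_ofReal_mul, ← wedge_eq_re_wedgeC] at e1 e2
    simp only [Pi.mul_apply]
    rw [e1, e2]
    congr 1
    have m1 : ∫ z in e.target, (localExpr v e z : ℂ) * wedgeC (Function.update
        (fun k => B k e z + c k • Hu e z) k₀ (ddbar φ e z)) =
        ∫ z in e.target, (localExpr v e z : ℂ) * wedgeC (Function.update
        (fun k => B k e z + c k • Hu e z) k₀ (complexHessian (chartExtension e φ) z)) :=
      setIntegral_congr_fun e.open_target.measurableSet fun z hz => by
        simp only [complexHessian_chartExtension hz]
    have m2 : ∫ z in e.target, (localExpr φ e z : ℂ) * wedgeC (Function.update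
        (fun k => B k e z + c k • Hu e z) k₀ (Hv e z)) =
        ∫ z in e.target, (chartExtension e φ z : ℂ) * wedgeC (Function.update
        (fun k => B k e z + c k • Hu e z) k₀ (Hv e z)) :=
      setIntegral_congr_fun e.open_target.measurableSet fun z hz => by
        simp only [chartExtension_apply hz]
    rw [m1, m2]
    exact hmain
  · refine fun e' _ => Eventually.of_forall fun z _ hzK => ?_
    rw [Pi.mul_apply, Pi.mul_apply, localExpr_eq_zero hzK, zero_mul]
  · refine fun e' _ => Eventually.of_forall fun z hz hzK => ?_
    rw [Pi.mul_apply, Pi.mul_apply, ddbar_eq_zero hz hzK, wedge_update_zero, mul_zero]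

/-- **Integration by parts** for wedge products of closed forms of the shape `B + c √-1 ∂∂̄u` with
`B` smooth and `u` of bounded complex Hessian. -/
lemma integral_mul_wedge_ddbar (hv : IsPotential v Hv) (hu : IsPotential u Hu)
    {B : Fin n → LocalForm n M} (hB : ∀ k, IsForm (B k))
    (hBc : ∀ k, ∀ e ∈ atlas (Model n) M, ClosedFormOn (B k e) e.target) (c : Fin n → ℝ)
    (k₀ : Fin n) {ψ : M → ℝ} (hψ : IsSmooth n ψ) :
    integral (localExpr v * fun e z => wedge (Function.update
      (fun k => B k e z + c k • Hu e z) k₀ (ddbar ψ e z))) =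
    integral (localExpr ψ * fun e z => wedge (Function.update
      (fun k => B k e z + c k • Hu e z) k₀ (Hv e z))) := by
  obtain ⟨T, χ, hχ, hχs, hχ1⟩ := exists_smooth_partition n M
  have hA : ∀ k, IsForm fun e z => B k e z + c k • Hu e z := fun k =>
    (hB k).add (hu.isForm.smul (c k))
  have hsm : ∀ x, IsSmooth n fun y => χ x y * ψ y := fun x => (hχ x).mul hψ
  have h1 : integral (localExpr v * fun e z => wedge (Function.update
      (fun k => B k e z + c k • Hu e z) k₀ (ddbar ψ e z))) =
      integral (∑ x ∈ T, localExpr v * fun e z => wedge (Function.update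
      (fun k => B k e z + c k • Hu e z) k₀ (ddbar (fun y => χ x y * ψ y) e z))) := by
    refine integral_congr fun e he => ?_
    filter_upwards [aeEqual_ddbar_sum hχ1 (isC11_of_isSmooth hψ)
      (fun x _ => isC11_of_isSmooth (hsm x)) e he] with z hz
    rw [Pi.mul_apply, Pi.mul_apply, hz, wedge_update_sum, Finset.mul_sum, Finset.sum_apply,
      Finset.sum_apply]
    rfl
  have h2 : (localExpr ψ * fun e z => wedge (Function.update
      (fun k => B k e z + c k • Hu e z) k₀ (Hv e z))) =
      ∑ x ∈ T, localExpr (fun y => χ x y * ψ y) * fun e z => wedge (Function.update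
      (fun k => B k e z + c k • Hu e z) k₀ (Hv e z)) := by
    funext e z
    rw [Finset.sum_apply, Finset.sum_apply]
    simp only [Pi.mul_apply, localExpr]
    rw [← Finset.sum_mul, ← Finset.sum_mul, hχ1, one_mul]
  rw [h1, h2, integral_sum, integral_sum]
  · exact Finset.sum_congr rfl fun x _ => integral_mul_wedge_ddbar_of_tsupport hv hu hB hBc c k₀
      (hsm x) (chart_mem_atlas (Model n) x) (tsupport_mul_subset_of (hχs x))
  · exact fun x _ => ((isPotential_of_isSmooth (hsm x)).loc).mul
      (IsForm.update hA hv.isForm k₀).loc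
  · exact fun x _ => hv.loc.mul
      (IsForm.update hA (isPotential_of_isSmooth (hsm x)).isForm k₀).loc

end GlobalIBP

/-! ### The space of bounded Kähler metrics -/

section HwPlus

variable {n : ℕ} {M : Type*} [TopologicalSpace M] [ChartedSpace (Model n) M]

lemma LInfLoc.of_ae_bound {E : Type*} [NormedAddCommGroup E] {U : Set (Model n)} {f : Model n → E}
    (hf : ∀ K ⊆ U, IsCompact K → AEStronglyMeasurable f (volume.restrict K))
    (hb : ∀ K ⊆ U, IsCompact K → ∃ C : ℝ, ∀ᵐ z ∂(volume.restrict K), ‖f z‖ ≤ C) :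
    LInfLoc U f := fun K hK hc => by
  obtain ⟨C, hC⟩ := hb K hK hc
  exact memLp_top_of_bound (hf K hK hc) C hC

variable {ω₀ : KahlerMetric n M} {u ψ : M → ℝ}

/-- The definition of `HwPlus` bounds `∂∂̄u` by multiples of the metric as a Hermitian form; over a
compact subset of a chart this bounds its entries. -/
lemma isPotential_of_mem_HwPlus (hu : u ∈ HwPlus ω₀) : IsPotential u (weakDdbar (n := n) u) := by
  obtain ⟨hm, ⟨C, hC⟩, hw, ⟨L, hL⟩, -⟩ := hu
  refine ⟨fun e he => LInfLoc.of_ae_bound (fun K hK _ => (hm e he).mono_set hK) fun K hK _ =>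
    ⟨C, ae_restrict_of_ae_restrict_of_subset hK (hC e he)⟩, fun e he i j => ?_,
    fun e he => hw e he⟩
  refine LInfLoc.of_ae_bound (fun K hK hc => ?_) fun K hK hc => ?_
  · exact (((hw e he i j).1).integrableOn_compact_subset hK hc).aestronglyMeasurable
  · obtain ⟨D, -, hD⟩ := exists_bound_entries hc
      fun i j => (ω₀.continuousOn_coeff he i j).mono hK
    refine ⟨5 * |L| * D, ?_⟩
    filter_upwards [ae_restrict_of_ae_restrict_of_subset hK (hL e he),
      ae_restrict_mem hc.measurableSet] with z hz hzK
    exact norm_apply_le_of_sandwich hz.1 hz.2 (hD z hzK) i j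

lemma isForm_perturbed [IsManifold 𝓘(ℂ, Model n) ω M] (hu : u ∈ HwPlus ω₀) :
    IsForm (perturbed ω₀ u) :=
  ω₀.isForm.add (isPotential_of_mem_HwPlus hu).isForm

/-- On a compact subset of a chart, a continuous Hermitian form is bounded by a multiple of the
metric. -/
lemma exists_bound_on_compact {K : Set (Model n)} (hK : IsCompact K)
    {G H : Model n → Matrix (Fin n) (Fin n) ℂ} (hGc : ∀ i j, ContinuousOn (fun z => G z i j) K)
    (hG : ∀ z ∈ K, (G z).PosDef) (hHc : ∀ i j, ContinuousOn (fun z => H z i j) K)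
    (hH : ∀ z ∈ K, (H z).IsHermitian) :
    ∃ L : ℝ, 0 ≤ L ∧ ∀ z ∈ K, (L • G z - H z).PosSemidef ∧ (L • G z + H z).PosSemidef := by
  obtain ⟨m, hm, hGm⟩ := exists_pos_lower_bound hK hGc hG
  obtain ⟨D, hD0, hD⟩ := exists_bound_entries hK hHc
  have hL : 0 ≤ n * D / m := by positivity
  refine ⟨n * D / m, hL, fun z hz => ?_⟩
  have h1 := (hGm z hz).real_smul hL
  have e1 : (n * D / m) • (G z - m • (1 : Matrix (Fin n) (Fin n) ℂ)) =
      (n * D / m) • G z - (n * D) • (1 : Matrix (Fin n) (Fin n) ℂ) := by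
    rw [smul_sub, smul_smul, div_mul_cancel₀ _ hm.ne']
  rw [e1] at h1
  have h2 := h1.add (posSemidef_of_norm_apply_le (hH z hz) (hD z hz))
  have h3 := h1.add (posSemidef_of_norm_apply_le (H := -H z) (hH z hz).neg
    (by simpa using hD z hz))
  refine ⟨?_, ?_⟩
  · convert h3 using 1; abel
  · convert h2 using 1; abel

/-- By compactness, the complex Hessian of a smooth function is bounded by a multiple of the Kähler
metric. -/
lemma exists_bound_ddbar [CompactSpace M] [IsManifold 𝓘(ℂ, Model n) ω M] (ω₀ : KahlerMetric n M)
    (hψ : IsSmooth n ψ) : ∃ L : ℝ, 0 ≤ L ∧ ∀ e ∈ atlas (Model n) M, ∀ z ∈ e.target,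
      (L • ω₀.coeff e z - ddbar ψ e z).PosSemidef ∧
      (L • ω₀.coeff e z + ddbar ψ e z).PosSemidef := by
  have key : ∃ L : ℝ, 0 ≤ L ∧ ∀ y ∈ (univ : Set M), ∀ e ∈ atlas (Model n) M, ∀ z ∈ e.target,
      e.symm z = y → (L • ω₀.coeff e z - ddbar ψ e z).PosSemidef ∧
      (L • ω₀.coeff e z + ddbar ψ e z).PosSemidef := by
    refine isCompact_univ.induction_on (p := fun s : Set M => ∃ L : ℝ, 0 ≤ L ∧ ∀ y ∈ s,
      ∀ e ∈ atlas (Model n) M, ∀ z ∈ e.target,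
      e.symm z = y → (L • ω₀.coeff e z - ddbar ψ e z).PosSemidef ∧
      (L • ω₀.coeff e z + ddbar ψ e z).PosSemidef) ⟨0, le_rfl, fun y hy => absurd hy (notMem_empty y)⟩
      (fun s t hst ⟨L, h0, h⟩ => ⟨L, h0, fun y hy => h y (hst hy)⟩) ?_ ?_
    · rintro s t ⟨L, h0, h⟩ ⟨L', h0', h'⟩
      have hadd : ∀ e ∈ atlas (Model n) M, ∀ z ∈ e.target, ∀ {a b : ℝ}, 0 ≤ b →
          ((a • ω₀.coeff e z - ddbar ψ e z).PosSemidef ∧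
          (a • ω₀.coeff e z + ddbar ψ e z).PosSemidef) →
          (((a + b) • ω₀.coeff e z - ddbar ψ e z).PosSemidef ∧
          ((a + b) • ω₀.coeff e z + ddbar ψ e z).PosSemidef) := by
        intro e he z hz a b hb hab
        have hg := (ω₀.posDef e he z hz).posSemidef.real_smul hb
        have h1 := hab.1.add hg
        have h2 := hab.2.add hg
        constructor
        · convert h1 using 1; rw [add_smul]; abel
        · convert h2 using 1; rw [add_smul]; abel
      refine ⟨L + L', add_nonneg h0 h0', fun y hy e he z hz hzy => ?_⟩
      rcases hy with hy | hy
      · exact hadd e he z hz h0' (h y hy e he z hz hzy)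
      · rw [add_comm L]
        exact hadd e he z hz h0 (h' y hy e he z hz hzy)
    · intro x _
      set e₀ := chartAt (Model n) x with he₀
      have hea : e₀ ∈ atlas (Model n) M := chart_mem_atlas (Model n) x
      have hx : e₀ x ∈ e₀.target := e₀.map_source (mem_chart_source (Model n) x)
      obtain ⟨K, hKn, hKt, hKc⟩ := local_compact_nhds (e₀.open_target.mem_nhds hx)
      obtain ⟨L, hL0, hL⟩ := exists_bound_on_compact hKc
        (fun i j => (ω₀.continuousOn_coeff hea i j).mono hKt)
        (fun z hz => ω₀.posDef e₀ hea z (hKt hz))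
        (fun i j => (continuousOn_ddbar hψ hea i j).mono hKt)
        (fun z hz => isHermitian_ddbar hψ hea (hKt hz))
      have hW : e₀.source ∩ e₀ ⁻¹' K ∈ 𝓝 x := inter_mem
        (e₀.open_source.mem_nhds (mem_chart_source (Model n) x))
        ((e₀.continuousAt (mem_chart_source (Model n) x)).preimage_mem_nhds hKn)
      refine ⟨_, mem_nhdsWithin_of_mem_nhds hW, L, hL0, fun y hy e he z hz hzy => ?_⟩
      have hzo : z ∈ overlap e e₀ := ⟨hz, by rw [mem_preimage, hzy]; exact hy.1⟩
      have hzK : transition e e₀ z ∈ K := by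
        rw [transition, hzy]; exact hy.2
      rw [ω₀.coeff_transform he hea hzo, ddbar_transform hψ he hea hzo]
      have h1 := posSemidef_transpose_mul_mul (hL _ hzK).1 (jacobian (transition e e₀) z)
      have h2 := posSemidef_transpose_mul_mul (hL _ hzK).2 (jacobian (transition e e₀) z)
      simp only [Matrix.mul_sub, Matrix.sub_mul, Matrix.mul_add, Matrix.add_mul, Matrix.mul_smul,
        Matrix.smul_mul] at h1 h2
      exact ⟨h1, h2⟩
  obtain ⟨L, h0, hL⟩ := key
  exact ⟨L, h0, fun e he z hz => hL _ (mem_univ _) e he z hz rfl⟩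

/-- `ω_{u + tψ} = ω_u + t √-1 ∂∂̄ψ` almost everywhere. -/
lemma perturbed_add_smul (ω₀ : KahlerMetric n M) {H : LocalForm n M}
    (hu : IsPotential u (weakDdbar (n := n) u)) (hψ : IsPotential ψ H) (t : ℝ) :
    AEEqual (perturbed ω₀ fun x => u x + t * ψ x)
      fun e z => perturbed ω₀ u e z + t • H e z := fun e he => by
  filter_upwards [(hu.add (hψ.const_mul t)).aeEqual_weakDdbar e he] with z hz
  rw [perturbed, hz, perturbed, add_assoc]

lemma posSemidef_abs_smul {A B : Matrix (Fin n) (Fin n) ℂ}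
    (h : (A - B).PosSemidef ∧ (A + B).PosSemidef) (t : ℝ) :
    (|t| • A - t • B).PosSemidef ∧ (|t| • A + t • B).PosSemidef := by
  have h1 := h.1.real_smul (abs_nonneg t)
  have h2 := h.2.real_smul (abs_nonneg t)
  rw [smul_sub] at h1
  rw [smul_add] at h2
  rcases abs_cases t with ⟨ht, -⟩ | ⟨ht, -⟩
  · rw [ht] at h1 h2 ⊢; exact ⟨h1, h2⟩
  · rw [ht] at h1 h2 ⊢
    refine ⟨?_, ?_⟩
    · convert h2 using 1; rw [neg_smul t B]; abel
    · convert h1 using 1; rw [neg_smul t B]; abel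

/-- Along a short segment `u + tψ` the forms `ω_u + t √-1 ∂∂̄ψ` are uniformly positive. -/
lemma exists_uniform_pos [CompactSpace M] [IsManifold 𝓘(ℂ, Model n) ω M] (hu : u ∈ HwPlus ω₀)
    (hψ : IsSmooth n ψ) : ∃ δ η : ℝ, 0 < δ ∧ 0 < η ∧ ∀ e ∈ atlas (Model n) M,
      ∀ᵐ z ∂(volume.restrict e.target), ∀ t : ℝ, |t| < δ →
        (perturbed ω₀ u e z + t • ddbar ψ e z - η • ω₀.coeff e z).PosSemidef := by
  obtain ⟨L, hL0, hL⟩ := exists_bound_ddbar ω₀ hψ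
  obtain ⟨ε, hε, hpos⟩ := hu.2.2.2.2
  -- half of the lower bound `ω_u ≥ ε ω` absorbs `t √-1 ∂∂̄ψ ≥ -|t| L ω`
  refine ⟨ε / 2 / (L + 1), ε / 2, by positivity, by positivity, fun e he => ?_⟩
  filter_upwards [hpos e he, ae_restrict_mem e.open_target.measurableSet] with z hz hzt t ht
  have h1 : |t| * L ≤ ε / 2 := by
    rw [lt_div_iff₀ (by positivity)] at ht
    nlinarith [abs_nonneg t]
  have h2 := (posSemidef_abs_smul (hL e he z hzt) t).2
  have h3 := (ω₀.posDef e he z hzt).posSemidef.real_smul (sub_nonneg.2 h1)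
  convert (hz.add h2).add h3 using 1
  rw [sub_smul, smul_smul]
  have : ε • ω₀.coeff e z = (ε / 2) • ω₀.coeff e z + (ε / 2) • ω₀.coeff e z := by
    rw [← add_smul, add_halves]
  rw [this]; abel

lemma add_smul_mem_HwPlus [CompactSpace M] [IsManifold 𝓘(ℂ, Model n) ω M] (hu : u ∈ HwPlus ω₀)
    (hψ : IsSmooth n ψ) : ∃ δ > 0, ∀ t : ℝ, |t| < δ → (fun x => u x + t * ψ x) ∈ HwPlus ω₀ := by
  obtain ⟨δ, η, hδ, hη, hpos⟩ := exists_uniform_pos hu hψ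
  obtain ⟨L, hL0, hL⟩ := exists_bound_ddbar ω₀ hψ
  have hup := isPotential_of_mem_HwPlus hu
  have hψp := isPotential_of_isSmooth hψ
  obtain ⟨hm, ⟨C, hC⟩, hw, ⟨L', hL'⟩, -⟩ := hu
  refine ⟨δ, hδ, fun t ht => ?_⟩
  have hp := hup.add (hψp.const_mul t)
  have hae := hp.aeEqual_weakDdbar
  refine ⟨fun e he => ?_, ?_, fun e he => isWeakDdbar_weakDdbar (hp.weak e he),
    ⟨L' + |t| * L, fun e he => ?_⟩, η, hη, fun e he => ?_⟩
  · have h1 : AEStronglyMeasurable (fun z => localExpr u e z + t * localExpr ψ e z)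
        (volume.restrict e.target) := (hm e he).add
      (((contDiffOn_localExpr hψ he).continuousOn.aestronglyMeasurable
        e.open_target.measurableSet).const_mul t)
    exact h1
  · have hcont : Continuous ψ := ContMDiff.continuous hψ
    obtain ⟨D, hD⟩ := isCompact_univ.exists_bound_of_continuousOn hcont.continuousOn
    refine ⟨C + |t| * D, fun e he => ?_⟩
    filter_upwards [hC e he] with z hz
    refine (abs_add_le _ _).trans (add_le_add hz ?_)
    rw [abs_mul]
    exact mul_le_mul_of_nonneg_left (hD _ (mem_univ _)) (abs_nonneg t)
  · filter_upwards [hL' e he, hae e he, ae_restrict_mem e.open_target.measurableSet]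
      with z h1 h2 hzt
    have h3 := posSemidef_abs_smul (hL e he z hzt) t
    rw [h2]
    refine ⟨?_, ?_⟩
    · convert h1.1.add h3.1 using 1
      rw [add_smul, smul_smul]; abel
    · convert h1.2.add h3.2 using 1
      rw [add_smul, smul_smul]; abel
  · filter_upwards [hpos e he, perturbed_add_smul ω₀ hup hψp t e he] with z h1 h2
    rw [h2]
    exact h1 t ht

end HwPlus

/-! ### Differentiation of integrals of wedge products -/

section Derivative

variable {n : ℕ} {M : Type*} [TopologicalSpace M] [ChartedSpace (Model n) M]

lemma abs_wedge_le {A : Fin n → Matrix (Fin n) (Fin n) ℂ} {D : ℝ} (h : ∀ k i j, ‖A k i j‖ ≤ D) :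
    |wedge A| ≤ (Fintype.card (Equiv.Perm (Fin n)) : ℝ) *
      ((Fintype.card (Equiv.Perm (Fin n)) : ℝ) * D ^ n) :=
  (Complex.abs_re_le_norm _).trans (norm_wedgeC_le h)

lemma norm_update_le {A : Fin n → Matrix (Fin n) (Fin n) ℂ} {X : Matrix (Fin n) (Fin n) ℂ} {D : ℝ}
    (h : ∀ k i j, ‖A k i j‖ ≤ D) (hX : ∀ i j, ‖X i j‖ ≤ D) (m k i j : Fin n) :
    ‖Function.update A m X k i j‖ ≤ D := by
  by_cases hk : k = m
  · subst hk; simpa using hX i j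
  · simpa [hk] using h k i j

lemma IsLocForm.exists_bound {A : LocalForm n M} (hA : IsLocForm A)
    {e : OpenPartialHomeomorph M (Model n)} (he : e ∈ atlas (Model n) M) {K : Set (Model n)}
    (hK : K ⊆ e.target) (hc : IsCompact K) :
    ∃ D : ℝ, 0 ≤ D ∧ ∀ᵐ z ∂(volume.restrict K), ∀ i j, ‖A e z i j‖ ≤ D := by
  choose D hD0 hD using fun i j => (hA e he i j).exists_bound hK hc
  refine ⟨∑ i, ∑ j, D i j, Finset.sum_nonneg fun i _ => Finset.sum_nonneg fun j _ => hD0 i j, ?_⟩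
  have h : ∀ᵐ z ∂(volume.restrict K), ∀ i j, ‖A e z i j‖ ≤ D i j :=
    ae_all_iff.2 fun i => ae_all_iff.2 fun j => hD i j
  filter_upwards [h] with z hz i j
  refine (hz i j).trans ((Finset.single_le_sum (f := fun j => D i j) (fun j _ => hD0 i j)
    (Finset.mem_univ j)).trans (Finset.single_le_sum (f := fun i => ∑ j, D i j)
    (fun i _ => Finset.sum_nonneg fun j _ => hD0 i j) (Finset.mem_univ i)))

lemma exists_bound_family {A : Fin n → LocalForm n M} (hA : ∀ k, IsLocForm (A k))
    {e : OpenPartialHomeomorph M (Model n)} (he : e ∈ atlas (Model n) M) {K : Set (Model n)}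
    (hK : K ⊆ e.target) (hc : IsCompact K) :
    ∃ D : ℝ, 0 ≤ D ∧ ∀ᵐ z ∂(volume.restrict K), ∀ k i j, ‖A k e z i j‖ ≤ D := by
  choose D hD0 hD using fun k => (hA k).exists_bound he hK hc
  refine ⟨∑ k, D k, Finset.sum_nonneg fun k _ => hD0 k, ?_⟩
  filter_upwards [ae_all_iff.2 hD] with z hz k i j
  exact (hz k i j).trans (Finset.single_le_sum (f := fun k => D k) (fun k _ => hD0 k)
    (Finset.mem_univ k))

lemma norm_add_smul_le {A B : Matrix (Fin n) (Fin n) ℂ} {D D' t : ℝ} (hA : ∀ i j, ‖A i j‖ ≤ D)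
    (hB : ∀ i j, ‖B i j‖ ≤ D') (ht : |t| ≤ 1) (i j : Fin n) :
    ‖(A + t • B) i j‖ ≤ D + D' := by
  rw [Matrix.add_apply, Matrix.smul_apply]
  refine (norm_add_le _ _).trans (add_le_add (hA i j) ?_)
  rw [norm_smul, Real.norm_eq_abs]
  calc |t| * ‖B i j‖ ≤ 1 * D' := mul_le_mul ht (hB i j) (norm_nonneg _) zero_le_one
    _ = D' := one_mul _

lemma IsLocForm.add_smul {A B : LocalForm n M} (hA : IsLocForm A) (hB : IsLocForm B) (t : ℝ) :
    IsLocForm fun e z => A e z + t • B e z := fun e he i j => by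
  have : (fun z => (A e z + t • B e z) i j) = fun z => A e z i j + (t : ℂ) * B e z i j := by
    funext z; simp
  rw [this]
  exact (hA e he i j).add ((LInfLoc.const _).mul (hB e he i j))

lemma IsLoc.wedge_update {A : Fin n → LocalForm n M} (hA : ∀ k, IsLocForm (A k))
    {X : LocalForm n M} (hX : IsLocForm X) (m : Fin n) :
    IsLoc fun e z => WeakCSCK.wedge (Function.update (fun k => A k e z) m (X e z)) := by
  have e1 : (fun e z => WeakCSCK.wedge (Function.update (fun k => A k e z) m (X e z))) =
      fun e z => WeakCSCK.wedge fun k => Function.update A m X k e z := by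
    funext e z
    congr 1
    funext k
    by_cases hk : k = m
    · subst hk; simp
    · simp [hk]
  rw [e1]
  refine IsLoc.wedge fun k => ?_
  by_cases hk : k = m
  · subst hk; simpa using hX
  · simpa [hk] using hA k

variable [CompactSpace M] [T2Space M]

lemma hasDerivAt_integral_mul_wedge {v w : LocalFun n M} (hv : IsLoc v) (hw : IsLoc w)
    {A B : Fin n → LocalForm n M} (hA : ∀ k, IsLocForm (A k)) (hB : ∀ k, IsLocForm (B k)) :
    HasDerivAt (fun t : ℝ => integral fun e z => (v e z + t * w e z) *
        wedge fun k => A k e z + t • B k e z)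
      (integral (w * fun e z => wedge fun k => A k e z) + ∑ m, integral (v * fun e z =>
        wedge (Function.update (fun k => A k e z) m (B m e z)))) 0 := by
  have hAB : ∀ t k, IsLocForm fun e z => A k e z + t • B k e z := fun t k =>
    (hA k).add_smul (hB k) t
  have hvw : ∀ t : ℝ, IsLoc fun e z => v e z + t * w e z := fun t => hv.add (hw.const_smul t)
  have hsum : ∀ t : ℝ, IsLoc (∑ m, fun e z => wedge (Function.update
      (fun k => A k e z + t • B k e z) m (B m e z)) : LocalFun n M) := fun t =>
    IsLoc.sum fun m _ => IsLoc.wedge_update (hAB t) (hB m) m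
  have hsum' : ∀ (t : ℝ) (e : OpenPartialHomeomorph M (Model n)) (z : Model n),
      (∑ m, fun e z => wedge (Function.update (fun k => A k e z + t • B k e z) m (B m e z)) :
        LocalFun n M) e z = ∑ m, wedge (Function.update (fun k => A k e z + t • B k e z) m
        (B m e z)) := fun t e z => by
    rw [Finset.sum_apply, Finset.sum_apply]
  have key := hasDerivAt_integral (F := fun t => fun e z => (v e z + t * w e z) *
      wedge fun k => A k e z + t • B k e z)
    (F' := fun t => (w * fun e z => wedge fun k => A k e z + t • B k e z) +
      (fun e z => v e z + t * w e z) * ∑ m, fun e z => wedge (Function.update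
        (fun k => A k e z + t • B k e z) m (B m e z))) one_pos
    (fun t _ => (hvw t).mul (IsLoc.wedge (hAB t)))
    ((hw.mul (IsLoc.wedge (hAB 0))).add ((hvw 0).mul (hsum 0))) ?_ ?_
  · convert key using 1
    simp only [zero_smul, add_zero, zero_mul]
    rw [integral_add' (hw.mul (IsLoc.wedge hA)) (hv.mul (IsLoc.sum fun m _ =>
      IsLoc.wedge_update hA (hB m) m)), Finset.mul_sum, integral_sum _ fun m _ =>
      hv.mul (IsLoc.wedge_update hA (hB m) m)]
  · intro e he K hK hc
    obtain ⟨D, hD0, hD⟩ := exists_bound_family hA he hK hc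
    obtain ⟨D', -, hD'⟩ := exists_bound_family hB he hK hc
    obtain ⟨a, ha0, ha⟩ := (hv e he).exists_bound hK hc
    obtain ⟨b, hb0, hb⟩ := (hw e he).exists_bound hK hc
    set W : ℝ := (Fintype.card (Equiv.Perm (Fin n)) : ℝ) *
      ((Fintype.card (Equiv.Perm (Fin n)) : ℝ) * (D + D') ^ n) with hW
    refine ⟨b * W + (a + b) * ∑ _m : Fin n, W, ?_⟩
    filter_upwards [hD, hD', ha, hb] with z h1 h2 h3 h4 t ht
    have hent : ∀ k i j, ‖(A k e z + t • B k e z) i j‖ ≤ D + D' := fun k =>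
      norm_add_smul_le (h1 k) (h2 k) ht.le
    have w1 : |wedge fun k => A k e z + t • B k e z| ≤ W := abs_wedge_le hent
    have w2 : ∀ m, |wedge (Function.update (fun k => A k e z + t • B k e z) m (B m e z))| ≤ W :=
      fun m => abs_wedge_le (norm_update_le hent (fun i j =>
        (h2 m i j).trans (le_add_of_nonneg_left hD0)) m)
    have hW0 : 0 ≤ W := (abs_nonneg _).trans w1
    simp only [Pi.add_apply, Pi.mul_apply]
    rw [hsum']
    refine (abs_add_le _ _).trans (add_le_add ?_ ?_)
    · rw [abs_mul]; exact mul_le_mul h4 w1 (abs_nonneg _) hb0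
    · rw [abs_mul]
      refine mul_le_mul ?_ ((Finset.abs_sum_le_sum_abs _ _).trans
        (Finset.sum_le_sum fun m _ => w2 m)) (abs_nonneg _) (add_nonneg ha0 hb0)
      refine (abs_add_le _ _).trans (add_le_add h3 ?_)
      rw [abs_mul]
      calc |t| * |w e z| ≤ 1 * b := mul_le_mul ht.le h4 (abs_nonneg _) zero_le_one
        _ = b := one_mul b
  · refine fun e _ => Eventually.of_forall fun z t _ => ?_
    simp only [Pi.add_apply, Pi.mul_apply]
    rw [hsum']
    have d1 : HasDerivAt (fun t : ℝ => v e z + t * w e z) (w e z) t := by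
      simpa using ((hasDerivAt_id t).mul_const (w e z)).const_add (v e z)
    exact d1.mul (hasDerivAt_wedge (fun k => A k e z) (fun k => B k e z) t)

end Derivative

/-! ### The first variation of the energies -/

section Energy

/-- The (n,n)-form with the factor `G` in the slots of `s` and `B k` in the other slots `k`. -/
noncomputable def slotPow {n : ℕ} {M : Type*} [TopologicalSpace M] (G : LocalForm n M)
    (B : Fin n → LocalForm n M) (s : Finset (Fin n)) : LocalFun n M :=
  fun e z => wedge fun k => if k ∈ s then G e z else B k e z

lemma slotPow_erase_congr {n : ℕ} {M : Type*} [TopologicalSpace M] {G : LocalForm n M}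
    {B : Fin n → LocalForm n M} {s : Finset (Fin n)} {m m' : Fin n} (hm : m ∈ s) (hm' : m' ∈ s)
    (h : B m = B m') :
    slotPow G B (s.erase m) = slotPow G B (s.erase m') := by
  have key : ∀ {a}, a ∈ s → slotPow G B (s.erase a) = fun e z => wedge (Function.update
      (fun k => if k ∈ s then G e z else B k e z) a (B a e z)) := by
    intro a ha
    funext e z
    rw [slotPow]
    congr 1
    funext k
    by_cases hk : k = a
    · subst hk; simp
    · simp [hk]
  rw [key hm, key hm', h]
  funext e z
  exact wedge_update_swap _ m m' _ (by simp [hm, hm'])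

variable {n : ℕ} {M : Type*} [TopologicalSpace M] [ChartedSpace (Model n) M]

variable [CompactSpace M] [T2Space M] [IsManifold 𝓘(ℂ, Model n) ω M]
  {ω₀ : KahlerMetric n M} {u ψ : M → ℝ}

/-- The derivative of `∫ u α` along `u + tψ`, where `α` is a wedge product with the factor `ω_u` in
the slots of `s`. Integration by parts moves `√-1 ∂∂̄` from `ψ` to `u`, and
`√-1 ∂∂̄u = ω_u - ω`. -/
lemma hasDerivAt_integral_slotPow (hu : u ∈ HwPlus ω₀) (hψ : IsSmooth n ψ)
    {B : Fin n → LocalForm n M} (hB : ∀ k, IsForm (B k))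
    (hBc : ∀ k, ∀ e ∈ atlas (Model n) M, ClosedFormOn (B k e) e.target) {s : Finset (Fin n)}
    (hs : ∀ m ∈ s, B m = ω₀.coeff) :
    HasDerivAt (fun t : ℝ => integral (localExpr (fun x => u x + t * ψ x) *
        slotPow (perturbed ω₀ fun x => u x + t * ψ x) B s))
      (integral (localExpr ψ * slotPow (perturbed ω₀ u) B s) +
        ∑ m ∈ s, (integral (localExpr ψ * slotPow (perturbed ω₀ u) B s) -
          integral (localExpr ψ * slotPow (perturbed ω₀ u) B (s.erase m)))) 0 := by
  classical
  have hup := isPotential_of_mem_HwPlus hu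
  have hψp := isPotential_of_isSmooth hψ
  have hG := isForm_perturbed hu
  set A : Fin n → LocalForm n M := fun k => if k ∈ s then perturbed ω₀ u else B k with hA
  set X : Fin n → LocalForm n M := fun k => if k ∈ s then ddbar ψ else fun _ _ => 0 with hX
  have hAf : ∀ k, IsForm (A k) := fun k => by
    by_cases hk : k ∈ s
    · simpa [hA, hk] using hG
    · simpa [hA, hk] using hB k
  have hXf : ∀ k, IsForm (X k) := fun k => by
    by_cases hk : k ∈ s
    · simpa [hX, hk] using hψp.isForm
    · simpa [hX, hk] using IsForm.zero
  have hmain := hasDerivAt_integral_mul_wedge hup.loc hψp.loc (fun k => (hAf k).loc)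
    (fun k => (hXf k).loc)
  have hfun : ∀ t : ℝ, integral (localExpr (fun x => u x + t * ψ x) *
      slotPow (perturbed ω₀ fun x => u x + t * ψ x) B s) = integral (fun e z =>
      (localExpr u e z + t * localExpr ψ e z) * wedge fun k => A k e z + t • X k e z) := by
    refine fun t => integral_congr fun e he => ?_
    filter_upwards [perturbed_add_smul ω₀ hup hψp t e he] with z hz
    rw [Pi.mul_apply, Pi.mul_apply, slotPow]
    congr 2
    funext k
    rw [hz]
    by_cases hk : k ∈ s
    · simp [hA, hX, hk]
    · simp [hA, hX, hk]
  have hAeq : (fun e z => wedge fun k => A k e z) = slotPow (perturbed ω₀ u) B s := by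
    funext e z
    rw [slotPow]
    congr 1
    funext k
    by_cases hk : k ∈ s
    · simp [hA, hk]
    · simp [hA, hk]
  have hterm : ∀ m, integral (localExpr u * fun e z =>
      wedge (Function.update (fun k => A k e z) m (X m e z))) = if m ∈ s then
        integral (localExpr ψ * slotPow (perturbed ω₀ u) B s) -
          integral (localExpr ψ * slotPow (perturbed ω₀ u) B (s.erase m)) else 0 := by
    intro m
    by_cases hm : m ∈ s
    · have hibp := integral_mul_wedge_ddbar hup hup hB hBc (fun k => if k ∈ s then 1 else 0) m hψ
      have e1 : ∀ e z, (fun k => B k e z + (if k ∈ s then (1 : ℝ) else 0) • weakDdbar u e z) =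
          fun k => A k e z := by
        intro e z
        funext k
        by_cases hk : k ∈ s
        · simp [hA, hk, perturbed, hs k hk]
        · simp [hA, hk]
      simp only [e1] at hibp
      rw [if_pos hm, ← integral_sub']
      · simp only [hX, hm, if_true]
        rw [hibp]
        congr 1
        funext e z
        have e2 : weakDdbar u e z = perturbed ω₀ u e z - ω₀.coeff e z := by
          rw [perturbed, add_sub_cancel_left]
        rw [Pi.mul_apply, Pi.mul_apply, e2, wedge_update_sub, Pi.sub_apply, Pi.sub_apply,
          Pi.mul_apply, Pi.mul_apply, Pi.mul_apply, Pi.mul_apply, mul_sub, slotPow, slotPow]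
        congr 3
        · funext k
          by_cases hk : k = m
          · subst hk; simp [hm]
          · by_cases hks : k ∈ s
            · simp [hA, hk, hks]
            · simp [hA, hk, hks]
        · funext k
          by_cases hk : k = m
          · subst hk; simp [hs _ hm]
          · by_cases hks : k ∈ s
            · simp [hA, hk, hks]
            · simp [hA, hk, hks]
      · rw [← hAeq]; exact hψp.loc.mul (IsLoc.wedge fun k => (hAf k).loc)
      · refine hψp.loc.mul ?_
        have e3 : slotPow (perturbed ω₀ u) B (s.erase m) = fun e z => wedge fun k =>
            (if k ∈ s.erase m then perturbed ω₀ u else B k) e z := by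
          funext e z
          rw [slotPow]
          congr 1
          funext k
          split_ifs <;> rfl
        rw [e3]
        refine IsLoc.wedge fun k => ?_
        split_ifs
        · exact hG.loc
        · exact (hB k).loc
    · rw [if_neg hm]
      have e4 : (localExpr u * fun e z =>
          wedge (Function.update (fun k => A k e z) m (X m e z))) = (0 : ℝ) • localExpr u := by
        funext e z
        simp only [hX, hm, if_false, Pi.mul_apply, Pi.smul_apply, wedge_update_zero, mul_zero,
          zero_smul]
      rw [e4, integral_smul, zero_mul]
  simp only [hfun]
  convert hmain using 1
  rw [hAeq, Finset.sum_congr rfl fun m _ => hterm m, Finset.sum_ite_mem, Finset.univ_inter]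

/-- The term `j = 0` does not see the truncated subtraction `j - 1`, since it has the factor `j`. -/
lemma sum_range_telescope (x : ℕ → ℝ) (N : ℕ) :
    ∑ j ∈ Finset.range N, (x j + j * (x j - x (j - 1))) = N * x (N - 1) := by
  induction N with
  | zero => simp
  | succ N ih =>
    rw [Finset.sum_range_succ, ih, Nat.add_sub_cancel]
    push_cast
    ring

/-- The derivative of a sum of mixed energies in which `ω_u` fills one more slot from each term to
the next. With `x j = ∫ ψ α_j`, where `α_j` is the `j`-th wedge product, the `j`-th term has
derivative `x j + j (x j - x (j - 1))`, and the sum telescopes. -/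
lemma hasDerivAt_sum_slotPow (hu : u ∈ HwPlus ω₀) (hψ : IsSmooth n ψ)
    {B : Fin n → LocalForm n M} (hB : ∀ k, IsForm (B k))
    (hBc : ∀ k, ∀ e ∈ atlas (Model n) M, ClosedFormOn (B k e) e.target) {s : ℕ → Finset (Fin n)}
    {N : ℕ} (hs : ∀ j < N, ∀ m ∈ s j, B m = ω₀.coeff) (hcard : ∀ j < N, (s j).card = j)
    (herase : ∀ j < N, 0 < j → ∃ m ∈ s j, (s j).erase m = s (j - 1)) :
    HasDerivAt (fun t : ℝ => ∑ j ∈ Finset.range N, integral (localExpr (fun x => u x + t * ψ x) *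
        slotPow (perturbed ω₀ fun x => u x + t * ψ x) B (s j)))
      (N * integral (localExpr ψ * slotPow (perturbed ω₀ u) B (s (N - 1)))) 0 := by
  rw [← sum_range_telescope fun j => integral (localExpr ψ * slotPow (perturbed ω₀ u) B (s j))]
  refine HasDerivAt.fun_sum fun j hj => ?_
  have hj' := Finset.mem_range.1 hj
  refine (hasDerivAt_integral_slotPow hu hψ hB hBc (hs j hj')).congr_deriv ?_
  congr 1
  rcases Nat.eq_zero_or_pos j with h0 | h0
  · have : s j = ∅ := Finset.card_eq_zero.1 ((hcard j hj').trans h0)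
    rw [this, h0]; simp
  · obtain ⟨m₀, hm₀, he⟩ := herase j hj' h0
    have : ∀ m ∈ s j, integral (localExpr ψ * slotPow (perturbed ω₀ u) B (s j)) -
        integral (localExpr ψ * slotPow (perturbed ω₀ u) B ((s j).erase m)) =
        integral (localExpr ψ * slotPow (perturbed ω₀ u) B (s j)) -
        integral (localExpr ψ * slotPow (perturbed ω₀ u) B (s (j - 1))) := by
      intro m hm
      rw [slotPow_erase_congr hm hm₀ ((hs j hj' m hm).trans (hs j hj' m₀ hm₀).symm), he]
    rw [Finset.sum_congr rfl this, Finset.sum_const, hcard j hj', nsmul_eq_mul]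

lemma hasDerivAt_energy (hu : u ∈ HwPlus ω₀) (hψ : IsSmooth n ψ) :
    HasDerivAt (fun t : ℝ => energy ω₀ fun x => u x + t * ψ x)
      ((n + 1) * integral (localExpr ψ * topPow (perturbed ω₀ u))) 0 := by
  set s : ℕ → Finset (Fin n) := fun j => Finset.univ.filter fun k => (k : ℕ) < j with hs
  have hmix : ∀ (G : LocalForm n M) (j : ℕ),
      mixedPow G ω₀.coeff j = slotPow G (fun _ => ω₀.coeff) (s j) := by
    intro G j
    funext e z
    simp [mixedPow, slotPow, hs]
  have htop : topPow (perturbed ω₀ u) =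
      slotPow (perturbed ω₀ u) (fun _ => ω₀.coeff) (s (n + 1 - 1)) := by
    funext e z
    simp [topPow, slotPow, hs]
  have h := hasDerivAt_sum_slotPow (N := n + 1) (s := s) hu hψ (B := fun _ => ω₀.coeff)
    (fun _ => ω₀.isForm) (fun _ e he => ω₀.closedFormOn he) (fun _ _ _ _ => rfl) ?_ ?_
  · rw [htop]
    simp only [energy, hmix]
    convert h using 2
    push_cast; rfl
  · intro j hj
    have : s j = (Finset.univ.filter fun k : Fin n => (k : ℕ) < j) := rfl
    rw [this, Fin.card_filter_val_lt]
    omega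
  · intro j hj h0
    refine ⟨⟨j - 1, by omega⟩, by simp [hs, h0], ?_⟩
    ext k
    simp only [hs, Finset.mem_erase, Finset.mem_filter, Finset.mem_univ, true_and, ne_eq, Fin.ext_iff]
    omega

/-- The Ricci form occupies the slot `0`, and `ω_u` fills the slots `1, …, j` of the `j`-th term. -/
lemma hasDerivAt_energyRic (hu : u ∈ HwPlus ω₀) (hψ : IsSmooth n ψ) :
    HasDerivAt (fun t : ℝ => energyRic ω₀ fun x => u x + t * ψ x)
      (n * integral (localExpr ψ *
        mixedPowWith (ricci ω₀) (perturbed ω₀ u) (perturbed ω₀ u) (n - 1))) 0 := by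
  set s : ℕ → Finset (Fin n) := fun j => Finset.univ.filter fun k => (k : ℕ) ≠ 0 ∧ (k : ℕ) ≤ j
    with hs
  set B : Fin n → LocalForm n M := fun k => if (k : ℕ) = 0 then ricci ω₀ else ω₀.coeff with hB
  have hmix : ∀ (G : LocalForm n M) (j : ℕ),
      mixedPowWith (ricci ω₀) G ω₀.coeff j = slotPow G B (s j) := by
    intro G j
    funext e z
    rw [mixedPowWith, slotPow]
    congr 1
    funext k
    by_cases h1 : (k : ℕ) = 0
    · simp [hs, hB, h1]
    · by_cases h2 : (k : ℕ) ≤ j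
      · simp [hs, h1, h2]
      · simp [hs, hB, h1, h2]
  have htop : mixedPowWith (ricci ω₀) (perturbed ω₀ u) (perturbed ω₀ u) (n - 1) =
      mixedPowWith (ricci ω₀) (perturbed ω₀ u) ω₀.coeff (n - 1) := by
    funext e z
    rw [mixedPowWith, mixedPowWith]
    congr 1
    funext k
    have : (k : ℕ) ≤ n - 1 := by omega
    simp [this]
  rw [htop, hmix]
  simp only [energyRic, hmix]
  refine hasDerivAt_sum_slotPow (N := n) (s := s) hu hψ (fun k => ?_) (fun k e he => ?_) ?_ ?_ ?_
  · simp only [hB]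
    split_ifs
    exacts [isForm_ricci ω₀, ω₀.isForm]
  · simp only [hB]
    split_ifs
    exacts [closedFormOn_ricci ω₀ he, ω₀.closedFormOn he]
  · intro j _ m hm
    have : (m : ℕ) ≠ 0 := (Finset.mem_filter.1 hm).2.1
    simp [hB, this]
  · intro j hj
    have : s j = ((Finset.univ.filter fun k : Fin n => (k : ℕ) < j + 1)).erase
        ⟨0, by omega⟩ := by
      ext k
      simp only [hs, Finset.mem_erase, Finset.mem_filter, Finset.mem_univ, true_and, ne_eq,
        Fin.ext_iff]
      omega
    rw [this, Finset.card_erase_of_mem (by simp), Fin.card_filter_val_lt]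
    omega
  · intro j hj h0
    refine ⟨⟨j, hj⟩, by simp [hs]; omega, ?_⟩
    ext k
    simp only [hs, Finset.mem_erase, Finset.mem_filter, Finset.mem_univ, true_and, ne_eq, Fin.ext_iff]
    omega

end Energy

/-! ### The first variation of the entropy and of the K-energy -/

section Entropy

variable {n : ℕ} {M : Type*} [TopologicalSpace M] [ChartedSpace (Model n) M]

lemma det_re_eq_wedge (A : Matrix (Fin n) (Fin n) ℂ) :
    A.det.re = (n.factorial : ℝ)⁻¹ * wedge fun _ => A := by
  rw [wedge_const, ← mul_assoc, inv_mul_cancel₀ (by positivity), one_mul]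

lemma log_det_div_det (A G : Matrix (Fin n) (Fin n) ℂ) :
    Real.log (A.det.re / G.det.re) = Real.log ((wedge fun _ => A) / wedge fun _ => G) := by
  rw [wedge_const, wedge_const, mul_div_mul_left _ _ (by positivity)]

/-- Bounds for the logarithm of the ratio of the determinants of two bounded and uniformly positive
matrices. -/
lemma exists_log_det_bound (n : ℕ) (D : ℝ) {η : ℝ} (hη : 0 < η) :
    ∃ C : ℝ, ∀ A G : Matrix (Fin n) (Fin n) ℂ, (∀ i j, ‖A i j‖ ≤ D) → (∀ i j, ‖G i j‖ ≤ D) →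
      (A - η • (1 : Matrix (Fin n) (Fin n) ℂ)).PosSemidef →
      (G - η • (1 : Matrix (Fin n) (Fin n) ℂ)).PosSemidef →
      |Real.log (A.det.re / G.det.re)| ≤ C := by
  set W : ℝ := (n.factorial : ℝ)⁻¹ * ((Fintype.card (Equiv.Perm (Fin n)) : ℝ) *
    ((Fintype.card (Equiv.Perm (Fin n)) : ℝ) * D ^ n)) with hW
  have key : ∀ A : Matrix (Fin n) (Fin n) ℂ, (∀ i j, ‖A i j‖ ≤ D) →
      (A - η • (1 : Matrix (Fin n) (Fin n) ℂ)).PosSemidef →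
      0 < A.det.re ∧ |Real.log A.det.re| ≤ |Real.log (η ^ n)| + |Real.log W| := by
    intro A hA hp
    have h1 := pow_le_det_of_posSemidef hη hp
    have h0 : 0 < η ^ n := pow_pos hη n
    have h2 : A.det.re ≤ W := by
      rw [det_re_eq_wedge, hW]
      exact mul_le_mul_of_nonneg_left ((le_abs_self _).trans (abs_wedge_le fun _ => hA))
        (by positivity)
    have h3 := Real.log_le_log h0 h1
    have h4 := Real.log_le_log (h0.trans_le h1) h2
    refine ⟨h0.trans_le h1, abs_le.2 ⟨?_, ?_⟩⟩
    · linarith [neg_abs_le (Real.log (η ^ n)), abs_nonneg (Real.log W)]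
    · linarith [le_abs_self (Real.log W), abs_nonneg (Real.log (η ^ n))]
  refine ⟨2 * (|Real.log (η ^ n)| + |Real.log W|), fun A G hA hG hAp hGp => ?_⟩
  obtain ⟨a1, a2⟩ := key A hA hAp
  obtain ⟨g1, g2⟩ := key G hG hGp
  rw [Real.log_div a1.ne' g1.ne']
  exact (abs_sub _ _).trans (by linarith)

variable {ω₀ : KahlerMetric n M} {u ψ : M → ℝ}

/-- Uniform bounds, over a compact subset of a chart, for `ω_u + t √-1 ∂∂̄ψ` and for its log volume
ratio. -/
lemma exists_bound_segment [CompactSpace M] [IsManifold 𝓘(ℂ, Model n) ω M] (hu : u ∈ HwPlus ω₀)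
    (hψ : IsSmooth n ψ) : ∃ δ : ℝ, 0 < δ ∧ δ ≤ 1 ∧ (∀ e ∈ atlas (Model n) M,
      ∀ᵐ z ∂(volume.restrict e.target), ∀ t : ℝ, |t| < δ →
        (perturbed ω₀ u e z + t • ddbar ψ e z).PosDef) ∧
      ∀ e ∈ atlas (Model n) M, ∀ K ⊆ e.target, IsCompact K → ∃ C : ℝ, 0 ≤ C ∧
      ∀ᵐ z ∂(volume.restrict K), ∀ t : ℝ, |t| < δ →
        (∀ i j, ‖(perturbed ω₀ u e z + t • ddbar ψ e z) i j‖ ≤ C) ∧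
        |Real.log ((perturbed ω₀ u e z + t • ddbar ψ e z).det.re / (ω₀.coeff e z).det.re)| ≤ C := by
  obtain ⟨δ, η, hδ, hη, hpos⟩ := exists_uniform_pos hu hψ
  refine ⟨min δ 1, by positivity, min_le_right _ _, fun e he => ?_, fun e he K hK hc => ?_⟩
  · filter_upwards [hpos e he, ae_restrict_mem e.open_target.measurableSet] with z hz hzt t ht
    have h1 := hz t (ht.trans_le (min_le_left _ _))
    have h2 : (η • ω₀.coeff e z).PosDef := (ω₀.posDef e he z hzt).smul hη
    simpa using h2.posSemidef_add h1
  · obtain ⟨m, hm, hGm⟩ := exists_pos_lower_bound hc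
      (fun i j => (ω₀.continuousOn_coeff he i j).mono hK) fun z hz => ω₀.posDef e he z (hK hz)
    obtain ⟨D₀, hD₀0, hD₀⟩ := exists_bound_entries hc
      fun i j => (ω₀.continuousOn_coeff he i j).mono hK
    obtain ⟨D₁, hD₁0, hD₁⟩ := (isForm_perturbed hu).loc.exists_bound he hK hc
    obtain ⟨D₂, hD₂0, hD₂⟩ := exists_bound_entries hc
      fun i j => (continuousOn_ddbar hψ he i j).mono hK
    set D := D₀ + (D₁ + D₂) with hD
    set η' := min m (η * m) with hη'
    have hη'0 : 0 < η' := lt_min hm (mul_pos hη hm)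
    obtain ⟨C, hC⟩ := exists_log_det_bound n D hη'0
    refine ⟨max D C, le_max_of_le_left (by positivity), ?_⟩
    filter_upwards [ae_restrict_of_ae_restrict_of_subset hK (hpos e he), hD₁,
      ae_restrict_mem hc.measurableSet] with z h1 h2 hzK t ht
    have h3 := h1 t (ht.trans_le (min_le_left _ _))
    have hent : ∀ i j, ‖(perturbed ω₀ u e z + t • ddbar ψ e z) i j‖ ≤ D₁ + D₂ :=
      norm_add_smul_le h2 (hD₂ z hzK) (ht.le.trans (min_le_right _ _))
    have hone : ∀ {a : ℝ}, 0 ≤ a → (a • (1 : Matrix (Fin n) (Fin n) ℂ)).PosSemidef :=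
      fun ha => Matrix.PosSemidef.one.real_smul ha
    refine ⟨fun i j => (hent i j).trans ((le_add_of_nonneg_left hD₀0).trans (le_max_left _ _)),
      (hC _ _ (fun i j => (hent i j).trans (le_add_of_nonneg_left hD₀0))
      (fun i j => (hD₀ z hzK i j).trans (le_add_of_nonneg_right (by positivity))) ?_ ?_).trans
      (le_max_right _ _)⟩
    · have h4 := h3.add ((hGm z hzK).real_smul hη.le)
      have h5 := h4.add (hone (sub_nonneg.2 (min_le_right m (η * m))))
      convert h5 using 1
      rw [smul_sub, smul_smul, sub_smul]; abel
    · have h5 := (hGm z hzK).add (hone (sub_nonneg.2 (min_le_left m (η * m))))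
      convert h5 using 1
      rw [sub_smul]; abel

lemma isLoc_log_div {A : LocalForm n M} (hA : IsLocForm A)
    (hb : ∀ e ∈ atlas (Model n) M, ∀ K ⊆ e.target, IsCompact K → ∃ C : ℝ,
      ∀ᵐ z ∂(volume.restrict K), |Real.log ((A e z).det.re / (ω₀.coeff e z).det.re)| ≤ C) :
    IsLoc fun e z => Real.log ((A e z).det.re / (ω₀.coeff e z).det.re) := by
  refine fun e he => LInfLoc.of_ae_bound (fun K hK hc => ?_) (hb e he)
  have h1 : AEStronglyMeasurable (fun z => wedge fun _ => A e z) (volume.restrict K) :=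
    (IsLoc.wedge (fun _ => hA) e he K hK hc).1
  have hgl : IsLocForm ω₀.coeff := fun e he i j =>
    LInfLoc.of_continuousOn (ω₀.continuousOn_coeff he i j)
  have h2 : AEStronglyMeasurable (fun z => wedge fun _ => ω₀.coeff e z) (volume.restrict K) :=
    (IsLoc.wedge (fun _ => hgl) e he K hK hc).1
  simp only [log_det_div_det]
  exact (Real.measurable_log.comp_aemeasurable
    (h1.aemeasurable.div h2.aemeasurable)).aestronglyMeasurable

variable [CompactSpace M] [IsManifold 𝓘(ℂ, Model n) ω M]

lemma isLoc_logRatio (hu : u ∈ HwPlus ω₀) : IsLoc (logRatio ω₀ u) := by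
  obtain ⟨δ, hδ, -, -, hC⟩ := exists_bound_segment hu (ψ := fun _ => 0) contMDiff_const
  refine isLoc_log_div (isForm_perturbed hu).loc fun e he K hK hc => ?_
  obtain ⟨C, -, h⟩ := hC e he K hK hc
  refine ⟨C, ?_⟩
  filter_upwards [h] with z hz
  simpa using (hz 0 (by simpa using hδ)).2

/-- The log volume ratio is a function: its local expressions agree on overlaps. -/
lemma isFun_logRatio (hu : u ∈ HwPlus ω₀) : IsFun (logRatio ω₀ u) := by
  refine ⟨isLoc_logRatio hu, fun e he e' he' => ?_⟩
  filter_upwards [(isForm_perturbed hu).trans e he e' he'] with z hz hzo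
  rw [logRatio, logRatio, hz hzo, ω₀.coeff_transform he he' hzo, det_transform, det_transform,
    mul_div_mul_left]
  exact (Complex.normSq_pos.2 (det_jacobian_ne_zero he he' hzo)).ne'

variable [T2Space M]

/-- Integration by parts against the constant function `1`, whose complex Hessian is zero. -/
lemma integral_wedge_ddbar_eq_zero (hu : u ∈ HwPlus ω₀) (hψ : IsSmooth n ψ) (m : Fin n) :
    integral (fun e z => wedge (Function.update (fun _ => perturbed ω₀ u e z) m (ddbar ψ e z))) =
      0 := by
  have h := integral_mul_wedge_ddbar isPotential_one (isPotential_of_mem_HwPlus hu)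
    (B := fun _ => ω₀.coeff) (fun _ => ω₀.isForm) (fun _ e he => ω₀.closedFormOn he)
    (fun _ => 1) m hψ
  have e1 : ∀ f : LocalFun n M, localExpr (fun _ : M => (1 : ℝ)) * f = f := fun f => by
    funext e z; simp [localExpr]
  rw [e1] at h
  simp only [one_smul, wedge_update_zero] at h
  refine h.trans ?_
  have e2 : (localExpr ψ * fun _ _ => 0 : LocalFun n M) = (0 : ℝ) • (localExpr ψ : LocalFun n M) := by
    funext e z; simp
  rw [e2, integral_smul, zero_mul]

lemma mixedPowWith_eq_update {n : ℕ} {M : Type*} [TopologicalSpace M] (A G : LocalForm n M)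
    (k₀ : Fin n) (e : OpenPartialHomeomorph M (Model n)) (z : Model n) :
    mixedPowWith A G G (n - 1) e z =
      wedge (Function.update (fun _ => G e z) k₀ (A e z)) := by
  have h0 : 0 < n := k₀.pos
  rw [wedge_update_swap (fun _ => G e z) k₀ ⟨0, h0⟩ _ rfl, mixedPowWith]
  congr 1
  funext k
  by_cases hk : (k : ℕ) = 0
  · have : k = ⟨0, h0⟩ := Fin.ext hk
    subst this; simp
  · have : k ≠ ⟨0, h0⟩ := fun h => hk (by rw [h])
    simp [hk, this]

/-- The first variation of the entropy. The derivative of `x log (x / g)` is `1 + log (x / g)` times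
that of `x`, and the contribution of the `1` is the integral of `√-1 ∂∂̄ψ ∧ ω_u^{n-1}`, which
vanishes. -/
lemma hasDerivAt_entropy (hu : u ∈ HwPlus ω₀) (hψ : IsSmooth n ψ) :
    HasDerivAt (fun t : ℝ => integral (logRatio ω₀ (fun x => u x + t * ψ x) *
        topPow (perturbed ω₀ fun x => u x + t * ψ x)))
      (n * integral (logRatio ω₀ u *
        mixedPowWith (ddbar ψ) (perturbed ω₀ u) (perturbed ω₀ u) (n - 1))) 0 := by
  have hup := isPotential_of_mem_HwPlus hu
  have hψp := isPotential_of_isSmooth hψ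
  have hG := (isForm_perturbed hu).loc
  have hH := hψp.locForm
  obtain ⟨δ, hδ, hδ1, hpd, hC⟩ := exists_bound_segment hu hψ
  set G := perturbed ω₀ u with hGdef
  set H : LocalForm n M := ddbar ψ with hHdef
  have hGt : ∀ t, IsLocForm fun e z => G e z + t • H e z := fun t => hG.add_smul hH t
  have hloc : ∀ t, |t| < δ → IsLoc fun e z =>
      Real.log ((G e z + t • H e z).det.re / (ω₀.coeff e z).det.re) := fun t ht =>
    isLoc_log_div (hGt t) fun e he K hK hc => by
      obtain ⟨C, -, h⟩ := hC e he K hK hc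
      exact ⟨C, h.mono fun z hz => (hz t ht).2⟩
  have hW : ∀ t, IsLoc fun e z => ∑ m, wedge (Function.update
      (fun _ => G e z + t • H e z) m (H e z)) := fun t => by
    have := IsLoc.sum (s := Finset.univ) fun m _ =>
      IsLoc.wedge_update (A := fun _ => fun e z => G e z + t • H e z) (fun _ => hGt t) hH m
    convert this using 1
    funext e z
    rw [Finset.sum_apply, Finset.sum_apply]
  have hfun : ∀ t : ℝ, integral (logRatio ω₀ (fun x => u x + t * ψ x) *
      topPow (perturbed ω₀ fun x => u x + t * ψ x)) = integral (fun e z =>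
        Real.log ((G e z + t • H e z).det.re / (ω₀.coeff e z).det.re) *
        wedge fun _ => G e z + t • H e z) := by
    refine fun t => integral_congr fun e he => ?_
    filter_upwards [perturbed_add_smul ω₀ hup hψp t e he] with z hz
    rw [Pi.mul_apply, Pi.mul_apply, logRatio, topPow, hz]
  simp only [hfun]
  have key := hasDerivAt_integral (F := fun t => fun e z =>
      Real.log ((G e z + t • H e z).det.re / (ω₀.coeff e z).det.re) *
        wedge fun _ => G e z + t • H e z)
    (F' := fun t => fun e z =>
      (1 + Real.log ((G e z + t • H e z).det.re / (ω₀.coeff e z).det.re)) *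
        ∑ m, wedge (Function.update (fun _ => G e z + t • H e z) m (H e z))) hδ
    (fun t ht => (hloc t ht).mul (IsLoc.wedge fun _ => hGt t)) ?_ ?_ ?_
  · refine key.congr_deriv ?_
    simp only [zero_smul, add_zero]
    have hz : ∀ m, IsLoc fun e z => wedge (Function.update (fun _ => G e z) m (H e z)) :=
      fun m => IsLoc.wedge_update (A := fun _ => G) (fun _ => hG) hH m
    have hV := isLoc_logRatio hu
    have e1 : (fun e z => (1 + Real.log ((G e z).det.re / (ω₀.coeff e z).det.re)) *
        ∑ m, wedge (Function.update (fun _ => G e z) m (H e z))) =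
        (∑ m : Fin n, fun e z => wedge (Function.update (fun _ => G e z) m (H e z))) +
        (n : ℝ) • (logRatio ω₀ u * mixedPowWith H G G (n - 1)) := by
      funext e z
      simp only [Pi.add_apply, Finset.sum_apply, Pi.smul_apply, Pi.mul_apply, smul_eq_mul]
      have e2 : ∑ m, wedge (Function.update (fun _ => G e z) m (H e z)) =
          n * mixedPowWith H G G (n - 1) e z := by
        rw [Finset.sum_congr rfl fun m _ => (mixedPowWith_eq_update H G m e z).symm,
          Finset.sum_const, Finset.card_univ, Fintype.card_fin, nsmul_eq_mul]
      rw [add_mul, one_mul, e2, logRatio]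
      ring
    rw [e1, integral_add' (IsLoc.sum fun m _ => hz m) (IsLoc.const_smul (hV.mul ?_) _),
      integral_sum _ fun m _ => hz m, Finset.sum_eq_zero fun m _ =>
      integral_wedge_ddbar_eq_zero hu hψ m, zero_add, integral_smul]
    have e3 : mixedPowWith H G G (n - 1) = fun e z => wedge fun k : Fin n =>
        (if (k : ℕ) = 0 then H else G) e z := by
      funext e z
      rw [mixedPowWith]
      congr 1
      funext k
      split_ifs <;> rfl
    rw [e3]
    refine IsLoc.wedge fun k => ?_
    split_ifs
    exacts [hH, hG]
  · have h1 : IsLoc fun e z => (1 : ℝ) +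
        Real.log ((G e z + (0 : ℝ) • H e z).det.re / (ω₀.coeff e z).det.re) := fun e he =>
      (LInfLoc.const 1).add (hloc 0 (by simpa using hδ) e he)
    exact h1.mul (hW 0)
  · intro e he K hK hc
    obtain ⟨C, hC0, hCb⟩ := hC e he K hK hc
    obtain ⟨D, hD0, hD⟩ := hH.exists_bound he hK hc
    set W : ℝ := (Fintype.card (Equiv.Perm (Fin n)) : ℝ) *
      ((Fintype.card (Equiv.Perm (Fin n)) : ℝ) * (C + D) ^ n) with hWdef
    refine ⟨(1 + C) * ∑ _m : Fin n, W, ?_⟩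
    filter_upwards [hCb, hD] with z h1 h2 t ht
    obtain ⟨h3, h4⟩ := h1 t ht
    rw [abs_mul]
    refine mul_le_mul ?_ ((Finset.abs_sum_le_sum_abs _ _).trans (Finset.sum_le_sum fun m _ => ?_))
      (abs_nonneg _) (by positivity)
    · refine (abs_add_le _ _).trans ?_
      rw [abs_one]
      exact add_le_add le_rfl h4
    · exact abs_wedge_le (norm_update_le (fun _ i j => (h3 i j).trans
        (le_add_of_nonneg_right hD0)) (fun i j => (h2 i j).trans (le_add_of_nonneg_left hC0)) m)
  · intro e he
    filter_upwards [hpd e he, ae_restrict_mem e.open_target.measurableSet] with z hz hzt t ht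
    have hw : 0 < wedge fun _ => G e z + t • H e z := by
      rw [wedge_const]
      exact mul_pos (by positivity) (Complex.lt_def.1 (hz t ht).det_pos).1
    have hg : 0 < wedge fun _ => ω₀.coeff e z := by
      rw [wedge_const]
      exact mul_pos (by positivity) (ω₀.det_pos he hzt)
    simp only [log_det_div_det]
    have d1 := hasDerivAt_wedge (fun _ => G e z) (fun _ => H e z) t
    have d2 := ((d1.div_const (wedge fun _ => ω₀.coeff e z)).log
      (div_pos hw hg).ne').mul d1
    refine d2.congr_deriv ?_
    field_simp

lemma hasDerivAt_kEnergy (hu : u ∈ HwPlus ω₀) (hψ : IsSmooth n ψ) :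
    HasDerivAt (fun t : ℝ => kEnergy ω₀ fun x => u x + t * ψ x) (firstVariation ω₀ u ψ) 0 := by
  have h := (((hasDerivAt_energy hu hψ).const_mul (avgScalar ω₀ / (n + 1))).sub
    (hasDerivAt_energyRic hu hψ)).add (hasDerivAt_entropy hu hψ)
  refine h.congr_deriv ?_
  have : (n : ℝ) + 1 ≠ 0 := by positivity
  rw [firstVariation, ← mul_assoc, div_mul_cancel₀ _ this]

end Entropy

/-! ### Approximation of test functions of class `C^{1,1}` -/

section Product

variable {n : ℕ} {M : Type*} [TopologicalSpace M]

lemma _root_.LocallyLipschitzOn.smul_of_normedSpace {X F : Type*} [PseudoEMetricSpace X]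
    [NormedAddCommGroup F] [NormedSpace ℝ F] {s : Set X} {a : X → ℝ} {B : X → F}
    (ha : LocallyLipschitzOn s a) (hB : LocallyLipschitzOn s B) :
    LocallyLipschitzOn s fun x => a x • B x := by
  intro x hx
  obtain ⟨Ka, ta, hta, hLa⟩ := ha hx
  obtain ⟨Kb, tb, htb, hLb⟩ := hB hx
  have ha1 : {y | ‖a y‖ ≤ ‖a x‖ + 1} ∈ 𝓝[s] x :=
    (ha.continuousOn x hx).norm (ge_mem_nhds (lt_add_one _))
  have hb1 : {y | ‖B y‖ ≤ ‖B x‖ + 1} ∈ 𝓝[s] x :=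
    (hB.continuousOn x hx).norm (ge_mem_nhds (lt_add_one _))
  refine ⟨(‖a x‖₊ + 1) * Kb + Ka * (‖B x‖₊ + 1), _,
    inter_mem (inter_mem hta htb) (inter_mem ha1 hb1), fun y hy w hw => ?_⟩
  have e1 : a y • B y - a w • B w = a y • (B y - B w) + (a y - a w) • B w := by
    rw [smul_sub, sub_smul]; abel
  have h1 : ‖a y‖ₑ ≤ ((‖a x‖₊ + 1 : NNReal) : ENNReal) := by
    rw [enorm_eq_nnnorm, ENNReal.coe_le_coe]
    exact hy.2.1
  have h2 : ‖B w‖ₑ ≤ ((‖B x‖₊ + 1 : NNReal) : ENNReal) := by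
    rw [enorm_eq_nnnorm, ENNReal.coe_le_coe]
    exact hw.2.2
  have h3 := hLa hy.1.1 hw.1.1
  have h4 := hLb hy.1.2 hw.1.2
  rw [edist_eq_enorm_sub] at h3 h4 ⊢
  rw [e1]
  calc ‖a y • (B y - B w) + (a y - a w) • B w‖ₑ
      ≤ ‖a y • (B y - B w)‖ₑ + ‖(a y - a w) • B w‖ₑ := enorm_add_le _ _
    _ = ‖a y‖ₑ * ‖B y - B w‖ₑ + ‖a y - a w‖ₑ * ‖B w‖ₑ := by rw [enorm_smul, enorm_smul]
    _ ≤ ((‖a x‖₊ + 1 : NNReal) : ENNReal) * (Kb * edist y w) +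
        Ka * edist y w * ((‖B x‖₊ + 1 : NNReal) : ENNReal) := by gcongr
    _ = ((((‖a x‖₊ + 1) * Kb + Ka * (‖B x‖₊ + 1) : NNReal)) : ENNReal) * edist y w := by
        push_cast; ring

variable [ChartedSpace (Model n) M]

lemma IsC11.mul {f g : M → ℝ} (hf : IsC11 n f) (hg : IsC11 n g) :
    IsC11 n fun x => f x * g x := fun e he => by
  obtain ⟨f1, f2⟩ := hf e he
  obtain ⟨g1, g2⟩ := hg e he
  refine ⟨f1.mul g1, ?_⟩
  have hU := e.open_target
  have hfl := locallyLipschitzOn_of_contDiffOn hU f1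
  have hgl := locallyLipschitzOn_of_contDiffOn hU g1
  have h := (hfl.smul_of_normedSpace g2).add (hgl.smul_of_normedSpace f2)
  intro z hz
  obtain ⟨K, t, ht, hL⟩ := h hz
  refine ⟨K, t ∩ e.target, inter_mem ht self_mem_nhdsWithin, ?_⟩
  have hd : ∀ w ∈ e.target, fderiv ℝ (localExpr (fun x => f x * g x) e) w =
      localExpr f e w • fderiv ℝ (localExpr g e) w +
        localExpr g e w • fderiv ℝ (localExpr f e) w := fun w hw =>
    fderiv_fun_mul ((f1.differentiableOn one_ne_zero).differentiableAt (hU.mem_nhds hw))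
      ((g1.differentiableOn one_ne_zero).differentiableAt (hU.mem_nhds hw))
  intro y hy w hw
  rw [hd y hy.2, hd w hw.2]
  exact hL hy.1 hw.1

end Product

section Pullback

variable {n : ℕ} {M : Type*} [TopologicalSpace M]

/-- The extension by zero to `M` of a function on the model space supported in the chart `e`. -/
noncomputable def pullback (e : OpenPartialHomeomorph M (Model n)) (F : Model n → ℝ) : M → ℝ :=
  e.source.indicator fun x => F (e x)

lemma localExpr_pullback {e : OpenPartialHomeomorph M (Model n)} {F : Model n → ℝ} {z : Model n}
    (hz : z ∈ e.target) : localExpr (pullback e F) e z = F z := by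
  rw [localExpr, pullback, indicator_of_mem (e.map_target hz), e.right_inv hz]

lemma ddbar_pullback {e : OpenPartialHomeomorph M (Model n)} {F : Model n → ℝ} {z : Model n}
    (hz : z ∈ e.target) : ddbar (pullback e F) e z = complexHessian F z := by
  refine complexHessian_congr ?_
  filter_upwards [e.open_target.mem_nhds hz] with w hw using localExpr_pullback hw

variable [T2Space M]

lemma isClosed_symm_image {e : OpenPartialHomeomorph M (Model n)} {K : Set (Model n)}
    (hK : IsCompact K) (hKe : K ⊆ e.target) :
    IsCompact (e.symm '' K) ∧ IsClosed (e.symm '' K) ∧ e.symm '' K ⊆ e.source := by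
  have h := hK.image_of_continuousOn (e.continuousOn_symm.mono hKe)
  exact ⟨h, h.isClosed, image_subset_iff.2 fun z hz => e.map_target (hKe hz)⟩

lemma tsupport_pullback_subset {e : OpenPartialHomeomorph M (Model n)} {F : Model n → ℝ}
    {K : Set (Model n)} (hK : IsCompact K) (hKe : K ⊆ e.target) (hF : ∀ z, z ∉ K → F z = 0) :
    tsupport (pullback e F) ⊆ e.symm '' K := by
  refine closure_minimal (fun x hx => ?_) (isClosed_symm_image hK hKe).2.1
  by_cases hxe : x ∈ e.source
  · refine ⟨e x, by_contra fun h => hx ?_, e.left_inv hxe⟩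
    rw [pullback, indicator_of_mem hxe, hF _ h]
  · exact absurd (indicator_of_notMem hxe _) hx

end Pullback

section Approximation

variable {n : ℕ} {M : Type*} [TopologicalSpace M] [ChartedSpace (Model n) M]

lemma IsDensity.add {α β : LocalFun n M} (hα : IsDensity α) (hβ : IsDensity β) :
    IsDensity (α + β) := by
  refine ⟨hα.loc.add hβ.loc, fun e he e' he' => ?_⟩
  filter_upwards [hα.trans e he e' he', hβ.trans e he e' he'] with z h1 h2 hz
  simp only [Pi.add_apply]
  rw [h1 hz, h2 hz]; ring

lemma IsDensity.smul {α : LocalFun n M} (hα : IsDensity α) (c : ℝ) : IsDensity (c • α) := by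
  refine ⟨hα.loc.const_smul c, fun e he e' he' => ?_⟩
  filter_upwards [hα.trans e he e' he'] with z h1 hz
  simp only [Pi.smul_apply, smul_eq_mul]
  rw [h1 hz]; ring

lemma IsFun.smul {f : LocalFun n M} (hf : IsFun f) (c : ℝ) : IsFun (c • f) := by
  refine ⟨hf.loc.const_smul c, fun e he e' he' => ?_⟩
  filter_upwards [hf.trans e he e' he'] with z h1 hz
  simp only [Pi.smul_apply, h1 hz]

variable [T2Space M] [IsManifold 𝓘(ℂ, Model n) ω M]

lemma isSmooth_pullback {e : OpenPartialHomeomorph M (Model n)} (he : e ∈ atlas (Model n) M)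
    {F : Model n → ℝ} (hF : ContDiff ℝ ∞ F) {K : Set (Model n)} (hK : IsCompact K)
    (hKe : K ⊆ e.target) (hF0 : ∀ z, z ∉ K → F z = 0) : IsSmooth n (pullback e F) := by
  have := isManifold_real n M
  intro x
  by_cases hx : x ∈ e.source
  · have h1 : ContMDiffOn 𝓘(ℝ, Model n) 𝓘(ℝ, Model n) ∞ e e.source :=
      contMDiffOn_of_mem_maximalAtlas (IsManifold.subset_maximalAtlas he)
    have h2 : ContMDiffAt 𝓘(ℝ, Model n) 𝓘(ℝ, ℝ) ∞ (F ∘ e) x :=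
      (hF.contMDiff.contMDiffAt).comp x (h1.contMDiffAt (e.open_source.mem_nhds hx))
    refine h2.congr_of_eventuallyEq ?_
    filter_upwards [e.open_source.mem_nhds hx] with y hy using indicator_of_mem hy _
  · have hx' : x ∉ tsupport (pullback e F) := fun h =>
      hx ((isClosed_symm_image hK hKe).2.2 (tsupport_pullback_subset hK hKe hF0 h))
    exact (contMDiffAt_const (c := (0 : ℝ))).congr_of_eventuallyEq
      (notMem_tsupport_iff_eventuallyEq.1 hx')

variable [CompactSpace M] {α V : LocalFun n M} {G : LocalForm n M}

/-- For `φ` supported in the chart `e`, the functional `φ ↦ ∫ φ α + ∫ V √-1 ∂∂̄φ ∧ G^{n-1}` is an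
integral over this chart. -/
lemma functional_eq_chart (hα : IsDensity α) (hV : IsFun V) (hG : IsForm G) (k₀ : Fin n)
    {φ : M → ℝ} (hφ : IsPotential φ (ddbar (n := n) φ))
    {e : OpenPartialHomeomorph M (Model n)} (he : e ∈ atlas (Model n) M)
    (hs : tsupport φ ⊆ e.source) :
    integral (localExpr φ * α) + integral (V * fun e z =>
      wedge (Function.update (fun _ => G e z) k₀ (ddbar φ e z))) =
      ∫ z in e.target, 2 ^ n * (localExpr φ e z * α e z + V e z *
        wedge (Function.update (fun _ => G e z) k₀ (ddbar φ e z))) := by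
  have d1 := (isFun_localExpr hφ.loc).mul_density hα
  have d2 := hV.mul_density (IsForm.update (A := fun _ => G) (fun _ => hG) hφ.isForm k₀)
  rw [← integral_add' d1.loc d2.loc, integral_eq_chart (d1.add d2) he
    (isClosed_tsupport φ).isCompact hs]
  · rfl
  · refine fun e' _ => Eventually.of_forall fun z hz hzK => ?_
    rw [Pi.add_apply, Pi.add_apply, Pi.mul_apply, Pi.mul_apply, Pi.mul_apply, Pi.mul_apply,
      localExpr_eq_zero hzK, ddbar_eq_zero hz hzK, wedge_update_zero, zero_mul, mul_zero, add_zero]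

/-- Mollification: an identity which holds for smooth test functions holds for test functions of
class `C^{1,1}` supported in one chart. -/
lemma functional_eq_zero_of_tsupport (hα : IsDensity α) (hV : IsFun V) (hG : IsForm G)
    (k₀ : Fin n) (h : ∀ φ : M → ℝ, IsSmooth n φ → integral (localExpr φ * α) +
      integral (V * fun e z => wedge (Function.update (fun _ => G e z) k₀ (ddbar φ e z))) = 0)
    {φ : M → ℝ} (hφ : IsC11 n φ) {e : OpenPartialHomeomorph M (Model n)}
    (he : e ∈ atlas (Model n) M) (hs : tsupport φ ⊆ e.source) :
    integral (localExpr φ * α) + integral (V * fun e z =>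
      wedge (Function.update (fun _ => G e z) k₀ (ddbar φ e z))) = 0 := by
  have hφp := isPotential_of_isC11 hφ
  obtain ⟨hc1, hc2, -⟩ := isCompact_image_chart (isClosed_tsupport φ).isCompact hs
  -- the mollifications of `φ` are supported in this thickening of the support of `φ`, so that they
  -- extend by zero to smooth functions on `M`
  obtain ⟨δ, hδ, hδK⟩ := hc1.exists_cthickening_subset_open e.open_target hc2
  set K := Metric.cthickening δ (e '' tsupport φ) with hKdef
  have hK : IsCompact K := hc1.cthickening
  set f := chartExtension e φ with hf
  have hmem := ae_restrict_mem (μ := (volume : Measure (Model n))) e.open_target.measurableSet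
  have hfe : localExpr φ e =ᵐ[volume.restrict e.target] f := by
    filter_upwards [hmem] with z hz using (chartExtension_apply hz).symm
  have hHe : ddbar φ e =ᵐ[volume.restrict e.target] complexHessian f := by
    filter_upwards [hmem] with z hz using (complexHessian_chartExtension hz).symm
  have hHl : ∀ i j, LInfLoc e.target fun z => complexHessian f z i j := fun i j =>
    (hφp.locForm e he i j).congr (by filter_upwards [hHe] with z hz; rw [hz])
  obtain ⟨F, C, hFs, hFC, hHC, hFl, hHlim, hF0⟩ := WeakHess.exists_smooth_approx e.open_target
    ((hφp.loc e he).congr hfe) hHl ((hφp.weak e he).congr hfe hHe) hK hδK hδ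
  have hzero : ∀ z, z ∉ K → f z = 0 := fun z hz =>
    chartExtension_eq_zero hs fun hc => hz (Metric.self_subset_cthickening _ hc)
  have hFzero : ∀ k z, z ∉ K → F k z = 0 := fun k z hz => hF0 k z fun w hw =>
    chartExtension_eq_zero hs fun hc => hz
      (Metric.mem_cthickening_of_dist_le z w δ _ hc (by rw [dist_comm]; exact hw.le))
  have hFH : ∀ k z, z ∉ K → complexHessian (F k) z = 0 := fun k z hz =>
    complexHessian_eq_zero_of_notMem hK.isClosed (hFzero k) hz
  have hfH : ∀ z, z ∉ K → complexHessian f z = 0 := fun z hz =>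
    complexHessian_eq_zero_of_notMem hK.isClosed hzero hz
  have hsm : ∀ k, IsSmooth n (pullback e (F k)) := fun k =>
    isSmooth_pullback he (hFs k) hK hδK (hFzero k)
  have hval : ∀ k, ∫ z in e.target, 2 ^ n * (F k z * α e z + V e z *
      wedge (Function.update (fun _ => G e z) k₀ (complexHessian (F k) z))) = 0 := fun k => by
    rw [← h _ (hsm k), functional_eq_chart hα hV hG k₀ (isPotential_of_isSmooth (hsm k)) he
      ((tsupport_pullback_subset hK hδK (hFzero k)).trans (isClosed_symm_image hK hδK).2.2)]
    refine setIntegral_congr_fun e.open_target.measurableSet fun z hz => ?_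
    simp only [localExpr_pullback hz, ddbar_pullback hz]
  have hgoal : integral (localExpr φ * α) + integral (V * fun e z =>
      wedge (Function.update (fun _ => G e z) k₀ (ddbar φ e z))) =
      ∫ z in e.target, 2 ^ n * (f z * α e z + V e z *
        wedge (Function.update (fun _ => G e z) k₀ (complexHessian f z))) := by
    rw [functional_eq_chart hα hV hG k₀ hφp he hs]
    refine setIntegral_congr_fun e.open_target.measurableSet fun z hz => ?_
    simp only [hf, chartExtension_apply hz, complexHessian_chartExtension hz]
  obtain ⟨a, ha0, ha⟩ := (hα.loc e he).exists_bound hδK hK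
  obtain ⟨b, hb0, hb⟩ := (hV.loc e he).exists_bound hδK hK
  obtain ⟨D, hD0, hD⟩ := hG.loc.exists_bound he hδK hK
  set W : ℝ := (Fintype.card (Equiv.Perm (Fin n)) : ℝ) *
    ((Fintype.card (Equiv.Perm (Fin n)) : ℝ) * (max D C) ^ n) with hW
  have hlim := tendsto_setIntegral_of_bounded (U := e.target) (F := fun k z => (2 : ℝ) ^ n *
      (F k z * α e z + V e z * wedge (Function.update (fun _ => G e z) k₀ (complexHessian (F k) z))))
    (f := fun z => (2 : ℝ) ^ n * (f z * α e z + V e z *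
      wedge (Function.update (fun _ => G e z) k₀ (complexHessian f z))))
    e.open_target hδK hK (fun k => ?_) (2 ^ n * (C * a + b * W)) (fun k => ?_) (fun k z hz => ?_)
    (fun z hz => ?_) ?_
  · simp only [hval] at hlim
    rw [hgoal]
    exact tendsto_nhds_unique hlim tendsto_const_nhds
  · have l1 : LInfLoc e.target (F k) := LInfLoc.of_continuousOn (hFs k).continuous.continuousOn
    have l2 : LInfLoc e.target fun z => wedge
        (Function.update (fun _ => G e z) k₀ (complexHessian (F k) z)) := by
      refine LInfLoc.wedge (A := fun k' z => Function.update (fun _ => G e z) k₀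
        (complexHessian (F k) z) k') fun k' i j => ?_
      by_cases hk : k' = k₀
      · simpa [hk] using LInfLoc.of_continuousOn
          (contDiff_iff_contDiffAt.2 fun z => contDiffAt_complexHessian
            (hFs k).contDiffAt i j).continuous.continuousOn
      · simpa [hk] using hG.loc e he i j
    exact (((LInfLoc.const ((2 : ℝ) ^ n)).mul ((l1.mul (hα.loc e he)).add
      ((hV.loc e he).mul l2))) K hδK hK).1
  · filter_upwards [ha, hb, hD, ae_restrict_mem hK.measurableSet] with z h1 h2 h3 hzK
    rw [norm_mul, Real.norm_eq_abs, abs_of_pos (by positivity : (0 : ℝ) < 2 ^ n)]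
    refine mul_le_mul_of_nonneg_left ((norm_add_le _ _).trans (add_le_add ?_ ?_)) (by positivity)
    · rw [norm_mul]
      exact mul_le_mul (hFC k z) h1 (norm_nonneg _) ((abs_nonneg _).trans (hFC k z))
    · rw [norm_mul]
      exact mul_le_mul h2 (abs_wedge_le (norm_update_le
        (fun _ i j => (h3 i j).trans (le_max_left D C))
        (fun i j => (hHC k z hzK i j).trans (le_max_right D C)) k₀)) (norm_nonneg _) hb0
  · simp only [hFzero k z hz, hFH k z hz, wedge_update_zero, zero_mul, mul_zero, add_zero]
  · simp only [hzero z hz, hfH z hz, wedge_update_zero, zero_mul, mul_zero, add_zero]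
  · filter_upwards [hFl, hHlim] with z h1 h2
    refine ((h1.mul_const _).add (Tendsto.const_mul _ ?_)).const_mul _
    refine (Complex.continuous_re.tendsto _).comp (tendsto_wedgeC fun k' i j => ?_)
    by_cases hk : k' = k₀
    · subst hk; simpa using h2 i j
    · simp [hk]

/-- An identity which holds for smooth test functions holds for test functions of class
`C^{1,1}`. -/
lemma functional_eq_zero (hα : IsDensity α) (hV : IsFun V) (hG : IsForm G)
    (k₀ : Fin n) (h : ∀ φ : M → ℝ, IsSmooth n φ → integral (localExpr φ * α) +
      integral (V * fun e z => wedge (Function.update (fun _ => G e z) k₀ (ddbar φ e z))) = 0)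
    {ψ : M → ℝ} (hψ : IsC11 n ψ) :
    integral (localExpr ψ * α) + integral (V * fun e z =>
      wedge (Function.update (fun _ => G e z) k₀ (ddbar ψ e z))) = 0 := by
  obtain ⟨T, χ, hχ, hχs, hχ1⟩ := exists_smooth_partition n M
  have hc : ∀ x, IsC11 n fun y => χ x y * ψ y := fun x => (isC11_of_isSmooth (hχ x)).mul hψ
  have h1 : integral (V * fun e z => wedge (Function.update
      (fun _ => G e z) k₀ (ddbar ψ e z))) = integral (∑ x ∈ T, V * fun e z =>
      wedge (Function.update (fun _ => G e z) k₀ (ddbar (fun y => χ x y * ψ y) e z))) := by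
    refine integral_congr fun e he => ?_
    filter_upwards [aeEqual_ddbar_sum hχ1 hψ (fun x _ => hc x) e he] with z hz
    rw [Pi.mul_apply, Pi.mul_apply, hz, wedge_update_sum, Finset.mul_sum, Finset.sum_apply,
      Finset.sum_apply]
    rfl
  have h2 : localExpr ψ * α = ∑ x ∈ T, localExpr (fun y => χ x y * ψ y) * α := by
    funext e z
    rw [Finset.sum_apply, Finset.sum_apply]
    simp only [Pi.mul_apply, localExpr]
    rw [← Finset.sum_mul, ← Finset.sum_mul, hχ1, one_mul]
  rw [h1, h2, integral_sum, integral_sum, ← Finset.sum_add_distrib]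
  · exact Finset.sum_eq_zero fun x _ => functional_eq_zero_of_tsupport hα hV hG k₀ h (hc x)
      (chart_mem_atlas (Model n) x) (tsupport_mul_subset_of (hχs x))
  · exact fun x _ => hV.loc.mul (IsForm.update (A := fun _ => G) (fun _ => hG)
      (isPotential_of_isC11 (hc x)).isForm k₀).loc
  · exact fun x _ => (isPotential_of_isC11 (hc x)).loc.mul hα.loc

end Approximation

/-! ### Weak solutions and critical points -/

section Conclusion

variable {n : ℕ} {M : Type*} [TopologicalSpace M] [ChartedSpace (Model n) M]
  {ω₀ : KahlerMetric n M} {u ψ : M → ℝ}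

lemma isDensity_mixedPowWith {A G : LocalForm n M} (hA : IsForm A) (hG : IsForm G) :
    IsDensity (mixedPowWith A G G (n - 1)) := by
  have e : mixedPowWith A G G (n - 1) = fun e z => wedge fun k : Fin n =>
      (if (k : ℕ) = 0 then A else G) e z := by
    funext e z
    rw [mixedPowWith]
    congr 1
    funext k
    split_ifs <;> rfl
  rw [e]
  refine IsDensity.wedge fun k => ?_
  split_ifs
  exacts [hA, hG]

lemma ae_posDef_perturbed (hu : u ∈ HwPlus ω₀) : ∀ e ∈ atlas (Model n) M,
    ∀ᵐ z ∂(volume.restrict e.target), (perturbed ω₀ u e z).PosDef := by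
  obtain ⟨ε, hε, hpos⟩ := hu.2.2.2.2
  intro e he
  filter_upwards [hpos e he, ae_restrict_mem e.open_target.measurableSet] with z hz hzt
  have h2 : (ε • ω₀.coeff e z).PosDef := (ω₀.posDef e he z hzt).smul hε
  simpa using h2.posSemidef_add hz

/-- `(tr_G A) Gⁿ = n A ∧ G^{n-1}`. -/
lemma trace_mul_topPow (hu : u ∈ HwPlus ω₀) (A : LocalForm n M) :
    AEEqual (traceWrt (perturbed ω₀ u) A * topPow (perturbed ω₀ u))
      ((n : ℝ) • mixedPowWith A (perturbed ω₀ u) (perturbed ω₀ u) (n - 1)) := fun e he => by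
  filter_upwards [ae_posDef_perturbed hu e he] with z hz
  simp only [Pi.mul_apply, Pi.smul_apply, smul_eq_mul]
  rcases Nat.eq_zero_or_pos n with h0 | h0
  · subst h0
    simp [traceWrt, Matrix.trace]
  · rw [mixedPowWith_eq_update A _ ⟨0, h0⟩, traceWrt, topPow]
    exact trace_mul_wedge_const ⟨0, h0⟩ hz (A e z)

variable [CompactSpace M] [IsManifold 𝓘(ℂ, Model n) ω M]

lemma eventually_add_smul_mem_HwPlus (hu : u ∈ HwPlus ω₀) (hψ : IsSmooth n ψ) :
    ∀ᶠ t : ℝ in 𝓝 0, (fun x => u x + t * ψ x) ∈ HwPlus ω₀ := by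
  obtain ⟨δ, hδ, h⟩ := add_smul_mem_HwPlus hu hψ
  filter_upwards [Metric.ball_mem_nhds (0 : ℝ) hδ] with t ht
  exact h t (by simpa [Real.dist_eq] using ht)

variable [T2Space M]

/-- The weak equation tested against `ψ` says that the first variation along `ψ` vanishes. -/
lemma weak_equation_iff (hu : u ∈ HwPlus ω₀) (hψ : IsC11 n ψ) :
    -integral (logRatio ω₀ u * traceWrt (perturbed ω₀ u) (ddbar ψ) * topPow (perturbed ω₀ u)) =
      integral (localExpr ψ * (localExpr (fun _ => avgScalar ω₀) -
        traceWrt (perturbed ω₀ u) (ricci ω₀)) * topPow (perturbed ω₀ u)) ↔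
    firstVariation ω₀ u ψ = 0 := by
  have hG := isForm_perturbed hu
  have hψp := isPotential_of_isC11 hψ
  have h1 : integral (logRatio ω₀ u * traceWrt (perturbed ω₀ u) (ddbar ψ) *
      topPow (perturbed ω₀ u)) = n * integral (logRatio ω₀ u *
      mixedPowWith (ddbar ψ) (perturbed ω₀ u) (perturbed ω₀ u) (n - 1)) := by
    rw [← integral_smul]
    refine integral_congr fun e he => ?_
    filter_upwards [trace_mul_topPow hu (ddbar ψ) e he] with z hz
    rw [mul_assoc, Pi.mul_apply, Pi.mul_apply, hz]
    simp only [Pi.smul_apply, Pi.mul_apply, smul_eq_mul]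
    ring
  have h2 : integral (localExpr ψ * (localExpr (fun _ => avgScalar ω₀) -
      traceWrt (perturbed ω₀ u) (ricci ω₀)) * topPow (perturbed ω₀ u)) =
      avgScalar ω₀ * integral (localExpr ψ * topPow (perturbed ω₀ u)) -
      n * integral (localExpr ψ *
      mixedPowWith (ricci ω₀) (perturbed ω₀ u) (perturbed ω₀ u) (n - 1)) := by
    rw [← integral_smul, ← integral_smul, ← integral_sub']
    · refine integral_congr fun e he => ?_
      filter_upwards [trace_mul_topPow hu (ricci ω₀) e he] with z hz
      simp only [Pi.mul_apply, Pi.sub_apply, Pi.smul_apply, smul_eq_mul, localExpr] at hz ⊢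
      linear_combination (-ψ (e.symm z)) * hz
    · exact (hψp.loc.mul (IsLoc.wedge fun _ => hG.loc)).const_smul _
    · exact (hψp.loc.mul (isDensity_mixedPowWith (isForm_ricci ω₀) hG).loc).const_smul _
  rw [h1, h2, firstVariation]
  constructor <;> intro h <;> linarith

/-- In dimension zero every trace is zero. This case is separate because there is no slot for
`√-1 ∂∂̄ψ`. -/
lemma avgScalar_of_eq_zero (hn : n = 0) (ω₀ : KahlerMetric n M) : avgScalar ω₀ = 0 := by
  subst hn
  have : (traceWrt ω₀.coeff (ricci ω₀) * topPow ω₀.coeff : LocalFun 0 M) =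
      (0 : ℝ) • topPow ω₀.coeff := by
    funext e z
    simp [traceWrt, Matrix.trace]
  rw [avgScalar, this, integral_smul, zero_mul, zero_div]

/-- If the first variation vanishes along smooth functions, it vanishes along functions of class
`C^{1,1}`. -/
lemma firstVariation_eq_zero_of_isC11 (hu : u ∈ HwPlus ω₀)
    (h : ∀ φ : M → ℝ, IsSmooth n φ → firstVariation ω₀ u φ = 0) (hψ : IsC11 n ψ) :
    firstVariation ω₀ u ψ = 0 := by
  have hG := isForm_perturbed hu
  rcases Nat.eq_zero_or_pos n with h0 | h0
  · simp [firstVariation, avgScalar_of_eq_zero h0 ω₀, h0]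
  have htop : IsDensity (topPow (perturbed ω₀ u)) := IsDensity.wedge fun _ => hG
  have hmix := isDensity_mixedPowWith (isForm_ricci ω₀) hG
  have hα := (htop.smul (avgScalar ω₀)).add (hmix.smul (-n : ℝ))
  have hV := (isFun_logRatio hu).smul (n : ℝ)
  have key : ∀ {φ : M → ℝ}, IsC11 n φ → firstVariation ω₀ u φ =
      integral (localExpr φ * (avgScalar ω₀ • topPow (perturbed ω₀ u) + (-n : ℝ) •
        mixedPowWith (ricci ω₀) (perturbed ω₀ u) (perturbed ω₀ u) (n - 1))) +
      integral (((n : ℝ) • logRatio ω₀ u) * fun e z => wedge (Function.update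
        (fun _ => perturbed ω₀ u e z) ⟨0, h0⟩ (ddbar φ e z))) := by
    intro φ hφ
    have hφl := (isPotential_of_isC11 hφ).loc
    have e1 : mixedPowWith (ddbar φ) (perturbed ω₀ u) (perturbed ω₀ u) (n - 1) = fun e z =>
        wedge (Function.update (fun _ => perturbed ω₀ u e z) ⟨0, h0⟩ (ddbar φ e z)) := by
      funext e z
      exact mixedPowWith_eq_update _ _ _ e z
    rw [firstVariation, ← e1, smul_mul_assoc, integral_smul, mul_add, mul_smul_comm,
      mul_smul_comm, integral_add' ((hφl.mul htop.loc).const_smul _)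
      ((hφl.mul hmix.loc).const_smul _), integral_smul, integral_smul]
    ring
  rw [key hψ]
  exact functional_eq_zero hα hV hG ⟨0, h0⟩
    (fun φ hφ => by rw [← key (isC11_of_isSmooth hφ), h φ hφ]) hψ

/-- Smooth functions are of class `C^{1,1}`, so a weak solution is a critical point at once; the
converse needs the passage from smooth test functions to those of class `C^{1,1}`. -/
lemma isWeakSolution_iff_isCriticalPoint (hu : u ∈ HwPlus ω₀) :
    IsWeakSolution ω₀ u (fun _ => avgScalar ω₀) ↔ IsCriticalPoint ω₀ u := by
  refine ⟨fun h ψ hψ => ?_, fun h ψ hψ => (weak_equation_iff hu hψ).2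
    (firstVariation_eq_zero_of_isC11 hu (fun φ hφ => ?_) hψ)⟩
  · have h1 := (weak_equation_iff hu (isC11_of_isSmooth hψ)).1 (h ψ (isC11_of_isSmooth hψ))
    exact h1 ▸ hasDerivAt_kEnergy hu hψ
  · exact (hasDerivAt_kEnergy hu hφ).unique (h φ hφ)

lemma isCriticalPoint_of_isMinOn (hu : u ∈ HwPlus ω₀)
    (hmin : IsMinOn (kEnergy ω₀) (HwPlus ω₀) u) : IsCriticalPoint ω₀ u := fun ψ hψ => by
  have h1 := hasDerivAt_kEnergy hu hψ
  have h2 : IsLocalMin (fun t : ℝ => kEnergy ω₀ fun x => u x + t * ψ x) 0 := by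
    filter_upwards [eventually_add_smul_mem_HwPlus hu hψ] with t ht
    simpa using hmin ht
  exact h2.hasDerivAt_eq_zero h1 ▸ h1

end Conclusion

end WeakCSCK

theorem mainTheorem11 {n : ℕ} {M : Type*} [TopologicalSpace M] [T2Space M] [CompactSpace M]
    [ChartedSpace (WeakCSCK.Model n) M] [IsManifold 𝓘(ℂ, WeakCSCK.Model n) ω M]
    (ω₀ : WeakCSCK.KahlerMetric n M) (u : M → ℝ) (hu : u ∈ WeakCSCK.HwPlus ω₀) :
    -- smooth variations stay in the space, and the first variation of the K-energy
    (∀ ψ : M → ℝ, WeakCSCK.IsSmooth n ψ →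
      (∀ᶠ t : ℝ in 𝓝 0, (fun x => u x + t * ψ x) ∈ WeakCSCK.HwPlus ω₀) ∧
      HasDerivAt (fun t : ℝ => WeakCSCK.kEnergy ω₀ fun x => u x + t * ψ x)
        (WeakCSCK.firstVariation ω₀ u ψ) 0) ∧
    -- weak solutions are exactly the critical points
    (WeakCSCK.IsWeakSolution ω₀ u (fun _ => WeakCSCK.avgScalar ω₀) ↔
      WeakCSCK.IsCriticalPoint ω₀ u) ∧
    -- minimizers are weak solutions
    (IsMinOn (WeakCSCK.kEnergy ω₀) (WeakCSCK.HwPlus ω₀) u →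
      WeakCSCK.IsWeakSolution ω₀ u (fun _ => WeakCSCK.avgScalar ω₀)) := by
  open WeakCSCK in
  exact ⟨fun ψ hψ => ⟨eventually_add_smul_mem_HwPlus hu hψ, hasDerivAt_kEnergy hu hψ⟩,
    isWeakSolution_iff_isCriticalPoint hu,
    fun hmin => (isWeakSolution_iff_isCriticalPoint hu).2 (isCriticalPoint_of_isMinOn hu hmin)⟩
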